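/- **The category $\mathsf{TOF}$.** $\mathsf{TOF}$ is the strict symmetric monoidal category (PROP) with objects the natural numbers ($\otimes$ is addition on objects, and wires are numbered from the top) presented by the generators $|1\rangle:0\to1$, $\langle1|:1\to0$ and the Toffoli gate $\mathsf{tof}:3\to3$ (two control wires followed by a target wire), subject to the identities below. Juxtaposition denotes diagrammatic composition, and $\circ$ classical composition. Put $\mathsf{cnot}:=(|1\rangle\otimes1_2)\,\mathsf{tof}\,(\langle1|\otimes1_2)$, $\mathsf{not}:=(|1\rangle\otimes1_1)\,\mathsf{cnot}\,(\langle1|\otimes1_1)$, $|0\rangle:=|1\rangle\,\mathsf{not}$, $\langle0|:=\mathsf{not}\,\langle1|$. For distinct wires let $[ab\to c]$ be the gate $\mathsf{tof}$ applied to the wires $a,b,c$ (in this order), and $[a\to c]$ the gate $\mathsf{cnot}$ applied to $a,c$, with symmetry maps suppressed. The identities are, with wires $0,1,2,\dots$: 1. $(|1\rangle\otimes1_2)\mathsf{tof}=|1\rangle\otimes\mathsf{cnot}$ and $\mathsf{tof}(\langle1|\otimes1_2)=\langle1|\otimes\mathsf{cnot}$; 2. $(|0\rangle\otimes1_2)\mathsf{tof}=|0\rangle\otimes1_2$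 and $\mathsf{tof}(\langle0|\otimes1_2)=\langle0|\otimes1_2$; 3. $[01\to2][43\to2]=[43\to2][01\to2]$ on $5$ wires; 4. $[21\to0][23\to4]=[23\to4][21\to0]$ on $5$ wires; 5. $[21\to0][12\to3]=[12\to3][21\to0]$ on $4$ wires; 6. $[02\to3][12\to3]=[12\to3][02\to3]$ on $4$ wires; 7. $(1_2\otimes|1\rangle)[0\to2](1_2\otimes\langle0|)\,(1_2\otimes|1\rangle)[1\to2](1_2\otimes\langle0|)=(1_2\otimes|1\rangle)\,\mathsf{tof}\,(1_2\otimes\langle0|)$; 8. $(|1\rangle\langle0|)\otimes1_1=(|1\rangle\langle0|)\otimes(\langle1|\,|1\rangle)$ (diagrammatic composites: the first is a map $0\to0$, the last a map $1\to0\to1$); 9. $|1\rangle\langle1|=1_0$ (diagrammatic composite $0\to1\to0$); 10. $\mathsf{tof}\,\mathsf{tof}=1_3$; 11. $[12\to3][01\to2][12\to3]=[01\to3][01\to2]$ on $4$ wires; 12. $[0\to1][12\to3][0\to1]=[02\to3][12\to3]$ on $4$ wires; 13. $[01\to2][12\to3][01\to2]=[01\to3][12\to3]$ on $4$ wires; 14.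 $[01\to2][2\to3][01\to2]=[01\to3][2\to3]$ on $4$ wires; 15. $[0\to1][1\to0][0\to1]$ is the symmetry $1\otimes1\to1\otimes1$; 16. $\mathsf{tof}=[10\to2]$ on $3$ wires; 17. the circuit $(1_2\otimes|0\rangle\otimes1_2)[01\to2][23\to4][01\to2](1_2\otimes\langle0|\otimes1_2):4\to4$ is unchanged by conjugation with the transposition of the wires $1$ and $2$. For a circuit $c$ let $c^\circ$ be its horizontal mirror image (composition is reversed, $|1\rangle$ and $\langle1|$ are exchanged, $\mathsf{tof}$ is fixed, wirings are inverted). The restriction of a map $f$ is $\bar f=ff^\circ$, computed from any circuit that presents $f$; an endomorphism $e$ is a *restriction idempotent* if $\bar e=e$. **Polyforms.** Let $\mathsf{cnot}_0:=\mathsf{not}$, $\mathsf{cnot}_1:=\mathsf{cnot}$, $\mathsf{cnot}_2:=\mathsf{tof}$, and for $k\ge2$ let $$\mathsf{cnot}_{k+1}:=(1_2\otimes|0\rangle\otimes1_k)(\mathsf{tof}\otimes1_k)(1_2\otimes\mathsf{cnot}_k)(\mathsf{tof}\otimes1_k)(1_2\otimes\langle0|\otimes1_k).$$ For $S\subseteq\{1,\dots,n\}$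 let $\oplus^S:n+1\to n+1$ be the gate $\mathsf{cnot}_{|S|}$ with the wires in $S$ (in increasing order) as controls and the last wire as target. A map $q:n+1\to n+1$ is in *polynomial form* if $q=\oplus^{S_1}\cdots\oplus^{S_k}$ for some finite, possibly empty, list $S_1,\dots,S_k$ of subsets of $\{1,\dots,n\}$; such a list has the polynomial $\sum_{j}\prod_{i\in S_j}x_i\in\mathbb Z_2[x_1,\dots,x_n]$. A map $e:n\to n$ in $\mathsf{TOF}$ is a *polyform* if $e=(1_n\otimes\langle0|)\circ q\circ(1_n\otimes|0\rangle)$ for some $q$ in polynomial form. **Proposition.** Polyforms are a normal form for the idempotents of $\mathsf{TOF}$. That is, for every $n\in\mathbb N$: (i) every polyform $e:n\to n$ satisfies $ee=e$ and is a restriction idempotent; (ii) every idempotent $e:n\to n$ of $\mathsf{TOF}$ is equal in $\mathsf{TOF}$ to a polyform; (iii) two polyforms $n\to n$, given by the lists $S_1,\dots,S_k$ and $S'_1,\dots,S'_l$, are equal in $\mathsf{TOF}$ if and only if the two lists have the same polynomial in $\mathbb Z_2[x_1,\dots,x_n]$. -/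

import Mathlib

open CategoryTheory

/-- Circuits with `n` input wires and `m` output wires (wires are numbered from top to bottom),
built by composition and juxtaposition from wirings and the three generators: the ancillary bit
`|1⟩`, the ancillary bit `⟨1|`, and the Toffoli gate (controls `0`, `1`, target `2`).
The wiring `perm σ` sends the input wire `i` to the output wire `σ i`. -/
inductive Circuit : ℕ → ℕ → Type
  | perm {n m : ℕ} (σ : Fin n ≃ Fin m) : Circuit n m
  | ket1 : Circuit 0 1
  | bra1 : Circuit 1 0
  | tof : Circuit 3 3
  | comp {n m k : ℕ} (f : Circuit n m) (g : Circuit m k) : Circuit n k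
  | tensor {n m n' m' : ℕ} (f : Circuit n m) (g : Circuit n' m') : Circuit (n + n') (m + m')

namespace Circuit

/-- `f ⨾ g` is composition in diagrammatic order: first `f`, then `g`. -/
scoped infixr:60 " ⨾ " => Circuit.comp

/-- `f ⊠ g` is juxtaposition: `f` on the upper wires, `g` on the lower wires. -/
scoped infixl:70 " ⊠ " => Circuit.tensor

/-- The identity circuit on `n` wires. -/
def idn (n : ℕ) : Circuit n n := perm (Equiv.refl (Fin n))

/-- The identity wiring between two equal numbers of wires. -/
def wire {n m : ℕ} (h : n = m) : Circuit n m := perm (finCongr h)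

/-- The wiring that exchanges the upper `n` wires with the lower `m` wires. -/
def swap (n m : ℕ) : Circuit (n + m) (m + n) := perm finAddFlip

/-- Juxtaposition of two wirings, as a bijection. -/
def permSum {n m n' m' : ℕ} (σ : Fin n ≃ Fin m) (τ : Fin n' ≃ Fin m') :
    Fin (n + n') ≃ Fin (m + m') :=
  (finSumFinEquiv.symm.trans (Equiv.sumCongr σ τ)).trans finSumFinEquiv

/-- For an injective choice `ι` of `k` among `n` wires: the bijection whose first `k` values are
`ι 0, …, ι (k - 1)` and whose remaining values are the other wires in increasing order. -/
def wiring {k n : ℕ} (ι : Fin k → Fin n) (h : Function.Injective ι) :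
    Fin (k + (n - k)) ≃ Fin n :=
  (finSumFinEquiv.symm.trans
    (Equiv.sumCongr (Function.Embedding.toEquivRange ⟨ι, h⟩)
      (((Finset.univ.filter fun a => a ∉ Set.range ι).orderIsoOfFin (by
          have h1 : (Finset.univ.filter fun a => a ∈ Set.range ι) = Finset.univ.image ι := by
            ext a; simp
          have h2 := Finset.card_filter_add_card_filter_not (s := (Finset.univ : Finset (Fin n)))
            (fun a => a ∈ Set.range ι)
          rw [h1, Finset.card_image_of_injective _ h, Finset.card_fin, Finset.card_fin] at h2
          omega)).toEquiv.trans
        (Equiv.subtypeEquivRight (by simp))))).trans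
  (Equiv.sumCompl fun a => a ∈ Set.range ι)

/-- The circuit on `n` wires which applies `f` to the wires `ι 0, …, ι (k - 1)`, in this order,
and leaves the other wires alone (a gate with "gaps", or with permuted wires). -/
def on {k n : ℕ} (f : Circuit k k) (ι : Fin k → Fin n)
    (h : Function.Injective ι := by decide) : Circuit n n :=
  perm (wiring ι h).symm ⨾ f ⊠ idn (n - k) ⨾ perm (wiring ι h)

/-- The controlled not gate (control `0`, target `1`). -/
def cnot : Circuit 2 2 := (ket1 ⊠ idn 2 : Circuit 2 3) ⨾ tof ⨾ (bra1 ⊠ idn 2 : Circuit 3 2)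

/-- The not gate. -/
def not : Circuit 1 1 := (ket1 ⊠ idn 1 : Circuit 1 2) ⨾ cnot ⨾ (bra1 ⊠ idn 1 : Circuit 2 1)

/-- The ancillary bit `|0⟩`. -/
def ket0 : Circuit 0 1 := ket1 ⨾ not

/-- The ancillary bit `⟨0|`. -/
def bra0 : Circuit 1 0 := not ⨾ bra1

/-- The three-fold controlled not gate (controls `0`, `1`, `2`, target `3`), realized with an
ancillary wire inserted between the wires `1` and `2`. -/
def cnot3 : Circuit 4 4 :=
  (idn 2 ⊠ ket0 ⊠ idn 2 : Circuit 4 5) ⨾ tof.on ![0, 1, 2] ⨾ tof.on ![2, 3, 4] ⨾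
    tof.on ![0, 1, 2] ⨾ (idn 2 ⊠ bra0 ⊠ idn 2 : Circuit 5 4)

/-- Equality of circuits in `TOF`: the congruence generated by the laws of a strict symmetric
monoidal category on the natural numbers and the identities of the Toffoli gate. -/
inductive Rel : {n m : ℕ} → Circuit n m → Circuit n m → Prop
  | refl {n m : ℕ} (f : Circuit n m) : Rel f f
  | symm {n m : ℕ} {f g : Circuit n m} : Rel f g → Rel g f
  | trans {n m : ℕ} {f g h : Circuit n m} : Rel f g → Rel g h → Rel f h
  | comp {n m k : ℕ} {f f' : Circuit n m} {g g' : Circuit m k} :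
      Rel f f' → Rel g g' → Rel (f ⨾ g) (f' ⨾ g')
  | tensor {n m n' m' : ℕ} {f f' : Circuit n m} {g g' : Circuit n' m'} :
      Rel f f' → Rel g g' → Rel (f ⊠ g) (f' ⊠ g')
  -- category
  | assoc {n m k l : ℕ} (f : Circuit n m) (g : Circuit m k) (h : Circuit k l) :
      Rel ((f ⨾ g) ⨾ h) (f ⨾ g ⨾ h)
  | id_comp {n m : ℕ} (f : Circuit n m) : Rel (idn n ⨾ f) f
  | comp_id {n m : ℕ} (f : Circuit n m) : Rel (f ⨾ idn m) f
  -- wirings compose and juxtapose like bijections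
  | perm_comp {n m k : ℕ} (σ : Fin n ≃ Fin m) (τ : Fin m ≃ Fin k) :
      Rel (perm σ ⨾ perm τ) (perm (σ.trans τ))
  | perm_tensor {n m n' m' : ℕ} (σ : Fin n ≃ Fin m) (τ : Fin n' ≃ Fin m') :
      Rel (perm σ ⊠ perm τ) (perm (permSum σ τ))
  -- strict symmetric monoidal structure
  | interchange {n m k n' m' k' : ℕ} (f : Circuit n m) (g : Circuit m k)
      (f' : Circuit n' m') (g' : Circuit m' k') :
      Rel ((f ⨾ g) ⊠ (f' ⨾ g')) ((f ⊠ f') ⨾ (g ⊠ g'))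
  | tensor_assoc {n₁ m₁ n₂ m₂ n₃ m₃ : ℕ} (f : Circuit n₁ m₁) (g : Circuit n₂ m₂)
      (h : Circuit n₃ m₃) :
      Rel ((f ⊠ g ⊠ h) ⨾ wire (Nat.add_assoc m₁ m₂ m₃))
        (wire (Nat.add_assoc n₁ n₂ n₃) ⨾ (f ⊠ (g ⊠ h)))
  | unit_tensor {n m : ℕ} (f : Circuit n m) :
      Rel ((idn 0 ⊠ f) ⨾ wire (Nat.zero_add m)) (wire (Nat.zero_add n) ⨾ f)
  | tensor_unit {n m : ℕ} (f : Circuit n m) : Rel (f ⊠ idn 0) f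
  | swap_natural {n m n' m' : ℕ} (f : Circuit n m) (g : Circuit n' m') :
      Rel ((f ⊠ g) ⨾ swap m m') (swap n n' ⨾ (g ⊠ f))
  -- the identities of the Toffoli gate and the ancillary bits
  | tof1 : Rel ((ket1 ⊠ idn 2 : Circuit 2 3) ⨾ tof) (ket1 ⊠ cnot : Circuit 2 3)
  | tof1' : Rel (tof ⨾ (bra1 ⊠ idn 2 : Circuit 3 2)) (bra1 ⊠ cnot : Circuit 3 2)
  | tof2 : Rel ((ket0 ⊠ idn 2 : Circuit 2 3) ⨾ tof) (ket0 ⊠ idn 2 : Circuit 2 3)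
  | tof2' : Rel (tof ⨾ (bra0 ⊠ idn 2 : Circuit 3 2)) (bra0 ⊠ idn 2 : Circuit 3 2)
  | tof3 : Rel (n := 5) (tof.on ![0, 1, 2] ⨾ tof.on ![4, 3, 2])
      (tof.on ![4, 3, 2] ⨾ tof.on ![0, 1, 2])
  | tof4 : Rel (n := 5) (tof.on ![2, 1, 0] ⨾ tof.on ![2, 3, 4])
      (tof.on ![2, 3, 4] ⨾ tof.on ![2, 1, 0])
  | tof5 : Rel (n := 4) (tof.on ![2, 1, 0] ⨾ tof.on ![1, 2, 3])
      (tof.on ![1, 2, 3] ⨾ tof.on ![2, 1, 0])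
  | tof5' : Rel (n := 4) (tof.on ![0, 2, 3] ⨾ tof.on ![1, 2, 3])
      (tof.on ![1, 2, 3] ⨾ tof.on ![0, 2, 3])
  | tof6 : Rel
      (((idn 2 ⊠ ket1 : Circuit 2 3) ⨾ cnot.on ![0, 2] ⨾ (idn 2 ⊠ bra0 : Circuit 3 2)) ⨾
        ((idn 2 ⊠ ket1 : Circuit 2 3) ⨾ cnot.on ![1, 2] ⨾ (idn 2 ⊠ bra0 : Circuit 3 2)))
      ((idn 2 ⊠ ket1 : Circuit 2 3) ⨾ tof ⨾ (idn 2 ⊠ bra0 : Circuit 3 2))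
  | tof7 : Rel ((ket1 ⨾ bra0) ⊠ idn 1 : Circuit 1 1) ((ket1 ⨾ bra0) ⊠ (bra1 ⨾ ket1) : Circuit 1 1)
  | tof8 : Rel (ket1 ⨾ bra1) (idn 0)
  | tof9 : Rel (tof ⨾ tof) (idn 3)
  | tof10 : Rel (n := 4) (tof.on ![1, 2, 3] ⨾ tof.on ![0, 1, 2] ⨾ tof.on ![1, 2, 3])
      (tof.on ![0, 1, 3] ⨾ tof.on ![0, 1, 2])
  | tof11 : Rel (n := 4) (cnot.on ![0, 1] ⨾ tof.on ![1, 2, 3] ⨾ cnot.on ![0, 1])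
      (tof.on ![0, 2, 3] ⨾ tof.on ![1, 2, 3])
  | tof12 : Rel (n := 4) (tof.on ![0, 1, 2] ⨾ tof.on ![1, 2, 3] ⨾ tof.on ![0, 1, 2])
      (tof.on ![0, 1, 3] ⨾ tof.on ![1, 2, 3])
  | tof13 : Rel (n := 4) (tof.on ![0, 1, 2] ⨾ cnot.on ![2, 3] ⨾ tof.on ![0, 1, 2])
      (tof.on ![0, 1, 3] ⨾ cnot.on ![2, 3])
  | tof14 : Rel (n := 2) (cnot.on ![0, 1] ⨾ cnot.on ![1, 0] ⨾ cnot.on ![0, 1]) (swap 1 1)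
  | tof15 : Rel tof (tof.on ![1, 0, 2])
  | tof16 : Rel cnot3 (cnot3.on ![0, 2, 1, 3])

/-- The horizontal mirror image of a circuit. -/
def dagger : {n m : ℕ} → Circuit n m → Circuit m n
  | _, _, perm σ => perm σ.symm
  | _, _, ket1 => bra1
  | _, _, bra1 => ket1
  | _, _, tof => tof
  | _, _, comp f g => g.dagger ⨾ f.dagger
  | _, _, tensor f g => f.dagger ⊠ g.dagger

/-- The not gate controlled by `n` wires: controls `0, …, n - 1`, target `n`. -/
def cnotGate : (n : ℕ) → Circuit (n + 1) (n + 1)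
  | 0 => not
  | 1 => cnot
  | 2 => tof
  | k + 3 =>
    (wire (by omega) ⨾ idn 2 ⊠ ket0 ⊠ idn (k + 2)) ⨾ tof ⊠ idn (k + 2) ⨾
      (wire (by omega) ⨾ idn 2 ⊠ cnotGate (k + 2) ⨾ wire (by omega)) ⨾
      tof ⊠ idn (k + 2) ⨾ (idn 2 ⊠ bra0 ⊠ idn (k + 2) ⨾ wire (by omega))

/-- The wires of the gate with controls `S` (among the first `n` wires) and target the last wire. -/
def targetLast {n : ℕ} (S : Finset (Fin n)) : Fin (S.card + 1) → Fin (n + 1) :=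
  Fin.snoc (α := fun _ => Fin (n + 1)) (fun i => (S.orderEmbOfFin rfl i).castSucc) (Fin.last n)

theorem targetLast_injective {n : ℕ} (S : Finset (Fin n)) :
    Function.Injective (targetLast S) := by
  refine Fin.snoc_injective_of_injective ?_ ?_
  · exact (Fin.castSucc_injective n).comp (S.orderEmbOfFin rfl).injective
  · rintro ⟨i, hi⟩
    exact Fin.castSucc_ne_last _ hi

/-- The circuit in polynomial form `c₁ ⋯ c_k` on `n + 1` wires: `cᵢ` is the controlled not gate
whose set of controls is the `i`-th entry of the list and whose target is the last wire. -/
def polyCircuit {n : ℕ} : List (Finset (Fin n)) → Circuit (n + 1) (n + 1)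
  | [] => idn (n + 1)
  | S :: l => (cnotGate S.card).on (targetLast S) (targetLast_injective S) ⨾ polyCircuit l

/-- The polynomial `∑_S ∏_{i ∈ S} xᵢ` over `ℤ/2` in `n` variables that belongs to a list of sets of
control wires. -/
noncomputable def polynomial {n : ℕ} (l : List (Finset (Fin n))) : MvPolynomial (Fin n) (ZMod 2) :=
  (l.map fun S => ∏ i ∈ S, MvPolynomial.X i).sum

/-- Circuits from `n` to `m` wires up to equality in `TOF`. -/
def setoid (n m : ℕ) : Setoid (Circuit n m) where
  r := Rel
  iseqv := ⟨Rel.refl, Rel.symm, Rel.trans⟩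

end Circuit

/-- The objects of the category `TOF`: natural numbers. -/
structure TOF where
  /-- the number of wires -/
  wires : ℕ

namespace TOF

open scoped Circuit

/-- The maps of `TOF` are circuits modulo the identities of `TOF`. -/
instance : Category TOF where
  Hom A B := Quotient (Circuit.setoid A.wires B.wires)
  id A := Quotient.mk _ (Circuit.idn A.wires)
  comp f g := Quotient.map₂ Circuit.comp (fun _ _ h _ _ h' => Circuit.Rel.comp h h') f g
  id_comp f := Quotient.inductionOn f fun c => Quotient.sound (Circuit.Rel.id_comp c)
  comp_id f := Quotient.inductionOn f fun c => Quotient.sound (Circuit.Rel.comp_id c)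
  assoc f g h := Quotient.inductionOn₃ f g h fun a b c => Quotient.sound (Circuit.Rel.assoc a b c)

/-- The map of `TOF` presented by a circuit. -/
def ofCircuit {n m : ℕ} (c : Circuit n m) : mk n ⟶ mk m :=
  Quotient.mk (Circuit.setoid n m) c

/-- `r` is the restriction `f f°` of `f`, where `f°` is obtained by horizontally flipping circuits:
whatever circuit `c` presents `f`, the circuit "`c`, then the mirror image of `c`" presents `r`. -/
def IsRestriction {n m : ℕ} (f : mk n ⟶ mk m) (r : mk n ⟶ mk n) : Prop :=
  ∀ c : Circuit n m, ofCircuit c = f → ofCircuit (c ⨾ c.dagger) = r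

/-- A restriction idempotent is an endomorphism which is its own restriction. -/
def IsRestrictionIdempotent {n : ℕ} (e : mk n ⟶ mk n) : Prop :=
  IsRestriction e e

/-- A map on `n + 1` wires is in polynomial form if it is a composite of controlled not gates, each
with some of the first `n` wires as controls and with the last wire as target. -/
def IsPolynomialForm {n : ℕ} (q : mk (n + 1) ⟶ mk (n + 1)) : Prop :=
  ∃ l : List (Finset (Fin n)), q = ofCircuit (Circuit.polyCircuit l)

/-- The map `(1ₙ ⊗ ⟨0|) ∘ q ∘ (1ₙ ⊗ |0⟩)`. -/
def sandwichZero {n : ℕ} (q : mk (n + 1) ⟶ mk (n + 1)) : mk n ⟶ mk n :=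
  ofCircuit (Circuit.idn n ⊠ Circuit.ket0) ≫ q ≫ ofCircuit (Circuit.idn n ⊠ Circuit.bra0)

/-- Polyforms. -/
def IsPolyform {n : ℕ} (e : mk n ⟶ mk n) : Prop :=
  ∃ q : mk (n + 1) ⟶ mk (n + 1), IsPolynomialForm q ∧ e = sandwichZero q

end TOF

/-! Call a gate on `n + 1` wires an oracle if it is built from the constants and the variables by
sums and products of functions of the first `n` wires, added to the last wire. The sum of two
oracles is their composite. The product computes both factors on two fresh wires with value 0,
applies a Toffoli gate, and uncomputes the factors. The identities of TOF make the oracles a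
commutative ring `Oracle n` in which U + U = 0 and U * U = U; associativity is the content of
`Rel.tof16`. The variables generate this ring, so every oracle is a sum of squarefree monomials. By
`ofCircuit_cnotGate` the monomials are the multiply controlled not gates. Hence oracles are exactly
the maps in polynomial form, and polyforms are exactly the maps `zeroTest U`: start the last wire at
0, apply U, keep the value 0.

These maps are commuting idempotents, closed under composition, because testing a product for 1 is
testing both factors for 1 (`test_mul`). Moreover oracles can be pulled back along any map f: for
every U there is U' such that f followed by U is U' followed by f (`Tracks`); since variables
generate, only variables and generating circuits need to be examined. Induction on circuits then
shows that c c° is a `zeroTest` and that c c° c = c (`partialInverse_dagger`).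

If e e = e, then e° = e° e e° = (e° e)(e e°) is a composite of two such maps, hence itself a
`zeroTest` and idempotent. The same argument applied to e° shows that e is a `zeroTest`, that is, a
polyform.

For uniqueness, substitution of variables is a ring homomorphism `ofPoly` from polynomials to
oracles, so equal polynomials give equal polyforms. Conversely, precomposing with a point x replaces
the polynomial by its value at x, and the two possible scalars 0 → 0 differ because TOF has a sound
interpretation `eval` in partial functions on bits. The polynomials in question have degree at most
1 in each variable, so their values determine them. -/

namespace TOF

open Circuit

/-! ### Calculus of gates placed on chosen wires. -/

/-- Endomorphisms of `n` wires. -/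
abbrev Gate (n : ℕ) := mk n ⟶ mk n

/-- Gates form a monoid under diagrammatic composition. -/
instance (n : ℕ) : Monoid (mk n ⟶ mk n) where
  mul f g := f ≫ g
  one := 𝟙 _
  mul_assoc f g h := Category.assoc f g h
  one_mul f := Category.id_comp f
  mul_one f := Category.comp_id f

theorem mul_eq {n : ℕ} (f g : Gate n) : f * g = f ≫ g := rfl

theorem one_eq (n : ℕ) : (1 : Gate n) = 𝟙 (mk n) := rfl

theorem ofCircuit_eq {n m : ℕ} {c d : Circuit n m} (h : Rel c d) : ofCircuit c = ofCircuit d :=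
  Quotient.sound h

theorem rel_of_ofCircuit_eq {n m : ℕ} {c d : Circuit n m} (h : ofCircuit c = ofCircuit d) :
    Rel c d :=
  Quotient.exact h

theorem exists_ofCircuit {n m : ℕ} (f : mk n ⟶ mk m) : ∃ c, ofCircuit c = f :=
  Quotient.exists_rep f

/-- The wiring of a bijection. -/
def pm {n m : ℕ} (σ : Fin n ≃ Fin m) : mk n ⟶ mk m := ofCircuit (perm σ)

/-- Juxtaposition of maps. -/
def tens {n m n' m' : ℕ} (f : mk n ⟶ mk m) (g : mk n' ⟶ mk m') :
    mk (n + n') ⟶ mk (m + m') :=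
  Quotient.map₂ Circuit.tensor (fun _ _ h _ _ h' => Circuit.Rel.tensor h h') f g

scoped infixl:75 " ⊗' " => TOF.tens

theorem ofCircuit_comp {n m k : ℕ} (f : Circuit n m) (g : Circuit m k) :
    ofCircuit (f ⨾ g) = ofCircuit f ≫ ofCircuit g := rfl

theorem pm_refl (n : ℕ) : pm (Equiv.refl (Fin n)) = 𝟙 (mk n) := rfl

theorem pm_comp {n m k : ℕ} (σ : Fin n ≃ Fin m) (τ : Fin m ≃ Fin k) :
    pm σ ≫ pm τ = pm (σ.trans τ) :=
  ofCircuit_eq (Rel.perm_comp σ τ)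

@[simp] theorem pm_symm_comp {n m : ℕ} (σ : Fin n ≃ Fin m) : pm σ.symm ≫ pm σ = 𝟙 _ := by
  rw [pm_comp, Equiv.symm_trans_self, pm_refl]

@[simp] theorem pm_comp_symm {n m : ℕ} (σ : Fin n ≃ Fin m) : pm σ ≫ pm σ.symm = 𝟙 _ := by
  rw [pm_comp, Equiv.self_trans_symm, pm_refl]

@[simp] theorem pm_symm_comp_assoc {n m k : ℕ} (σ : Fin n ≃ Fin m) (f : mk m ⟶ mk k) :
    pm σ.symm ≫ pm σ ≫ f = f := by
  rw [← Category.assoc, pm_symm_comp, Category.id_comp]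

@[simp] theorem pm_comp_symm_assoc {n m k : ℕ} (σ : Fin n ≃ Fin m) (f : mk n ⟶ mk k) :
    pm σ ≫ pm σ.symm ≫ f = f := by
  rw [← Category.assoc, pm_comp_symm, Category.id_comp]

theorem tens_comp {n m k n' m' k' : ℕ} (f : mk n ⟶ mk m) (g : mk m ⟶ mk k)
    (f' : mk n' ⟶ mk m') (g' : mk m' ⟶ mk k') :
    (f ≫ g) ⊗' (f' ≫ g') = (f ⊗' f') ≫ (g ⊗' g') := by
  obtain ⟨f, rfl⟩ := exists_ofCircuit f
  obtain ⟨g, rfl⟩ := exists_ofCircuit g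
  obtain ⟨f', rfl⟩ := exists_ofCircuit f'
  obtain ⟨g', rfl⟩ := exists_ofCircuit g'
  exact ofCircuit_eq (Rel.interchange f g f' g')

theorem pm_tens {n m n' m' : ℕ} (σ : Fin n ≃ Fin m) (τ : Fin n' ≃ Fin m') :
    pm σ ⊗' pm τ = pm (permSum σ τ) :=
  ofCircuit_eq (Rel.perm_tensor σ τ)

@[simp] theorem permSum_castAdd {n m n' m' : ℕ} (σ : Fin n ≃ Fin m) (τ : Fin n' ≃ Fin m')
    (i : Fin n) : permSum σ τ (Fin.castAdd n' i) = Fin.castAdd m' (σ i) := by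
  simp [permSum]

@[simp] theorem permSum_natAdd {n m n' m' : ℕ} (σ : Fin n ≃ Fin m) (τ : Fin n' ≃ Fin m')
    (i : Fin n') : permSum σ τ (Fin.natAdd n i) = Fin.natAdd m (τ i) := by
  simp [permSum]

theorem id_tens_id (n m : ℕ) : 𝟙 (mk n) ⊗' 𝟙 (mk m) = 𝟙 (mk (n + m)) := by
  rw [← pm_refl, ← pm_refl, pm_tens, ← pm_refl]
  congr 1
  ext i
  induction i using Fin.addCases <;> simp

theorem tens_assoc {n₁ m₁ n₂ m₂ n₃ m₃ : ℕ} (f : mk n₁ ⟶ mk m₁) (g : mk n₂ ⟶ mk m₂)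
    (h : mk n₃ ⟶ mk m₃) :
    (f ⊗' g ⊗' h) ≫ pm (finCongr (Nat.add_assoc m₁ m₂ m₃)) =
      pm (finCongr (Nat.add_assoc n₁ n₂ n₃)) ≫ (f ⊗' (g ⊗' h)) := by
  obtain ⟨f, rfl⟩ := exists_ofCircuit f
  obtain ⟨g, rfl⟩ := exists_ofCircuit g
  obtain ⟨h, rfl⟩ := exists_ofCircuit h
  exact ofCircuit_eq (Rel.tensor_assoc f g h)

theorem tens_assoc' {n₁ m₁ n₂ m₂ n₃ m₃ : ℕ} (f : mk n₁ ⟶ mk m₁) (g : mk n₂ ⟶ mk m₂)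
    (h : mk n₃ ⟶ mk m₃) :
    f ⊗' g ⊗' h =
      pm (finCongr (Nat.add_assoc n₁ n₂ n₃)) ≫ (f ⊗' (g ⊗' h)) ≫
        pm (finCongr (Nat.add_assoc m₁ m₂ m₃)).symm := by
  rw [← Category.assoc, ← tens_assoc, Category.assoc, pm_comp_symm, Category.comp_id]

theorem tens_unit {n m : ℕ} (f : mk n ⟶ mk m) : f ⊗' 𝟙 (mk 0) = f := by
  obtain ⟨f, rfl⟩ := exists_ofCircuit f
  exact ofCircuit_eq (Rel.tensor_unit f)

theorem unit_tens {n m : ℕ} (f : mk n ⟶ mk m) :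
    (𝟙 (mk 0) ⊗' f) ≫ pm (finCongr (Nat.zero_add m)) = pm (finCongr (Nat.zero_add n)) ≫ f := by
  obtain ⟨f, rfl⟩ := exists_ofCircuit f
  exact ofCircuit_eq (Rel.unit_tensor f)

theorem swap_natural {n m n' m' : ℕ} (f : mk n ⟶ mk m) (g : mk n' ⟶ mk m') :
    (f ⊗' g) ≫ pm (finAddFlip (m := m) (n := m')) = pm (finAddFlip (m := n) (n := n')) ≫ (g ⊗' f) := by
  obtain ⟨f, rfl⟩ := exists_ofCircuit f
  obtain ⟨g, rfl⟩ := exists_ofCircuit g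
  exact ofCircuit_eq (Rel.swap_natural f g)

theorem tens_eq_comp {n m n' m' : ℕ} (f : mk n ⟶ mk m) (g : mk n' ⟶ mk m') :
    f ⊗' g = (f ⊗' 𝟙 (mk n')) ≫ (𝟙 (mk m) ⊗' g) := by
  rw [← tens_comp, Category.comp_id, Category.id_comp]

theorem tens_eq_comp' {n m n' m' : ℕ} (f : mk n ⟶ mk m) (g : mk n' ⟶ mk m') :
    f ⊗' g = (𝟙 (mk n) ⊗' g) ≫ (f ⊗' 𝟙 (mk m')) := by
  rw [← tens_comp, Category.comp_id, Category.id_comp]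

theorem tens_id_comp {n m k : ℕ} (f : mk n ⟶ mk m) (g : mk m ⟶ mk k) (r : ℕ) :
    (f ≫ g) ⊗' 𝟙 (mk r) = (f ⊗' 𝟙 (mk r)) ≫ (g ⊗' 𝟙 (mk r)) := by
  rw [← tens_comp, Category.comp_id]

theorem id_tens_comp {n m k : ℕ} (f : mk n ⟶ mk m) (g : mk m ⟶ mk k) (r : ℕ) :
    𝟙 (mk r) ⊗' (f ≫ g) = (𝟙 (mk r) ⊗' f) ≫ (𝟙 (mk r) ⊗' g) := by
  rw [← tens_comp, Category.comp_id]

/-- The gate `f` on the wires `σ 0, …, σ (k - 1)`. -/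
def place {k r n : ℕ} (σ : Fin (k + r) ≃ Fin n) (f : Gate k) : Gate n :=
  pm σ.symm ≫ (f ⊗' 𝟙 (mk r)) ≫ pm σ

/-- The two wirings differ by a bijection that fixes the first `k` wires and permutes the idle ones.
Such a bijection is a juxtaposition with the identity, so it slides past `f` by interchange and
cancels against its inverse. -/
theorem place_congr {k r n : ℕ} {σ τ : Fin (k + r) ≃ Fin n}
    (h : ∀ i, σ (Fin.castAdd r i) = τ (Fin.castAdd r i)) (f : Gate k) : place σ f = place τ f := by
  let ρ : Fin (k + r) ≃ Fin (k + r) := σ.trans τ.symm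
  have h1 : ∀ i, ρ (Fin.castAdd r i) = Fin.castAdd r i := fun i => by simp [ρ, h]
  have h2 : ∀ i : Fin r, ∃ j : Fin r, ρ (Fin.natAdd k i) = Fin.natAdd k j := by
    intro i
    generalize hx : ρ (Fin.natAdd k i) = x
    induction x using Fin.addCases with
    | left j =>
      rw [← h1 j] at hx
      have := ρ.injective hx
      simp [Fin.ext_iff] at this
      omega
    | right j => exact ⟨j, rfl⟩
  choose t ht using h2
  have tinj : Function.Injective t := by
    intro i j hij
    have : ρ (Fin.natAdd k i) = ρ (Fin.natAdd k j) := by rw [ht, ht, hij]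
    simpa using ρ.injective this
  let t' : Fin r ≃ Fin r := Equiv.ofBijective t (Finite.injective_iff_bijective.1 tinj)
  have hρ : ρ = permSum (Equiv.refl _) t' := by
    ext i
    induction i using Fin.addCases with
    | left i => simp [h1]
    | right i => simp [ht, t']
  have hσ : σ = ρ.trans τ := by ext; simp [ρ]
  have hσ' : σ.symm = τ.symm.trans ρ.symm := by rw [hσ]; rfl
  unfold place
  have h3 : pm ρ.symm ≫ (f ⊗' 𝟙 (mk r)) ≫ pm ρ = f ⊗' 𝟙 (mk r) := by
    have h4 : pm ρ.symm = 𝟙 (mk k) ⊗' pm t'.symm := by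
      rw [← pm_refl, pm_tens, hρ]
      rfl
    have h5 : pm ρ = 𝟙 (mk k) ⊗' pm t' := by
      rw [← pm_refl, pm_tens, hρ]
    rw [h4, h5, ← tens_comp, ← tens_comp]
    simp
  rw [hσ', hσ, ← pm_comp, ← pm_comp]
  conv_rhs => rw [← h3]
  simp only [Category.assoc]

theorem place_mul {k r n : ℕ} (σ : Fin (k + r) ≃ Fin n) (f g : Gate k) :
    place σ (f * g) = place σ f * place σ g := by
  simp only [place, mul_eq, tens_id_comp, Category.assoc, pm_comp_symm_assoc]

theorem place_one {k r n : ℕ} (σ : Fin (k + r) ≃ Fin n) : place σ (1 : Gate k) = 1 := by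
  simp only [place, one_eq, id_tens_id, Category.id_comp, pm_symm_comp]

theorem wiring_castAdd {k n : ℕ} (ι : Fin k → Fin n) (h : Function.Injective ι) (i : Fin k) :
    wiring ι h (Fin.castAdd (n - k) i) = ι i := by
  simp [wiring]
  rfl

open Classical in
/-- The gate on `n` wires which applies a gate to the wires `ι 0, …, ι (k - 1)` (trivial if `ι` is
not injective). -/
noncomputable def on {k n : ℕ} (ι : Fin k → Fin n) : Gate k →* Gate n :=
  if h : Function.Injective ι then
    { toFun := place (wiring ι h)
      map_one' := place_one _
      map_mul' := place_mul _ }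
  else 1

theorem on_eq_place_wiring {k n : ℕ} {ι : Fin k → Fin n} (h : Function.Injective ι) (f : Gate k) :
    on ι f = place (wiring ι h) f := by
  rw [on, dif_pos h]; rfl

theorem ofCircuit_on {k n : ℕ} (f : Circuit k k) (ι : Fin k → Fin n) (h : Function.Injective ι) :
    ofCircuit (f.on ι h) = on ι (ofCircuit f) := by
  rw [on_eq_place_wiring h]; rfl

/-- Any bijection extending `ι` may be used in place of the specific `wiring`; everything below
relies on this freedom. -/
theorem on_eq_place {k r n : ℕ} {ι : Fin k → Fin n} (σ : Fin (k + r) ≃ Fin n)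
    (h : ∀ i, σ (Fin.castAdd r i) = ι i) (f : Gate k) : on ι f = place σ f := by
  have hι : Function.Injective ι := by
    intro i j hij
    rw [← h, ← h] at hij
    simpa using σ.injective hij
  have hc : k + r = n := by simpa using Fintype.card_congr σ
  obtain rfl : r = n - k := by omega
  rw [on_eq_place_wiring hι]
  exact place_congr (fun i => by rw [wiring_castAdd, h]) f

theorem on_castAdd {k : ℕ} (r : ℕ) (f : Gate k) :
    on (Fin.castAdd r) f = f ⊗' 𝟙 (mk r) := by
  rw [on_eq_place (ι := Fin.castAdd r) (Equiv.refl (Fin (k + r))) (fun i => rfl)]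
  simp [place, pm_refl]

theorem on_castSucc {k : ℕ} (f : Gate k) :
    on Fin.castSucc f = f ⊗' 𝟙 (mk 1) :=
  on_castAdd 1 f

theorem on_natAdd {k : ℕ} (r : ℕ) (f : Gate k) :
    on (Fin.natAdd r) f = 𝟙 (mk r) ⊗' f := by
  rw [on_eq_place (finAddFlip (m := k) (n := r)) (fun i => by simp)]
  rw [place, swap_natural, pm_symm_comp_assoc]

theorem on_equiv {k n : ℕ} (σ : Fin k ≃ Fin n) (f : Gate k) :
    on σ f = pm σ.symm ≫ f ≫ pm σ := by
  rw [on_eq_place (ι := σ) (r := 0) σ (fun i => rfl)]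
  simp [place, tens_unit]

theorem place_place {k r m s n : ℕ} (σ : Fin (k + r) ≃ Fin m) (τ : Fin (m + s) ≃ Fin n)
    (f : Gate k) :
    place τ (place σ f) = place (((finCongr (Nat.add_assoc k r s)).symm.trans
      (permSum σ (Equiv.refl (Fin s)))).trans τ) f := by
  have h1 : (pm σ ⊗' 𝟙 (mk s)) = pm (permSum σ (Equiv.refl (Fin s))) := by
    rw [← pm_refl, pm_tens]
  have h2 : (pm σ.symm ⊗' 𝟙 (mk s)) = pm (permSum σ (Equiv.refl (Fin s))).symm := by
    rw [← pm_refl, pm_tens]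
    rfl
  simp only [place, tens_id_comp]
  rw [h1, h2, tens_assoc', id_tens_id]
  have h3 : (((finCongr (Nat.add_assoc k r s)).symm.trans
      (permSum σ (Equiv.refl (Fin s)))).trans τ).symm = τ.symm.trans
      ((permSum σ (Equiv.refl (Fin s))).symm.trans (finCongr (Nat.add_assoc k r s))) := rfl
  rw [h3]
  simp only [Category.assoc, ← pm_comp]

theorem exists_extend {k n : ℕ} {ι : Fin k → Fin n} (h : Function.Injective ι) :
    ∃ (r : ℕ) (σ : Fin (k + r) ≃ Fin n), ∀ i, σ (Fin.castAdd r i) = ι i :=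
  ⟨_, wiring ι h, wiring_castAdd ι h⟩

theorem on_on {k m n : ℕ} {κ : Fin k → Fin m} {ι : Fin m → Fin n} (hκ : Function.Injective κ)
    (hι : Function.Injective ι) (f : Gate k) : on ι (on κ f) = on (ι ∘ κ) f := by
  obtain ⟨r, σ, hσ⟩ := exists_extend hκ
  obtain ⟨s, τ, hτ⟩ := exists_extend hι
  rw [on_eq_place σ hσ, on_eq_place τ hτ, place_place]
  refine (on_eq_place _ (fun i => ?_) f).symm
  have : (finCongr (Nat.add_assoc k r s)).symm (Fin.castAdd (r + s) i) =
      Fin.castAdd s (Fin.castAdd r i) := by ext; simp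
  simp only [Equiv.trans_apply, this, permSum_castAdd, hσ, hτ, Function.comp_apply]

/-- The two choices of wires join to one injection of `k + l` wires, and there the claim is the
interchange law for `f` above `g`. -/
theorem commute_on {k l n : ℕ} {ι : Fin k → Fin n} {κ : Fin l → Fin n} (hι : Function.Injective ι)
    (hκ : Function.Injective κ) (h : ∀ i j, ι i ≠ κ j) (f : Gate k) (g : Gate l) :
    Commute (on ι f) (on κ g) := by
  let ρ : Fin (k + l) → Fin n := Fin.addCases ι κ
  have h1 : ρ ∘ Fin.castAdd l = ι := by ext; simp [ρ]
  have h2 : ρ ∘ Fin.natAdd k = κ := by ext; simp [ρ]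
  have hρ : Function.Injective ρ := by
    intro i j hij
    induction i using Fin.addCases <;> induction j using Fin.addCases <;>
      simp only [ρ, Fin.addCases_left, Fin.addCases_right] at hij
    · rw [hι hij]
    · exact absurd hij (h _ _)
    · exact absurd hij.symm (h _ _)
    · rw [hκ hij]
  rw [← h1, ← h2, ← on_on (Fin.castAdd_injective _ _) hρ, ← on_on (Fin.natAdd_injective _ _) hρ]
  refine Commute.map ?_ _
  rw [on_castAdd, on_natAdd, Commute, SemiconjBy, mul_eq, mul_eq, ← tens_eq_comp, ← tens_eq_comp']

end TOF

/-! ### The generators as gates, and cancellation of an ancilla. -/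

namespace TOF

open Circuit

theorem on_id {k : ℕ} (f : Gate k) : on id f = f := by
  rw [on_eq_place (ι := id) (r := 0) (Equiv.refl _) (fun i => rfl)]
  simp [place, tens_unit, pm_refl]

/-- The ancillary bits and the gates as maps of `TOF`. -/
def k1 : mk 0 ⟶ mk 1 := ofCircuit ket1
def b1 : mk 1 ⟶ mk 0 := ofCircuit bra1
def k0 : mk 0 ⟶ mk 1 := ofCircuit ket0
def b0 : mk 1 ⟶ mk 0 := ofCircuit bra0
def notG : Gate 1 := ofCircuit Circuit.not
def cnotG : Gate 2 := ofCircuit Circuit.cnot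
def tofG : Gate 3 := ofCircuit Circuit.tof

theorem k1_b1 : k1 ≫ b1 = 𝟙 _ := ofCircuit_eq Rel.tof8

theorem k0_eq : k0 = k1 ≫ notG := rfl

theorem b0_eq : b0 = notG ≫ b1 := rfl

variable {N : ℕ}

/-- The Toffoli gate with controls `a`, `b` and target `c`. -/
noncomputable def T (a b c : Fin N) : Gate N := on ![a, b, c] tofG

/-- The controlled not gate with control `a` and target `c`. -/
noncomputable def C (a c : Fin N) : Gate N := on ![a, c] cnotG

/-- The not gate on the wire `a`. -/
noncomputable def X (a : Fin N) : Gate N := on ![a] notG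

/-- The restriction to the value `0` on the wire `a`. -/
noncomputable def z (a : Fin N) : Gate N := on ![a] (b0 ≫ k0)

/-- The restriction to the value `1` on the wire `a`. -/
noncomputable def o (a : Fin N) : Gate N := on ![a] (b1 ≫ k1)

theorem injective_vecCons {α : Type*} {k : ℕ} {a : α} {v : Fin k → α} :
    Function.Injective (Matrix.vecCons a v) ↔ (∀ i, a ≠ v i) ∧ Function.Injective v := by
  rw [Matrix.vecCons, Fin.cons_injective_iff]
  simp [eq_comm]

theorem injective_vec1 {α : Type*} (a : α) : Function.Injective ![a] :=
  Function.injective_of_subsingleton _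

theorem injective_vec2 {α : Type*} {a b : α} : Function.Injective ![a, b] ↔ a ≠ b := by
  simp [injective_vecCons, Function.injective_of_subsingleton]

theorem injective_vec3 {α : Type*} {a b c : α} :
    Function.Injective ![a, b, c] ↔ a ≠ b ∧ a ≠ c ∧ b ≠ c := by
  simp [injective_vecCons, Function.injective_of_subsingleton, Fin.forall_fin_succ, and_assoc]

theorem injective_vec4 {α : Type*} {a b c d : α} :
    Function.Injective ![a, b, c, d] ↔ a ≠ b ∧ a ≠ c ∧ a ≠ d ∧ b ≠ c ∧ b ≠ d ∧ c ≠ d := by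
  simp [injective_vecCons, Function.injective_of_subsingleton, Fin.forall_fin_succ, and_assoc]

theorem injective_vec5 {α : Type*} {a b c d e : α} :
    Function.Injective ![a, b, c, d, e] ↔ a ≠ b ∧ a ≠ c ∧ a ≠ d ∧ a ≠ e ∧ b ≠ c ∧ b ≠ d ∧ b ≠ e ∧
      c ≠ d ∧ c ≠ e ∧ d ≠ e := by
  simp [injective_vecCons, Function.injective_of_subsingleton, Fin.forall_fin_succ, and_assoc]

theorem comp_vec1 {α β : Type*} (f : α → β) (a : α) : f ∘ ![a] = ![f a] := by
  ext i; fin_cases i; rfl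

theorem comp_vec2 {α β : Type*} (f : α → β) (a b : α) : f ∘ ![a, b] = ![f a, f b] := by
  ext i; fin_cases i <;> rfl

theorem comp_vec3 {α β : Type*} (f : α → β) (a b c : α) : f ∘ ![a, b, c] = ![f a, f b, f c] := by
  ext i; fin_cases i <;> rfl

section maps

variable {n : ℕ} {ι : Fin n → Fin N}

theorem on_T (h : Function.Injective ι) {a b c : Fin n} (hab : a ≠ b) (hac : a ≠ c)
    (hbc : b ≠ c) : on ι (T a b c) = T (ι a) (ι b) (ι c) := by
  rw [T, on_on (injective_vec3.2 ⟨hab, hac, hbc⟩) h, comp_vec3, T]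

theorem on_C (h : Function.Injective ι) {a c : Fin n} (hac : a ≠ c) :
    on ι (C a c) = C (ι a) (ι c) := by
  rw [C, on_on (injective_vec2.2 hac) h, comp_vec2, C]

theorem on_X (h : Function.Injective ι) (a : Fin n) : on ι (X a) = X (ι a) := by
  rw [X, on_on (injective_vec1 _) h, comp_vec1, X]

theorem on_z (h : Function.Injective ι) (a : Fin n) : on ι (z a) = z (ι a) := by
  rw [z, on_on (injective_vec1 _) h, comp_vec1, z]

theorem on_o (h : Function.Injective ι) (a : Fin n) : on ι (o a) = o (ι a) := by
  rw [o, on_on (injective_vec1 _) h, comp_vec1, o]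

end maps

theorem T_012 : (T 0 1 2 : Gate 3) = tofG := by
  rw [T, show (![0, 1, 2] : Fin 3 → Fin 3) = id by ext i; fin_cases i <;> rfl, on_id]

theorem C_01 : (C 0 1 : Gate 2) = cnotG := by
  rw [C, show (![0, 1] : Fin 2 → Fin 2) = id by ext i; fin_cases i <;> rfl, on_id]

theorem X_0 : (X 0 : Gate 1) = notG := by
  rw [X, show (![0] : Fin 1 → Fin 1) = id by ext i; fin_cases i; rfl, on_id]

theorem on_zero_succ (r : ℕ) (f : Gate 1) :
    on ![(0 : Fin (1 + r))] f = f ⊗' 𝟙 (mk r) := by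
  rw [← on_castAdd]
  congr 2
  ext i; fin_cases i; rfl

theorem o_mul_T_base : (o 0 * T 0 1 2 : Gate 3) = o 0 * C 1 2 := by
  have e : (k1 ⊗' 𝟙 (mk 2)) ≫ (tofG : Gate (1 + 2)) = k1 ⊗' cnotG := ofCircuit_eq Rel.tof1
  have e1 : (o 0 : Gate 3) = (b1 ≫ k1) ⊗' 𝟙 (mk 2) := on_zero_succ 2 _
  have e2 : (C 1 2 : Gate 3) = 𝟙 (mk 1) ⊗' cnotG := by
    rw [← on_natAdd, C]
    congr 2
    ext i; fin_cases i <;> rfl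
  rw [T_012, e1, e2, mul_eq, mul_eq]
  have e3 : ((b1 ≫ k1) ⊗' 𝟙 (mk 2)) ≫ (tofG : Gate (1 + 2)) =
      ((b1 ≫ k1) ⊗' 𝟙 (mk 2)) ≫ (𝟙 (mk 1) ⊗' cnotG) := by
    rw [tens_id_comp, Category.assoc, e, Category.assoc, ← tens_comp k1]
    simp
  exact e3

theorem T_mul_o_base : (T 0 1 2 * o 0 : Gate 3) = C 1 2 * o 0 := by
  have e : (tofG : Gate (1 + 2)) ≫ (b1 ⊗' 𝟙 (mk 2)) = b1 ⊗' cnotG := ofCircuit_eq Rel.tof1'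
  have e1 : (o 0 : Gate 3) = (b1 ≫ k1) ⊗' 𝟙 (mk 2) := on_zero_succ 2 _
  have e2 : (C 1 2 : Gate 3) = 𝟙 (mk 1) ⊗' cnotG := by
    rw [← on_natAdd, C]
    congr 2
    ext i; fin_cases i <;> rfl
  rw [T_012, e1, e2, mul_eq, mul_eq]
  have e3 : (tofG : Gate (1 + 2)) ≫ ((b1 ≫ k1) ⊗' 𝟙 (mk 2)) =
      (𝟙 (mk 1) ⊗' cnotG) ≫ ((b1 ≫ k1) ⊗' 𝟙 (mk 2)) := by
    rw [tens_id_comp, ← Category.assoc, e, ← Category.assoc, ← tens_comp (𝟙 (mk 1))]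
    simp
  exact e3

theorem z_mul_T_base : (z 0 * T 0 1 2 : Gate 3) = z 0 := by
  have e : (k0 ⊗' 𝟙 (mk 2)) ≫ (tofG : Gate (1 + 2)) = k0 ⊗' 𝟙 (mk 2) := ofCircuit_eq Rel.tof2
  have e1 : (z 0 : Gate 3) = (b0 ≫ k0) ⊗' 𝟙 (mk 2) := on_zero_succ 2 _
  rw [T_012, e1, mul_eq]
  have e3 : ((b0 ≫ k0) ⊗' 𝟙 (mk 2)) ≫ (tofG : Gate (1 + 2)) = (b0 ≫ k0) ⊗' 𝟙 (mk 2) := by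
    rw [tens_id_comp, Category.assoc, e]
  exact e3

theorem T_mul_z_base : (T 0 1 2 * z 0 : Gate 3) = z 0 := by
  have e : (tofG : Gate (1 + 2)) ≫ (b0 ⊗' 𝟙 (mk 2)) = b0 ⊗' 𝟙 (mk 2) := ofCircuit_eq Rel.tof2'
  have e1 : (z 0 : Gate 3) = (b0 ≫ k0) ⊗' 𝟙 (mk 2) := on_zero_succ 2 _
  rw [T_012, e1, mul_eq]
  have e3 : (tofG : Gate (1 + 2)) ≫ ((b0 ≫ k0) ⊗' 𝟙 (mk 2)) = (b0 ≫ k0) ⊗' 𝟙 (mk 2) := by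
    rw [tens_id_comp, ← Category.assoc, e]
  exact e3

/-- The not gate is defined as cnot between |1⟩ and ⟨1|, which yields only this two-sided form. The
one-sided form `o_mul_C_base` needs a third wire. -/
theorem o_C_o_base : (o 0 * C 0 1 * o 0 : Gate 2) = o 0 * X 1 := by
  have e : (k1 ⊗' 𝟙 (mk 1)) ≫ (cnotG : Gate (1 + 1)) ≫ (b1 ⊗' 𝟙 (mk 1)) =
      (𝟙 (mk 0) ⊗' notG : mk (0 + 1) ⟶ mk (0 + 1)) := by
    have h := unit_tens notG
    have h2 : ∀ h : 0 + 1 = 1, pm (finCongr h) = 𝟙 (mk 1) := fun h => by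
      rw [← pm_refl]; congr 1
    rw [h2] at h
    refine Eq.trans ?_ ((Category.id_comp _).symm.trans (h.symm.trans (Category.comp_id _)))
    rfl
  have e1 : (o 0 : Gate 2) = (b1 ≫ k1) ⊗' 𝟙 (mk 1) := on_zero_succ 1 _
  have e2 : (X 1 : Gate 2) = 𝟙 (mk 1) ⊗' notG := by
    rw [← on_natAdd, X]
    congr 2
    ext i; fin_cases i; rfl
  rw [C_01, e1, e2, mul_eq, mul_eq, mul_eq]
  have e3 : (((b1 ≫ k1) ⊗' 𝟙 (mk 1)) ≫ (cnotG : Gate (1 + 1))) ≫ ((b1 ≫ k1) ⊗' 𝟙 (mk 1)) =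
      ((b1 ≫ k1) ⊗' 𝟙 (mk 1)) ≫ (𝟙 (mk 1) ⊗' notG) := by
    rw [tens_id_comp]
    simp only [Category.assoc]
    rw [reassoc_of% e, ← tens_comp, ← tens_comp, ← tens_comp, ← tens_comp]
    simp
  exact e3

/-- Adding a last wire with value `0`. -/
def K (n : ℕ) : mk n ⟶ mk (n + 1) := 𝟙 (mk n) ⊗' k0

/-- Removing a last wire with value `0`. -/
def B (n : ℕ) : mk (n + 1) ⟶ mk n := 𝟙 (mk n) ⊗' b0

/-- Adding a last wire with value `1`. -/
def K1 (n : ℕ) : mk n ⟶ mk (n + 1) := 𝟙 (mk n) ⊗' k1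

/-- Removing a last wire with value `1`. -/
def B1 (n : ℕ) : mk (n + 1) ⟶ mk n := 𝟙 (mk n) ⊗' b1

theorem K1_B1 (n : ℕ) : K1 n ≫ B1 n = 𝟙 _ := by
  have : (𝟙 (mk n) ⊗' k1) ≫ (𝟙 (mk n) ⊗' b1) = 𝟙 (mk (n + 0)) := by
    rw [← id_tens_comp, k1_b1, id_tens_id]
  exact this

theorem last_eq_natAdd (n : ℕ) : (![Fin.last n] : Fin 1 → Fin (n + 1)) = Fin.natAdd n := by
  ext i; fin_cases i; rfl

theorem B1_K1 (n : ℕ) : B1 n ≫ K1 n = o (Fin.last n) := by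
  rw [o, last_eq_natAdd, on_natAdd, id_tens_comp]
  rfl

theorem B_K (n : ℕ) : B n ≫ K n = z (Fin.last n) := by
  rw [z, last_eq_natAdd, on_natAdd, id_tens_comp]
  rfl

theorem K1_naturality {n : ℕ} (f : Gate n) : K1 n ≫ on Fin.castSucc f = f ≫ K1 n := by
  have h : (𝟙 (mk n) ⊗' k1) ≫ (f ⊗' 𝟙 (mk 1)) = (f ⊗' 𝟙 (mk 0)) ≫ (𝟙 (mk n) ⊗' k1) := by
    rw [← tens_eq_comp, ← tens_comp]; simp
  rw [on_castSucc]
  conv_rhs => rw [← tens_unit f]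
  exact h

theorem K_naturality {n : ℕ} (f : Gate n) : K n ≫ on Fin.castSucc f = f ≫ K n := by
  have h : (𝟙 (mk n) ⊗' k0) ≫ (f ⊗' 𝟙 (mk 1)) = (f ⊗' 𝟙 (mk 0)) ≫ (𝟙 (mk n) ⊗' k0) := by
    rw [← tens_eq_comp, ← tens_comp]; simp
  rw [on_castSucc]
  conv_rhs => rw [← tens_unit f]
  exact h

theorem B_naturality {n : ℕ} (f : Gate n) : on Fin.castSucc f ≫ B n = B n ≫ f := by
  have h : (f ⊗' 𝟙 (mk 1)) ≫ (𝟙 (mk n) ⊗' b0) = (𝟙 (mk n) ⊗' b0) ≫ (f ⊗' 𝟙 (mk 0)) := by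
    rw [← tens_eq_comp, ← tens_comp]; simp
  rw [on_castSucc]
  conv_rhs => rw [← tens_unit f]
  exact h

/-- Since |1⟩ followed by ⟨1| is trivial, adding the last wire with value 1 and removing it again
recovers the gate. -/
theorem on_castSucc_mul_o_cancel {n : ℕ} {f g : Gate n}
    (h : on Fin.castSucc f * o (Fin.last n) = on Fin.castSucc g * o (Fin.last n)) : f = g := by
  have h1 : ∀ f : Gate n, K1 n ≫ (on Fin.castSucc f * o (Fin.last n)) ≫ B1 n = f := by
    intro f
    rw [mul_eq, ← B1_K1]
    simp only [Category.assoc]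
    rw [← Category.assoc, K1_naturality, Category.assoc, K1_B1, ← Category.assoc (K1 n), K1_B1]
    simp
  rw [← h1 f, h, h1]

theorem on_castSucc_injective {n : ℕ} :
    Function.Injective (on (Fin.castSucc : Fin n → Fin (n + 1))) :=
  fun _ _ h => on_castSucc_mul_o_cancel (by rw [h])

/-- Idle wires lose no information, so an identity may be proved on more wires than it mentions. -/
theorem on_injective {k n : ℕ} {ι : Fin k → Fin n} (h : Function.Injective ι) :
    Function.Injective (on ι) := by
  obtain ⟨r, σ, hσ⟩ := exists_extend h
  have hc : ∀ r, Function.Injective (on (Fin.castAdd r : Fin k → Fin (k + r))) := by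
    intro r
    induction r with
    | zero => intro f g hfg; rwa [on_castAdd, on_castAdd, tens_unit, tens_unit] at hfg
    | succ r ih =>
      intro f g hfg
      have : (Fin.castAdd (r + 1) : Fin k → Fin (k + (r + 1))) =
        (Fin.castSucc : Fin (k + r) → Fin (k + r + 1)) ∘ Fin.castAdd r := rfl
      rw [this, ← on_on (Fin.castAdd_injective _ _) (Fin.castSucc_injective _),
        ← on_on (Fin.castAdd_injective _ _) (Fin.castSucc_injective _)] at hfg
      exact ih (on_castSucc_injective hfg)
  intro f g hfg
  have : ι = σ ∘ Fin.castAdd r := by ext i; simp [hσ]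
  rw [this, ← on_on (Fin.castAdd_injective _ _) σ.injective,
    ← on_on (Fin.castAdd_injective _ _) σ.injective, on_equiv, on_equiv] at hfg
  apply hc r
  have h2 := congrArg (fun x => pm σ ≫ x ≫ pm σ.symm) hfg
  simpa using h2

theorem injective_snoc {k n : ℕ} {κ : Fin k → Fin n} (hκ : Function.Injective κ) {a : Fin n}
    (ha : ∀ i, κ i ≠ a) : Function.Injective (Fin.snoc κ a : Fin (k + 1) → Fin n) :=
  Fin.snoc_injective_of_injective hκ (by rintro ⟨i, hi⟩; exact ha i hi)

theorem on_mul_o_cancel {k n : ℕ} {κ : Fin k → Fin n} (hκ : Function.Injective κ) {a : Fin n}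
    (ha : ∀ i, κ i ≠ a) {f g : Gate k} (h : on κ f * o a = on κ g * o a) : f = g := by
  have h1 := injective_snoc hκ ha
  have h2 : (Fin.snoc κ a : Fin (k + 1) → Fin n) ∘ Fin.castSucc = κ := by ext; simp
  have h3 : (Fin.snoc κ a : Fin (k + 1) → Fin n) (Fin.last k) = a := by simp
  apply on_castSucc_mul_o_cancel
  apply on_injective h1
  rwa [map_mul, map_mul, on_on (Fin.castSucc_injective _) h1, on_on (Fin.castSucc_injective _) h1,
    on_o h1, h2, h3]

end TOF

/-! ### Toffoli, cnot and not gates with a control fixed to 0 or 1. -/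

namespace TOF

open Circuit

variable {N : ℕ}

section basic

variable {a b c d e : Fin N}

theorem T_comm_controls (hab : a ≠ b) (hac : a ≠ c) (hbc : b ≠ c) : T a b c = T b a c := by
  have hι := injective_vec3.2 ⟨hab, hac, hbc⟩
  have h : (T 0 1 2 : Gate 3) = T 1 0 2 := by
    rw [T_012]
    exact (ofCircuit_eq Rel.tof15).trans (ofCircuit_on _ _ (by decide))
  simpa [on_T hι] using congrArg (on ![a, b, c]) h

theorem T_mul_self (hab : a ≠ b) (hac : a ≠ c) (hbc : b ≠ c) : T a b c * T a b c = 1 := by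
  have hι := injective_vec3.2 ⟨hab, hac, hbc⟩
  have h : (T 0 1 2 * T 0 1 2 : Gate 3) = 1 := by
    rw [T_012]
    exact (ofCircuit_eq Rel.tof9)
  simpa [on_T hι] using congrArg (on ![a, b, c]) h

theorem o_mul_T (hab : a ≠ b) (hac : a ≠ c) (hbc : b ≠ c) : o a * T a b c = o a * C b c := by
  have hι := injective_vec3.2 ⟨hab, hac, hbc⟩
  simpa [on_T hι, on_C hι, on_o hι] using congrArg (on ![a, b, c]) o_mul_T_base

theorem T_mul_o (hab : a ≠ b) (hac : a ≠ c) (hbc : b ≠ c) : T a b c * o a = C b c * o a := by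
  have hι := injective_vec3.2 ⟨hab, hac, hbc⟩
  simpa [on_T hι, on_C hι, on_o hι] using congrArg (on ![a, b, c]) T_mul_o_base

theorem z_mul_T (hab : a ≠ b) (hac : a ≠ c) (hbc : b ≠ c) : z a * T a b c = z a := by
  have hι := injective_vec3.2 ⟨hab, hac, hbc⟩
  simpa [on_T hι, on_z hι] using congrArg (on ![a, b, c]) z_mul_T_base

theorem T_mul_z (hab : a ≠ b) (hac : a ≠ c) (hbc : b ≠ c) : T a b c * z a = z a := by
  have hι := injective_vec3.2 ⟨hab, hac, hbc⟩
  simpa [on_T hι, on_z hι] using congrArg (on ![a, b, c]) T_mul_z_base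

/-! Gates on disjoint wires commute. -/

theorem commute_o_on {n : ℕ} {ι : Fin n → Fin N} (hι : Function.Injective ι) (h : ∀ i, a ≠ ι i)
    (f : Gate n) : Commute (o a) (on ι f) :=
  commute_on (injective_vec1 a) hι (fun i j => by fin_cases i; exact h j) _ _

theorem commute_z_on {n : ℕ} {ι : Fin n → Fin N} (hι : Function.Injective ι) (h : ∀ i, a ≠ ι i)
    (f : Gate n) : Commute (z a) (on ι f) :=
  commute_on (injective_vec1 a) hι (fun i j => by fin_cases i; exact h j) _ _

theorem commute_X_on {n : ℕ} {ι : Fin n → Fin N} (hι : Function.Injective ι) (h : ∀ i, a ≠ ι i)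
    (f : Gate n) : Commute (X a) (on ι f) :=
  commute_on (injective_vec1 a) hι (fun i j => by fin_cases i; exact h j) _ _

theorem commute_C_on {n : ℕ} {ι : Fin n → Fin N} (hι : Function.Injective ι) (hab : a ≠ b)
    (h : ∀ i, a ≠ ι i) (h' : ∀ i, b ≠ ι i)
    (f : Gate n) : Commute (C a b) (on ι f) :=
  commute_on (injective_vec2.2 hab) hι
    (fun i j => by fin_cases i; exacts [h j, h' j]) _ _

theorem commute_o_X (h : a ≠ b) : Commute (o a) (X b) :=
  commute_o_on (injective_vec1 b) (fun i => by fin_cases i; exact h) _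

theorem commute_o_z (h : a ≠ b) : Commute (o a) (z b) :=
  commute_o_on (injective_vec1 b) (fun i => by fin_cases i; exact h) _

theorem commute_o_o (h : a ≠ b) : Commute (o a) (o b) :=
  commute_o_on (injective_vec1 b) (fun i => by fin_cases i; exact h) _

theorem commute_z_z (h : a ≠ b) : Commute (z a) (z b) :=
  commute_z_on (injective_vec1 b) (fun i => by fin_cases i; exact h) _

theorem commute_z_X (h : a ≠ b) : Commute (z a) (X b) :=
  commute_z_on (injective_vec1 b) (fun i => by fin_cases i; exact h) _

theorem commute_X_X (h : a ≠ b) : Commute (X a) (X b) :=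
  commute_X_on (injective_vec1 b) (fun i => by fin_cases i; exact h) _

theorem commute_o_C (hbc : b ≠ c) (hab : a ≠ b) (hac : a ≠ c) : Commute (o a) (C b c) :=
  commute_o_on (injective_vec2.2 hbc) (fun i => by fin_cases i; exacts [hab, hac]) _

theorem commute_z_C (hbc : b ≠ c) (hab : a ≠ b) (hac : a ≠ c) : Commute (z a) (C b c) :=
  commute_z_on (injective_vec2.2 hbc) (fun i => by fin_cases i; exacts [hab, hac]) _

theorem commute_X_C (hbc : b ≠ c) (hab : a ≠ b) (hac : a ≠ c) : Commute (X a) (C b c) :=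
  commute_X_on (injective_vec2.2 hbc) (fun i => by fin_cases i; exacts [hab, hac]) _

theorem commute_C_C_of_ne (hab : a ≠ b) (hcd : c ≠ d) (hac : a ≠ c) (had : a ≠ d) (hbc : b ≠ c)
    (hbd : b ≠ d) : Commute (C a b) (C c d) :=
  commute_C_on (injective_vec2.2 hcd) hab (fun i => by fin_cases i; exacts [hac, had])
    (fun i => by fin_cases i; exacts [hbc, hbd]) _

theorem commute_z_T (hbc : b ≠ c) (hbd : b ≠ d) (hcd : c ≠ d) (hab : a ≠ b) (hac : a ≠ c)
    (had : a ≠ d) : Commute (z a) (T b c d) :=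
  commute_z_on (injective_vec3.2 ⟨hbc, hbd, hcd⟩)
    (fun i => by fin_cases i; exacts [hab, hac, had]) _

theorem o_mul_o (a : Fin N) : o a * o a = o a := by
  rw [o, ← map_mul, mul_eq]
  simp only [Category.assoc]
  rw [← Category.assoc k1, k1_b1, Category.id_comp]

/-! Cancelling a value `1` on a fresh wire. -/

/-- A Toffoli gate with both controls set to 1 is reduced in two ways, by the symmetry of its
controls: fixing one control leaves cnot from the other. One of these two cnots is controlled by the
auxiliary wire, and there the two-sided form `o_C_o_base` applies. The auxiliary wire is then
cancelled. -/
theorem o_mul_C_base : (o 0 * C 0 1 : Gate 2) = o 0 * X 1 := by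
  apply on_mul_o_cancel (κ := ![(0 : Fin 3), 2]) (by decide) (a := 1) (by decide)
  have hκ : Function.Injective ![(0 : Fin 3), 2] := by decide
  have h1 : (o 1 * (o 0 * T 0 1 2) : Gate 3) = o 1 * (o 0 * T 1 0 2) := by
    rw [T_comm_controls (by decide) (by decide) (by decide)]
  rw [o_mul_T (by decide) (by decide) (by decide), ← mul_assoc, ← mul_assoc,
    (commute_o_o (show (1 : Fin 3) ≠ 0 by decide)).eq, mul_assoc, mul_assoc,
    o_mul_T (by decide) (by decide) (by decide)] at h1
  have h2 := congrArg (· * o 1) h1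
  have h3 : (o 1 * C 1 2 * o 1 : Gate 3) = o 1 * X 2 := by
    have := congrArg (on ![(1 : Fin 3), 2]) o_C_o_base
    have hκ : Function.Injective ![(1 : Fin 3), 2] := by decide
    simpa [on_o hκ, on_C hκ, on_X hκ] using this
  simp only [mul_assoc] at h2 h3
  rw [h3, ← (commute_o_C (N := 3) (a := 1) (b := 0) (c := 2) (by decide) (by decide)
    (by decide)).eq, ← mul_assoc (o 1) (o 1), o_mul_o] at h2
  simp only [map_mul, on_o hκ, on_X hκ, on_C hκ (show (0 : Fin 2) ≠ 1 by decide)]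
  simp only [Matrix.cons_val_zero, Matrix.cons_val_one]
  rw [mul_assoc, mul_assoc, ← (commute_o_C (N := 3) (a := 1) (b := 0) (c := 2) (by decide)
    (by decide) (by decide)).eq, ← (commute_o_X (N := 3) (a := 1) (b := 2) (by decide)).eq]
  exact h2.symm

end basic

end TOF

namespace TOF

open Circuit

variable {N : ℕ}

section basic

variable {a b c d e : Fin N}

theorem C_mul_o_base : (C 0 1 * o 0 : Gate 2) = X 1 * o 0 := by
  apply on_mul_o_cancel (κ := ![(0 : Fin 3), 2]) (by decide) (a := 1) (by decide)
  have hκ : Function.Injective ![(0 : Fin 3), 2] := by decide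
  have h1 : (T 0 1 2 * o 0 * o 1 : Gate 3) = T 1 0 2 * o 1 * o 0 := by
    rw [T_comm_controls (a := 0) (by decide) (by decide) (by decide), mul_assoc, mul_assoc,
      (commute_o_o (show (1 : Fin 3) ≠ 0 by decide)).eq]
  rw [T_mul_o (by decide) (by decide) (by decide),
    T_mul_o (by decide) (by decide) (by decide)] at h1
  have h2 := congrArg (o 1 * ·) h1
  have h3 : (o 1 * C 1 2 * o 1 : Gate 3) = o 1 * X 2 := by
    have := congrArg (on ![(1 : Fin 3), 2]) o_C_o_base
    have hκ : Function.Injective ![(1 : Fin 3), 2] := by decide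
    simpa [on_o hκ, on_C hκ, on_X hκ] using this
  rw [mul_assoc (C 1 2), (commute_o_o (show (0 : Fin 3) ≠ 1 by decide)).eq, ← mul_assoc (C 1 2),
    ← mul_assoc, ← mul_assoc, h3] at h2
  simp only [map_mul, on_o hκ, on_X hκ, on_C hκ (show (0 : Fin 2) ≠ 1 by decide)]
  simp only [Matrix.cons_val_zero, Matrix.cons_val_one]
  rw [mul_assoc, (commute_o_o (show (0 : Fin 3) ≠ 1 by decide)).eq, ← mul_assoc,
    ← (commute_o_C (N := 3) (a := 1) (b := 0) (c := 2) (by decide) (by decide) (by decide)).eq,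
    mul_assoc (X 2), (commute_o_o (show (0 : Fin 3) ≠ 1 by decide)).eq, ← mul_assoc (X 2),
    ← (commute_o_X (N := 3) (a := 1) (b := 2) (by decide)).eq, h2]
  rw [(commute_o_C (N := 3) (a := 1) (b := 0) (c := 2) (by decide) (by decide) (by decide)).eq,
    mul_assoc (C 0 2), ← mul_assoc (o 1) (C 0 2),
    (commute_o_C (N := 3) (a := 1) (b := 0) (c := 2) (by decide) (by decide) (by decide)).eq,
    mul_assoc (C 0 2), ← mul_assoc (o 1) (o 1), o_mul_o]

theorem o_mul_C (h : a ≠ c) : o a * C a c = o a * X c := by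
  have hι := injective_vec2.2 h
  simpa [on_C hι, on_X hι, on_o hι] using congrArg (on ![a, c]) o_mul_C_base

theorem C_mul_o (h : a ≠ c) : C a c * o a = X c * o a := by
  have hι := injective_vec2.2 h
  simpa [on_C hι, on_X hι, on_o hι] using congrArg (on ![a, c]) C_mul_o_base

/-- The gate `f` reduces to `g` when the wire `a` has the value `1`. -/
structure Spec (a : Fin N) (f g : Gate N) : Prop where
  eq : f * o a = g * o a
  comm : Commute (o a) f
  comm' : Commute (o a) g

theorem Spec.mul {f g f' g' : Gate N} (h : Spec a f g) (h' : Spec a f' g') :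
    Spec a (f * f') (g * g') where
  eq := by
    rw [mul_assoc, ← h'.comm.eq, ← mul_assoc, h.eq, mul_assoc, h'.comm.eq, h'.eq, ← mul_assoc]
  comm := h.comm.mul_right h'.comm
  comm' := h.comm'.mul_right h'.comm'

theorem Spec.of_commute {f : Gate N} (h : Commute (o a) f) : Spec a f f := ⟨rfl, h, h⟩

theorem Spec.T (hab : a ≠ b) (hac : a ≠ c) (hbc : b ≠ c) : Spec a (T a b c) (C b c) := by
  have h := commute_o_C hbc hab hac
  refine ⟨T_mul_o hab hac hbc, ?_, h⟩
  rw [Commute, SemiconjBy, o_mul_T hab hac hbc, T_mul_o hab hac hbc, h.eq]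

theorem Spec.C (h : a ≠ c) : Spec a (C a c) (X c) := by
  have h' := commute_o_X h
  refine ⟨C_mul_o h, ?_, h'⟩
  rw [Commute, SemiconjBy, o_mul_C h, C_mul_o h, h'.eq]

/-- The transfer principle: setting a control to 1 turns Toffoli into cnot and cnot into not,
compatibly with composition, and `g` is determined by any `f` that reduces to it. Identities of
Toffoli gates thus descend to gates with fewer controls. -/
theorem eq_of_spec {f : Gate (N + 1)} {g g' : Gate N} (h : Spec (Fin.last N) f (on Fin.castSucc g))
    (h' : Spec (Fin.last N) f (on Fin.castSucc g')) : g = g' :=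
  on_castSucc_mul_o_cancel (h.eq.symm.trans h'.eq)

theorem Spec.castSucc (g : Gate N) :
    Spec (Fin.last N) (on Fin.castSucc g) (on Fin.castSucc g) :=
  Spec.of_commute (commute_o_on (Fin.castSucc_injective N) (fun i => (Fin.castSucc_ne_last i).symm) g)

theorem Spec.one : Spec a 1 1 := Spec.of_commute (Commute.one_right _)

theorem Spec.lastC (a : Fin N) :
    Spec (Fin.last N) (TOF.C (Fin.last N) a.castSucc) (on Fin.castSucc (X a)) := by
  rw [on_X (Fin.castSucc_injective N)]
  exact Spec.C (Fin.castSucc_ne_last a).symm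

theorem Spec.lastT {a b : Fin N} (h : a ≠ b) :
    Spec (Fin.last N) (TOF.T (Fin.last N) a.castSucc b.castSucc) (on Fin.castSucc (TOF.C a b)) := by
  rw [on_C (Fin.castSucc_injective N) h]
  exact Spec.T (Fin.castSucc_ne_last a).symm (Fin.castSucc_ne_last b).symm (by simpa using h)

theorem Spec.castSuccT (hab : a ≠ b) (hac : a ≠ c) (hbc : b ≠ c) :
    Spec (Fin.last N) (TOF.T a.castSucc b.castSucc c.castSucc) (on Fin.castSucc (TOF.T a b c)) := by
  rw [← on_T (Fin.castSucc_injective N) hab hac hbc]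
  exact Spec.castSucc _

theorem Spec.castSuccC (hac : a ≠ c) :
    Spec (Fin.last N) (TOF.C a.castSucc c.castSucc) (on Fin.castSucc (TOF.C a c)) := by
  rw [← on_C (Fin.castSucc_injective N) hac]
  exact Spec.castSucc _

theorem Spec.map_mul {f f' : Gate (N + 1)} {g g' : Gate N}
    (h : Spec (Fin.last N) f (on Fin.castSucc g)) (h' : Spec (Fin.last N) f' (on Fin.castSucc g')) :
    Spec (Fin.last N) (f * f') (on Fin.castSucc (g * g')) := by
  rw [_root_.map_mul]
  exact h.mul h'

theorem C_mul_self (h : a ≠ b) : C a b * C a b = 1 := by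
  refine eq_of_spec ((Spec.lastT h).map_mul (Spec.lastT h)) ?_
  rw [T_mul_self (Fin.castSucc_ne_last a).symm (Fin.castSucc_ne_last b).symm (by simpa using h),
    map_one]
  exact Spec.one

theorem X_mul_self (a : Fin N) : X a * X a = 1 := by
  refine eq_of_spec ((Spec.lastC a).map_mul (Spec.lastC a)) ?_
  rw [C_mul_self (Fin.castSucc_ne_last a).symm, map_one]
  exact Spec.one

theorem notG_notG : notG ≫ notG = 𝟙 (mk 1) := by
  have := X_mul_self (0 : Fin 1)
  rwa [X_0] at this

theorem k0_b0 : k0 ≫ b0 = 𝟙 _ := by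
  rw [k0_eq, b0_eq, Category.assoc, ← Category.assoc notG, notG_notG, Category.id_comp, k1_b1]

theorem K_B (n : ℕ) : K n ≫ B n = 𝟙 _ := by
  have : (𝟙 (mk n) ⊗' k0) ≫ (𝟙 (mk n) ⊗' b0) = 𝟙 (mk (n + 0)) := by
    rw [← id_tens_comp, k0_b0, id_tens_id]
  exact this

theorem K_B_assoc (n m : ℕ) (f : mk n ⟶ mk m) : K n ≫ B n ≫ f = f := by
  rw [← Category.assoc, K_B, Category.id_comp]

theorem z_mul_z (a : Fin N) : z a * z a = z a := by
  rw [z, ← map_mul, mul_eq]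
  simp only [Category.assoc]
  rw [← Category.assoc k0, k0_b0, Category.id_comp]

theorem z_eq (a : Fin N) : z a = X a * o a * X a := by
  rw [z, X, o, ← map_mul, ← map_mul, k0_eq, b0_eq]
  simp only [mul_eq, Category.assoc]

theorem o_eq (a : Fin N) : o a = X a * z a * X a := by
  rw [z_eq]
  simp only [mul_assoc]
  rw [X_mul_self, mul_one, ← mul_assoc, X_mul_self, one_mul]

theorem on_castSucc_mul_z_cancel {n : ℕ} {f g : Gate n}
    (h : on Fin.castSucc f * z (Fin.last n) = on Fin.castSucc g * z (Fin.last n)) : f = g := by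
  have h1 : ∀ f : Gate n, K n ≫ (on Fin.castSucc f * z (Fin.last n)) ≫ B n = f := by
    intro f
    rw [mul_eq, ← B_K]
    simp only [Category.assoc]
    rw [← Category.assoc, K_naturality, Category.assoc, K_B, ← Category.assoc (K n), K_B]
    simp
  rw [← h1 f, h, h1]

theorem on_mul_z_cancel {k n : ℕ} {κ : Fin k → Fin n} (hκ : Function.Injective κ) {a : Fin n}
    (ha : ∀ i, κ i ≠ a) {f g : Gate k} (h : on κ f * z a = on κ g * z a) : f = g := by
  have h1 := injective_snoc hκ ha
  have h2 : (Fin.snoc κ a : Fin (k + 1) → Fin n) ∘ Fin.castSucc = κ := by ext; simp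
  have h3 : (Fin.snoc κ a : Fin (k + 1) → Fin n) (Fin.last k) = a := by simp
  apply on_castSucc_mul_z_cancel
  apply on_injective h1
  rwa [map_mul, map_mul, on_on (Fin.castSucc_injective _) h1, on_on (Fin.castSucc_injective _) h1,
    on_z h1, h2, h3]

/-- With a fresh wire of value 1 the cnot is a Toffoli gate, one of whose controls, `a`, has the
value 0. -/
theorem z_mul_C (h : a ≠ c) : z a * C a c = z a := by
  apply on_castSucc_mul_o_cancel
  have h1 := Fin.castSucc_injective N
  have ha := (Fin.castSucc_ne_last a)
  have hc := (Fin.castSucc_ne_last c)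
  have h' : a.castSucc ≠ c.castSucc := by simpa using h
  rw [map_mul, on_z h1, on_C h1 h, mul_assoc, ← T_mul_o ha.symm hc.symm h', ← mul_assoc,
    T_comm_controls ha.symm hc.symm h', z_mul_T ha h' hc.symm]

theorem C_mul_z (h : a ≠ c) : C a c * z a = z a := by
  apply on_castSucc_mul_o_cancel
  have h1 := Fin.castSucc_injective N
  have ha := (Fin.castSucc_ne_last a)
  have hc := (Fin.castSucc_ne_last c)
  have h' : a.castSucc ≠ c.castSucc := by simpa using h
  rw [map_mul, on_z h1, on_C h1 h, mul_assoc, ← (commute_o_z ha.symm).eq, ← mul_assoc,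
    ← T_mul_o ha.symm hc.symm h', mul_assoc, (commute_o_z ha.symm).eq, ← mul_assoc,
    T_comm_controls ha.symm hc.symm h', T_mul_z ha h' hc.symm]

theorem commute_z_T' (hab : a ≠ b) (hac : a ≠ c) (hbc : b ≠ c) : Commute (z a) (T a b c) := by
  rw [Commute, SemiconjBy, z_mul_T hab hac hbc, T_mul_z hab hac hbc]

/-! Identities between Toffoli gates on arbitrary wires. -/

theorem commute_T_T_target (h : Function.Injective ![a, b, c, d, e]) :
    Commute (T a b c) (T e d c) := by
  have base : (T 0 1 2 * T 4 3 2 : Gate 5) = T 4 3 2 * T 0 1 2 := by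
    have := ofCircuit_eq Rel.tof3
    simp only [ofCircuit_comp, ofCircuit_on] at this
    exact this
  rw [commute_iff_eq]
  simpa [on_T h] using congrArg (on ![a, b, c, d, e]) base

theorem commute_T_T_control (h : Function.Injective ![a, b, c, d, e]) :
    Commute (T c b a) (T c d e) := by
  have base : (T 2 1 0 * T 2 3 4 : Gate 5) = T 2 3 4 * T 2 1 0 := by
    have := ofCircuit_eq Rel.tof4
    simp only [ofCircuit_comp, ofCircuit_on] at this
    exact this
  rw [commute_iff_eq]
  simpa [on_T h] using congrArg (on ![a, b, c, d, e]) base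

theorem commute_T_T_target_control (h : Function.Injective ![a, b, c, d]) :
    Commute (T a c d) (T b c d) := by
  have base : (T 0 2 3 * T 1 2 3 : Gate 4) = T 1 2 3 * T 0 2 3 := by
    have := ofCircuit_eq Rel.tof5'
    simp only [ofCircuit_comp, ofCircuit_on] at this
    exact this
  rw [commute_iff_eq]
  simpa [on_T h] using congrArg (on ![a, b, c, d]) base

theorem C_T_C (h : Function.Injective ![a, b, c, d]) :
    C a b * T b c d * C a b = T a c d * T b c d := by
  have base : (C 0 1 * (T 1 2 3 * C 0 1) : Gate 4) = T 0 2 3 * T 1 2 3 := by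
    have := ofCircuit_eq Rel.tof11
    simp only [ofCircuit_comp, ofCircuit_on] at this
    exact this
  simpa [on_T h, on_C h, mul_assoc] using congrArg (on ![a, b, c, d]) base

theorem T_T_T (h : Function.Injective ![a, b, c, d]) :
    T a b c * T b c d * T a b c = T a b d * T b c d := by
  have base : (T 0 1 2 * (T 1 2 3 * T 0 1 2) : Gate 4) = T 0 1 3 * T 1 2 3 := by
    have := ofCircuit_eq Rel.tof12
    simp only [ofCircuit_comp, ofCircuit_on] at this
    exact this
  simpa [on_T h, on_C h, mul_assoc] using congrArg (on ![a, b, c, d]) base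

theorem T_C_T (h : Function.Injective ![a, b, c, d]) :
    T a b c * C c d * T a b c = T a b d * C c d := by
  have base : (T 0 1 2 * (C 2 3 * T 0 1 2) : Gate 4) = T 0 1 3 * C 2 3 := by
    have := ofCircuit_eq Rel.tof13
    simp only [ofCircuit_comp, ofCircuit_on] at this
    exact this
  simpa [on_T h, on_C h, mul_assoc] using congrArg (on ![a, b, c, d]) base

end basic

end TOF

/-! ### Commutation and conjugation rules for gates with fewer controls. -/

namespace TOF

open Circuit

variable {N : ℕ}

section basic

variable {a b c d e : Fin N}

theorem Spec.lastT' {a b : Fin N} (h : a ≠ b) :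
    Spec (Fin.last N) (TOF.T a.castSucc (Fin.last N) b.castSucc) (on Fin.castSucc (TOF.C a b)) := by
  rw [T_comm_controls (Fin.castSucc_ne_last a) (by simpa using h) (Fin.castSucc_ne_last b).symm]
  exact Spec.lastT h

theorem last_ne_castSucc (a : Fin N) : Fin.last N ≠ a.castSucc := (Fin.castSucc_ne_last a).symm

theorem commute_C_T (h : Function.Injective ![a, b, c, d]) : Commute (C a d) (T b c d) := by
  rw [injective_vec4] at h
  obtain ⟨hab, hac, had, hbc, hbd, hcd⟩ := h
  have e : Commute (T (Fin.last N) a.castSucc d.castSucc) (T b.castSucc c.castSucc d.castSucc) := by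
    apply commute_T_T_target (b := a.castSucc) (d := c.castSucc)
    simp only [injective_vec5, ne_eq, Fin.castSucc_inj, Fin.castSucc_ne_last, last_ne_castSucc]
    tauto
  refine eq_of_spec ((Spec.lastT had).map_mul (Spec.castSuccT hbc hbd hcd)) ?_
  rw [e.eq]
  exact (Spec.castSuccT hbc hbd hcd).map_mul (Spec.lastT had)

theorem commute_X_T (h : Function.Injective ![b, c, d]) : Commute (X d) (T b c d) := by
  rw [injective_vec3] at h
  obtain ⟨hbc, hbd, hcd⟩ := h
  have e : Commute (C (Fin.last N) d.castSucc) (T b.castSucc c.castSucc d.castSucc) := by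
    apply commute_C_T
    simp only [injective_vec4, ne_eq, Fin.castSucc_inj, last_ne_castSucc]
    tauto
  refine eq_of_spec ((Spec.lastC d).map_mul (Spec.castSuccT hbc hbd hcd)) ?_
  rw [e.eq]
  exact (Spec.castSuccT hbc hbd hcd).map_mul (Spec.lastC d)

theorem commute_C_C_target (hac : a ≠ c) (hbc : b ≠ c) : Commute (C a c) (C b c) := by
  by_cases hab : a = b
  · rw [hab]
  have e : Commute (C a.castSucc c.castSucc) (T (Fin.last N) b.castSucc c.castSucc) := by
    apply commute_C_T
    simp only [injective_vec4, ne_eq, Fin.castSucc_inj, last_ne_castSucc, Fin.castSucc_ne_last]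
    tauto
  refine eq_of_spec ((Spec.castSuccC hac).map_mul (Spec.lastT hbc)) ?_
  rw [e.eq]
  exact (Spec.lastT hbc).map_mul (Spec.castSuccC hac)

theorem commute_X_C_target (hac : a ≠ c) : Commute (X c) (C a c) := by
  have e : Commute (C (Fin.last N) c.castSucc) (C a.castSucc c.castSucc) :=
    commute_C_C_target (last_ne_castSucc c) (by simpa using hac)
  refine eq_of_spec ((Spec.lastC c).map_mul (Spec.castSuccC hac)) ?_
  rw [e.eq]
  exact (Spec.castSuccC hac).map_mul (Spec.lastC c)

theorem commute_T_C_control (h : Function.Injective ![a, b, c, d]) : Commute (T a b c) (C a d) := by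
  rw [injective_vec4] at h
  obtain ⟨hab, hac, had, hbc, hbd, hcd⟩ := h
  have e : Commute (T a.castSucc b.castSucc c.castSucc) (T a.castSucc (Fin.last N) d.castSucc) := by
    apply commute_T_T_control
    simp only [injective_vec5, ne_eq, Fin.castSucc_inj, Fin.castSucc_ne_last, last_ne_castSucc]
    tauto
  refine eq_of_spec ((Spec.castSuccT hab hac hbc).map_mul (Spec.lastT' had)) ?_
  rw [e.eq]
  exact (Spec.lastT' had).map_mul (Spec.castSuccT hab hac hbc)

theorem commute_C_C_control (hac : a ≠ c) (had : a ≠ d) : Commute (C a c) (C a d) := by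
  by_cases hcd : c = d
  · rw [hcd]
  have e : Commute (T a.castSucc (Fin.last N) c.castSucc) (C a.castSucc d.castSucc) := by
    apply commute_T_C_control
    simp only [injective_vec4, ne_eq, Fin.castSucc_inj, Fin.castSucc_ne_last, last_ne_castSucc]
    tauto
  refine eq_of_spec ((Spec.lastT' hac).map_mul (Spec.castSuccC had)) ?_
  rw [e.eq]
  exact (Spec.castSuccC had).map_mul (Spec.lastT' hac)

theorem C_C_C (hab : a ≠ b) (had : a ≠ d) (hbd : b ≠ d) :
    C a b * C b d * C a b = C a d * C b d := by
  refine eq_of_spec (((Spec.castSuccC hab).map_mul (Spec.lastT' hbd)).map_mul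
    (Spec.castSuccC hab)) ?_
  rw [C_T_C]
  · exact (Spec.lastT' had).map_mul (Spec.lastT' hbd)
  · simp only [injective_vec4, ne_eq, Fin.castSucc_inj, Fin.castSucc_ne_last, last_ne_castSucc]
    tauto

theorem X_T_X (hbc : b ≠ c) (hbd : b ≠ d) (hcd : c ≠ d) :
    X b * T b c d * X b = C c d * T b c d := by
  refine eq_of_spec (((Spec.lastC b).map_mul (Spec.castSuccT hbc hbd hcd)).map_mul
    (Spec.lastC b)) ?_
  rw [C_T_C]
  · exact (Spec.lastT hcd).map_mul (Spec.castSuccT hbc hbd hcd)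
  · simp only [injective_vec4, ne_eq, Fin.castSucc_inj, Fin.castSucc_ne_last, last_ne_castSucc]
    tauto

theorem X_C_X (hbd : b ≠ d) : X b * C b d * X b = X d * C b d := by
  refine eq_of_spec (((Spec.lastC b).map_mul (Spec.castSuccC hbd)).map_mul (Spec.lastC b)) ?_
  rw [C_C_C (last_ne_castSucc b) (last_ne_castSucc d) (by simpa using hbd)]
  exact (Spec.lastC d).map_mul (Spec.castSuccC hbd)

theorem C_T_C' (hbc : b ≠ c) (hbd : b ≠ d) (hcd : c ≠ d) :
    C b c * T b c d * C b c = C b d * T b c d := by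
  refine eq_of_spec (((Spec.lastT hbc).map_mul (Spec.castSuccT hbc hbd hcd)).map_mul
    (Spec.lastT hbc)) ?_
  rw [T_T_T]
  · exact (Spec.lastT hbd).map_mul (Spec.castSuccT hbc hbd hcd)
  · simp only [injective_vec4, ne_eq, Fin.castSucc_inj, Fin.castSucc_ne_last, last_ne_castSucc]
    tauto

/-- The involutions of `T_C_T` are moved to the other side. In this form the rule says that cnot
copies whatever is added to its control; this is the pattern of `Pre.copy`. -/
theorem C_T_C_target (h : Function.Injective ![a, b, c, d]) :
    C c d * T a b c * C c d = T a b c * T a b d := by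
  have h1 := T_C_T h
  have h2 := h
  rw [injective_vec4] at h2
  obtain ⟨hab, hac, had, hbc, hbd, hcd⟩ := h2
  have hT := T_mul_self hab hac hbc
  have hC := C_mul_self hcd
  have h3 : C c d * T a b c = T a b c * (T a b d * C c d) := by
    rw [← h1]
    simp only [← mul_assoc]
    rw [hT, one_mul]
  rw [h3, mul_assoc, mul_assoc, hC, mul_one]

theorem C_C_C_target (hac : a ≠ c) (had : a ≠ d) (hcd : c ≠ d) :
    C c d * C a c * C c d = C a c * C a d := by
  have h1 := C_C_C hac had hcd
  have hT := C_mul_self hac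
  have hC := C_mul_self hcd
  have h3 : C c d * C a c = C a c * (C a d * C c d) := by
    rw [← h1]
    simp only [← mul_assoc]
    rw [hT, one_mul]
  rw [h3, mul_assoc, mul_assoc, hC, mul_one]

theorem C_X_C_target (hcd : c ≠ d) : C c d * X c * C c d = X c * X d := by
  have h1 := X_C_X hcd
  have hT := X_mul_self c
  have hC := C_mul_self hcd
  have h3 : C c d * X c = X c * (X d * C c d) := by
    rw [← h1]
    simp only [← mul_assoc]
    rw [hT, one_mul]
  rw [h3, mul_assoc, mul_assoc, hC, mul_one]

/-! ### Testing wires by means of a postselected ancilla. -/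

theorem C_C_C_eq_swap (hab : a ≠ b) :
    C a b * (C b a * C a b) = on ![a, b] (pm (finAddFlip (m := 1) (n := 1))) := by
  have h := injective_vec2.2 hab
  have base : (C 0 1 * (C 1 0 * C 0 1) : Gate 2) = pm (finAddFlip (m := 1) (n := 1)) := by
    have := ofCircuit_eq Rel.tof14
    simp only [ofCircuit_comp, ofCircuit_on] at this
    exact this
  simpa [on_C h] using congrArg (on ![a, b]) base

theorem pm_swap_conj_z (hab : a ≠ b) :
    on ![a, b] (pm (finAddFlip (m := 1) (n := 1))) * z a =
      z b * on ![a, b] (pm (finAddFlip (m := 1) (n := 1))) := by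
  have h := injective_vec2.2 hab
  have e0 : (z 0 : Gate 2) = (b0 ≫ k0) ⊗' 𝟙 (mk 1) := on_zero_succ 1 _
  have e1 : (z 1 : Gate 2) = 𝟙 (mk 1) ⊗' (b0 ≫ k0) := by
    rw [← on_natAdd, z]
    congr 2
    ext i; fin_cases i; rfl
  have base : (pm (finAddFlip (m := 1) (n := 1)) * z 0 : Gate 2) =
      z 1 * pm (finAddFlip (m := 1) (n := 1)) := by
    rw [e0, e1, mul_eq, mul_eq]
    exact (swap_natural (𝟙 (mk 1)) (b0 ≫ k0)).symm
  simpa [on_z h] using congrArg (on ![a, b]) base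

/-- Adding `a` to a wire with value 0 and finding 0 again forces `a` to be 0. Three alternating
cnots are the swap `w`. A reverse cnot may be inserted before the final `z b`, which absorbs it;
then two cnots act after `z b` as the swap does, `w` turns `z b` into `z a`, and all three cnots in
`w` are trivial on zero wires. -/
theorem z_C_z (hab : a ≠ b) : z b * C a b * z b = z a * z b := by
  set w := on ![a, b] (pm (finAddFlip (m := 1) (n := 1))) with hw
  have h1 : C a b * (C b a * C a b) = w := C_C_C_eq_swap hab
  have h2 : w * z a = z b * w := pm_swap_conj_z hab
  have h3 : C b a * C a b = C a b * w := by
    rw [← h1, ← mul_assoc (C a b), C_mul_self hab, one_mul]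
  have h4 : C a b * C b a = w * C a b := by
    rw [← h1]
    simp only [mul_assoc]
    rw [C_mul_self hab, mul_one]
  have h5 : z b * (C a b * C b a) = z b * w := by
    rw [h4, ← mul_assoc, ← h2, mul_assoc, z_mul_C hab]
  have h6 : w * (z a * z b) = z a * z b := by
    rw [← h1, mul_assoc, mul_assoc, ← mul_assoc _ (z a) (z b), C_mul_z hab, (commute_z_z hab).eq,
      ← mul_assoc (C b a), C_mul_z hab.symm, ← (commute_z_z hab).eq, ← mul_assoc, C_mul_z hab]
  calc z b * C a b * z b = z b * (C a b * C b a) * z b := by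
        rw [← mul_assoc, mul_assoc _ (C b a), C_mul_z hab.symm]
    _ = z a * z b := by
        rw [h5, ← h2, mul_assoc, h6]

/-- `z_C_z` conjugated by the not gate on `a`, which exchanges the two values of that wire. -/
theorem z_X_C_z (hab : a ≠ b) : z b * X b * C a b * z b = o a * z b := by
  have h := z_C_z hab
  have h1 : X a * (z b * C a b * z b) * X a = X a * (z a * z b) * X a := by rw [h]
  have h2 : X a * (z b * C a b * z b) * X a = z b * (X a * C a b * X a) * z b := by
    simp only [← mul_assoc]
    rw [← (commute_z_X hab.symm).eq, mul_assoc _ (z b), (commute_z_X hab.symm).eq, ← mul_assoc]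
  have h3 : X a * (z a * z b) * X a = o a * z b := by
    rw [o_eq, mul_assoc (X a), mul_assoc (z a), (commute_z_X hab.symm).eq]
    simp only [mul_assoc]
  rw [h2, X_C_X hab, h3] at h1
  rw [← h1]
  simp only [mul_assoc]

theorem K1_eq (n : ℕ) : K1 n = K n ≫ X (Fin.last n) := by
  rw [K, k0_eq, X, last_eq_natAdd, on_natAdd, id_tens_comp]
  have : (𝟙 (mk n) ⊗' k1) =
      ((𝟙 (mk n) ⊗' k1) ≫ (𝟙 (mk n) ⊗' notG)) ≫ (𝟙 (mk n) ⊗' notG) := by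
    rw [Category.assoc, ← id_tens_comp, notG_notG, id_tens_id, Category.comp_id]
  exact this

/-- `Rel.tof6` factors the postselected Toffoli gate into two postselected cnots, and `z_X_C_z`
evaluates each of them. This is the source of the multiplicativity of tests. -/
theorem z_X_T_z_base : (z 2 * X 2 * T 0 1 2 * z 2 : Gate 3) = o 0 * o 1 * z 2 := by
  have e := ofCircuit_eq Rel.tof6
  simp only [ofCircuit_comp, ofCircuit_on] at e
  have e2 : (K1 2 ≫ C 0 2 ≫ B 2) ≫ (K1 2 ≫ C 1 2 ≫ B 2) = K1 2 ≫ T 0 1 2 ≫ B 2 := by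
    rw [T_012]; exact e
  rw [K1_eq] at e2
  have h2 : (2 : Fin 3) = Fin.last 2 := rfl
  have hz : (z 2 : Gate 3) = B 2 ≫ K 2 := (B_K 2).symm
  have e3 := congrArg (fun x => B 2 ≫ x ≫ K 2) e2
  simp only [Category.assoc] at e3
  have e4 : (z 2 * X 2 * C 0 2 * z 2 * X 2 * C 1 2 * z 2 : Gate 3) = z 2 * X 2 * T 0 1 2 * z 2 := by
    simp only [mul_eq, hz, Category.assoc]
    exact e3
  rw [← e4, z_X_C_z (by decide), mul_assoc (o 0), mul_assoc (o 0), mul_assoc (o 0), z_X_C_z (by decide),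
    mul_assoc]

theorem z_X_T_z (hab : a ≠ b) (hac : a ≠ c) (hbc : b ≠ c) :
    z c * X c * T a b c * z c = o a * o b * z c := by
  have hι := injective_vec3.2 ⟨hab, hac, hbc⟩
  simpa [on_T hι, on_o hι, on_X hι, on_z hι] using congrArg (on ![a, b, c]) z_X_T_z_base

/-! ### Ancillas inserted between other wires. -/

/-- Moving the last wire to the position `p`. -/
def insertEquiv (p q : ℕ) : Fin (p + q + 1) ≃ Fin (p + 1 + q) :=
  (finCongr (Nat.add_assoc p q 1)).trans ((permSum (Equiv.refl (Fin p)) finAddFlip).trans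
    (finCongr (Nat.add_assoc p 1 q)).symm)

theorem insertEquiv_last (p q : ℕ) : (insertEquiv p q (Fin.last (p + q)) : ℕ) = p := by
  have : (finCongr (Nat.add_assoc p q 1)) (Fin.last (p + q)) = Fin.natAdd p (Fin.natAdd q 0) := by
    ext; simp
  simp only [insertEquiv, Equiv.trans_apply, this]
  simp

theorem insertEquiv_castSucc (p q : ℕ) (i : Fin (p + q)) :
    (insertEquiv p q i.castSucc : ℕ) = if (i : ℕ) < p then (i : ℕ) else i + 1 := by
  induction i using Fin.addCases with
  | left i =>
    have : (finCongr (Nat.add_assoc p q 1)) (Fin.castAdd q i).castSucc = Fin.castAdd (q + 1) i := by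
      ext; simp
    simp only [insertEquiv, Equiv.trans_apply, this]
    simp
  | right i =>
    have : (finCongr (Nat.add_assoc p q 1)) (Fin.natAdd p i).castSucc =
        Fin.natAdd p (Fin.castAdd 1 i) := by
      ext; simp
    simp only [insertEquiv, Equiv.trans_apply, this]
    simp; omega

theorem insertEquiv_aux (p q : ℕ) : ((finCongr (Nat.add_assoc p 0 q)).trans
    (permSum (Equiv.refl (Fin p)) (finAddFlip (m := 0) (n := q)))).trans
      (finCongr (Nat.add_assoc p q 0)).symm = Equiv.refl (Fin (p + q)) := by
  ext i
  refine Fin.addCases (m := p + 0) (n := q) (fun i => ?_) (fun i => ?_) i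
  · have : (finCongr (Nat.add_assoc p 0 q)) (Fin.castAdd q i) = Fin.castAdd (0 + q) i := by
      ext; simp
    rw [Equiv.trans_apply, Equiv.trans_apply, this]
    erw [permSum_castAdd]
    simp
  · have : (finCongr (Nat.add_assoc p 0 q)) (Fin.natAdd (p + 0) i) =
        Fin.natAdd p (Fin.natAdd 0 i) := by
      ext; simp
    rw [Equiv.trans_apply, Equiv.trans_apply, this, permSum_natAdd, finAddFlip_apply_natAdd]
    simp

/-- Naturality of the symmetry moves the ancilla below the last `q` wires. On the input side the
wiring moves no wire at all and is the identity by `insertEquiv_aux`. -/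
theorem insert_k0 (p q : ℕ) : (𝟙 (mk p) ⊗' k0) ⊗' 𝟙 (mk q) =
    (K (p + q) ≫ pm (insertEquiv p q) : mk (p + q) ⟶ mk (p + 1 + q)) := by
  have h1 : k0 ⊗' 𝟙 (mk q) = pm (finAddFlip (m := 0) (n := q)) ≫ (𝟙 (mk q) ⊗' k0) ≫
      pm (finAddFlip (m := 1) (n := q)).symm := by
    rw [← Category.assoc, ← swap_natural, Category.assoc, pm_comp_symm, Category.comp_id]
  have h2 : 𝟙 (mk p) ⊗' (𝟙 (mk q) ⊗' k0) = pm (finCongr (Nat.add_assoc p q 0)).symm ≫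
      ((𝟙 (mk p) ⊗' 𝟙 (mk q)) ⊗' k0) ≫ pm (finCongr (Nat.add_assoc p q 1)) := by
    rw [tens_assoc, pm_symm_comp_assoc]
  rw [tens_assoc', h1, id_tens_comp, id_tens_comp, h2, id_tens_id, ← pm_refl p, pm_tens, pm_tens]
  simp only [Category.assoc]
  rw [← Category.assoc, ← Category.assoc, pm_comp, pm_comp, pm_comp, pm_comp, insertEquiv_aux]
  exact Category.id_comp _

theorem insert_b0 (p q : ℕ) : (𝟙 (mk p) ⊗' b0) ⊗' 𝟙 (mk q) =
    (pm (insertEquiv p q).symm ≫ B (p + q) : mk (p + 1 + q) ⟶ mk (p + q)) := by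
  have h1 : b0 ⊗' 𝟙 (mk q) = pm (finAddFlip (m := 1) (n := q)) ≫ (𝟙 (mk q) ⊗' b0) ≫
      pm (finAddFlip (m := 0) (n := q)).symm := by
    rw [← Category.assoc, ← swap_natural, Category.assoc, pm_comp_symm, Category.comp_id]
  have h2 : 𝟙 (mk p) ⊗' (𝟙 (mk q) ⊗' b0) = pm (finCongr (Nat.add_assoc p q 1)).symm ≫
      ((𝟙 (mk p) ⊗' 𝟙 (mk q)) ⊗' b0) ≫ pm (finCongr (Nat.add_assoc p q 0)) := by
    rw [tens_assoc, pm_symm_comp_assoc]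
  have h3 : ((finCongr (Nat.add_assoc p q 0)).trans (permSum (Equiv.refl (Fin p))
      (finAddFlip (m := 0) (n := q)).symm)).trans (finCongr (Nat.add_assoc p 0 q)).symm =
      Equiv.refl (Fin (p + q)) := congrArg Equiv.symm (insertEquiv_aux p q)
  rw [tens_assoc', h1, id_tens_comp, id_tens_comp, h2, id_tens_id, ← pm_refl p, pm_tens, pm_tens]
  simp only [Category.assoc]
  rw [pm_comp, pm_comp, ← Equiv.trans_assoc, h3]
  rw [← Category.assoc, ← Category.assoc, pm_comp, pm_comp]
  exact congrArg (_ ≫ ·) (Category.comp_id _)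

theorem cnot3_eq : ofCircuit cnot3 = K 4 ≫ pm (insertEquiv 2 2) ≫ T 0 1 2 ≫ T 2 3 4 ≫ T 0 1 2 ≫
    pm (insertEquiv 2 2).symm ≫ B 4 := by
  have h : ofCircuit cnot3 = ((𝟙 (mk 2) ⊗' k0) ⊗' 𝟙 (mk 2)) ≫ T 0 1 2 ≫ T 2 3 4 ≫ T 0 1 2 ≫
    ((𝟙 (mk 2) ⊗' b0) ⊗' 𝟙 (mk 2)) := by
    simp only [cnot3, ofCircuit_comp, ofCircuit_on]
    rfl
  rw [h, insert_k0, insert_b0]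
  exact Category.assoc _ _ _

end basic

end TOF

namespace TOF

open Circuit

section

variable {N : ℕ} {a b c d e : Fin N}

theorem B_comp_K {n : ℕ} (f : Gate n) :
    B n ≫ f ≫ K n = on Fin.castSucc f * z (Fin.last n) := by
  rw [← Category.assoc, ← B_naturality, Category.assoc, B_K, mul_eq]

theorem cnot3_spec : on Fin.castSucc (ofCircuit cnot3) * z 4 =
    (z 4 * (T 0 1 4 * T 4 2 3 * T 0 1 4) * z 4 : Gate 5) := by
  have h := B_comp_K (ofCircuit cnot3)
  have h4 : Fin.last 4 = 4 := rfl
  rw [h4] at h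
  rw [← h]
  have h1 : (T 0 1 4 * T 4 2 3 * T 0 1 4 : Gate 5) =
      on (insertEquiv 2 2).symm (T 0 1 2 * T 2 3 4 * T 0 1 2) := by
    have hι := (insertEquiv 2 2).symm.injective
    have e0 : (insertEquiv 2 2).symm 0 = 0 := by decide
    have e1 : (insertEquiv 2 2).symm 1 = 1 := by decide
    have e2 : (insertEquiv 2 2).symm 2 = 4 := by decide
    have e3 : (insertEquiv 2 2).symm 3 = 2 := by decide
    have e4 : (insertEquiv 2 2).symm 4 = 3 := by decide
    rw [map_mul, map_mul, on_T hι, on_T hι, e0, e1, e2, e3, e4] <;> decide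
  rw [h1, on_equiv, cnot3_eq]
  have h5 : (z 4 : Gate 5) = B 4 ≫ K 4 := (B_K 4).symm
  rw [h5]
  simp only [mul_eq, Category.assoc, Equiv.symm_symm]

/-- `Rel.tof16` with its ancilla exposed as the wire `e`. Exchanging `b` and `c` regroups a product
of three factors, which will give associativity of the product of oracles. -/
theorem z_T_T_T_z (h : Function.Injective ![a, b, c, d, e]) :
    z e * (T a b e * T e c d * T a b e) * z e = z e * (T a c e * T e b d * T a c e) * z e := by
  have hs : ofCircuit cnot3 = on ![0, 2, 1, 3] (ofCircuit cnot3) :=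
    (ofCircuit_eq Rel.tof16).trans (ofCircuit_on _ _ _)
  have hκ : Function.Injective ![(0 : Fin 5), 2, 1, 3, 4] := by decide
  have base : (z 4 * (T 0 1 4 * T 4 2 3 * T 0 1 4) * z 4 : Gate 5) =
      z 4 * (T 0 2 4 * T 4 1 3 * T 0 2 4) * z 4 := by
    rw [← cnot3_spec]
    have h2 := congrArg (on ![(0 : Fin 5), 2, 1, 3, 4]) cnot3_spec
    rw [map_mul, on_on (Fin.castSucc_injective _) hκ,
      show ![(0 : Fin 5), 2, 1, 3, 4] ∘ Fin.castSucc = Fin.castSucc ∘ ![0, 2, 1, 3] by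
        ext i; fin_cases i <;> rfl,
      ← on_on (by decide) (Fin.castSucc_injective _), ← hs] at h2
    simpa [on_T hκ, on_z hκ] using h2
  simpa [on_T h, on_z h] using congrArg (on ![a, b, c, d, e]) base

end

/-! ### Gates that add a function to an auxiliary wire. -/

variable {n : ℕ}

/-- Extending a map of wires by `n` further wires in front. -/
def lift (n : ℕ) {i j : ℕ} (κ : Fin i → Fin j) : Fin (n + i) → Fin (n + j) :=
  Fin.addCases (Fin.castAdd j) (Fin.natAdd n ∘ κ)

@[simp] theorem lift_castAdd {i j : ℕ} (κ : Fin i → Fin j) (x : Fin n) :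
    lift n κ (Fin.castAdd i x) = Fin.castAdd j x := by simp [lift]

@[simp] theorem lift_natAdd {i j : ℕ} (κ : Fin i → Fin j) (x : Fin i) :
    lift n κ (Fin.natAdd n x) = Fin.natAdd n (κ x) := by simp [lift]

theorem lift_comp_lift {i j k : ℕ} (κ : Fin j → Fin k) (κ' : Fin i → Fin j) :
    lift n κ ∘ lift n κ' = lift n (κ ∘ κ') := by
  ext x
  induction x using Fin.addCases <;> simp

theorem lift_injective {i j : ℕ} {κ : Fin i → Fin j} (h : Function.Injective κ) :
    Function.Injective (lift n κ) := by
  intro x y hxy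
  induction x using Fin.addCases <;> induction y using Fin.addCases <;>
    simp [Fin.ext_iff] at hxy
  · ext; simpa using hxy
  · omega
  · omega
  · rw [h (Fin.ext hxy)]

theorem lift_id (n i : ℕ) : lift n (id : Fin i → Fin i) = id := by
  ext x
  induction x using Fin.addCases <;> simp

theorem castSucc_eq_lift (n i : ℕ) :
    (Fin.castSucc : Fin (n + i) → Fin (n + i + 1)) = lift n Fin.castSucc := by
  ext x
  induction x using Fin.addCases <;> simp

theorem natAdd_ne {j : ℕ} {a b : Fin j} (h : a ≠ b) : Fin.natAdd n a ≠ Fin.natAdd n b := by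
  simpa using h

theorem castAdd_ne_natAdd {j : ℕ} (x : Fin n) (a : Fin j) : Fin.castAdd j x ≠ Fin.natAdd n a := by
  intro h
  simp [Fin.ext_iff] at h
  omega

/-- The gate `U` whose target, the last wire, is the auxiliary wire `a`. -/
noncomputable def at' {j : ℕ} (a : Fin j) : Gate (n + 1) →* Gate (n + j) := on (lift n ![a])

/-- Gates on auxiliary wires. -/
noncomputable abbrev tx (n : ℕ) {j : ℕ} (a b c : Fin j) : Gate (n + j) :=
  T (Fin.natAdd n a) (Fin.natAdd n b) (Fin.natAdd n c)

noncomputable abbrev cx (n : ℕ) {j : ℕ} (a b : Fin j) : Gate (n + j) :=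
  C (Fin.natAdd n a) (Fin.natAdd n b)

noncomputable abbrev xx (n : ℕ) {j : ℕ} (a : Fin j) : Gate (n + j) := X (Fin.natAdd n a)

noncomputable abbrev zx (n : ℕ) {j : ℕ} (a : Fin j) : Gate (n + j) := z (Fin.natAdd n a)

noncomputable abbrev ox (n : ℕ) {j : ℕ} (a : Fin j) : Gate (n + j) := o (Fin.natAdd n a)

section

variable {i j : ℕ} {κ : Fin i → Fin j}

theorem lift_at (hκ : Function.Injective κ) (a : Fin i) (U : Gate (n + 1)) :
    on (lift n κ) (at' a U) = at' (κ a) U := by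
  rw [at', at', on_on (lift_injective (injective_vec1 a)) (lift_injective hκ), lift_comp_lift,
    comp_vec1]

theorem lift_tx (hκ : Function.Injective κ) {a b c : Fin i} (hab : a ≠ b) (hac : a ≠ c)
    (hbc : b ≠ c) : on (lift n κ) (tx n a b c) = tx n (κ a) (κ b) (κ c) := by
  rw [on_T (lift_injective hκ) (natAdd_ne hab) (natAdd_ne hac) (natAdd_ne hbc)]
  simp

theorem lift_cx (hκ : Function.Injective κ) {a b : Fin i} (hab : a ≠ b) :
    on (lift n κ) (cx n a b) = cx n (κ a) (κ b) := by
  rw [on_C (lift_injective hκ) (natAdd_ne hab)]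
  simp

theorem lift_xx (hκ : Function.Injective κ) (a : Fin i) :
    on (lift n κ) (xx n a) = xx n (κ a) := by
  rw [on_X (lift_injective hκ)]
  simp

theorem lift_zx (hκ : Function.Injective κ) (a : Fin i) :
    on (lift n κ) (zx n a) = zx n (κ a) := by
  rw [on_z (lift_injective hκ)]
  simp

theorem commute_at_on (a : Fin j) (U : Gate (n + 1)) {k : ℕ} {ι : Fin k → Fin j}
    (hι : Function.Injective ι) (h : ∀ x, a ≠ ι x) (g : Gate k) :
    Commute (at' a U) (on (Fin.natAdd n ∘ ι) g) := by
  refine commute_on (lift_injective (injective_vec1 a))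
    ((Fin.natAdd_injective _ n).comp hι) (fun x y => ?_) _ _
  induction x using Fin.addCases with
  | left x => simpa using castAdd_ne_natAdd x (ι y)
  | right x => simpa [Fin.fin_one_eq_zero x] using h y

variable {a b c d : Fin j} (U : Gate (n + 1))

theorem commute_at_tx (hbc : b ≠ c) (hbd : b ≠ d) (hcd : c ≠ d) (hab : a ≠ b) (hac : a ≠ c)
    (had : a ≠ d) : Commute (at' a U) (tx n b c d) := by
  rw [tx, T, ← comp_vec3]
  exact commute_at_on a U (injective_vec3.2 ⟨hbc, hbd, hcd⟩)
    (fun i => by fin_cases i; exacts [hab, hac, had]) _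

theorem commute_at_cx (hbc : b ≠ c) (hab : a ≠ b) (hac : a ≠ c) :
    Commute (at' a U) (cx n b c) := by
  rw [cx, C, ← comp_vec2]
  exact commute_at_on a U (injective_vec2.2 hbc)
    (fun i => by fin_cases i; exacts [hab, hac]) _

theorem commute_at_xx (hab : a ≠ b) : Commute (at' a U) (xx n b) := by
  rw [xx, X, ← comp_vec1]
  exact commute_at_on a U (injective_vec1 b) (fun i => by fin_cases i; exact hab) _

theorem commute_at_zx (hab : a ≠ b) : Commute (at' a U) (zx n b) := by
  rw [zx, z, ← comp_vec1]
  exact commute_at_on a U (injective_vec1 b) (fun i => by fin_cases i; exact hab) _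

theorem commute_at_ox (hab : a ≠ b) : Commute (at' a U) (ox n b) := by
  rw [ox, o, ← comp_vec1]
  exact commute_at_on a U (injective_vec1 b) (fun i => by fin_cases i; exact hab) _

end

theorem at_zero (U : Gate (n + 1)) : at' (0 : Fin 1) U = U := by
  rw [at', show (![0] : Fin 1 → Fin 1) = id by ext x; fin_cases x; rfl, lift_id, on_id]

/-- Properties of the gates which add a function of the first `n` wires to the last one. -/
structure Pre (U : Gate (n + 1)) : Prop where
  sq : U * U = 1
  -- A cnot from the target to another wire duplicates the added value.
  copy : cx n 0 1 * at' (0 : Fin 2) U * cx n 0 1 = at' 0 U * at' 1 U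
  tof : Commute (at' (0 : Fin 3) U) (tx n 1 2 0)

/-- The gates `U` and `V` commute for the same and for different targets. -/
def Comm (U V : Gate (n + 1)) : Prop :=
  Commute U V ∧ Commute (at' (0 : Fin 2) U) (at' 1 V)

section

variable {j : ℕ} {a b c d : Fin j} {U V W : Gate (n + 1)}

theorem at_sq (h : Pre U) (a : Fin j) : at' a U * at' a U = 1 := by
  rw [← map_mul, h.sq, map_one]

theorem at_copy (h : Pre U) (hab : a ≠ b) :
    cx n a b * at' a U * cx n a b = at' a U * at' b U := by
  have hκ := injective_vec2.2 hab
  have := congrArg (on (lift n ![a, b])) h.copy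
  simp only [map_mul, lift_at hκ, lift_cx hκ (show (0 : Fin 2) ≠ 1 by decide)] at this
  exact this

theorem at_tof (h : Pre U) (hab : a ≠ b) (hac : a ≠ c) (hbc : b ≠ c) :
    Commute (at' a U) (tx n b c a) := by
  have hκ := injective_vec3.2 ⟨hab, hac, hbc⟩
  have := congrArg (on (lift n ![a, b, c])) h.tof.eq
  simp only [map_mul, lift_at hκ] at this
  rw [lift_tx hκ (by decide) (by decide) (by decide)] at this
  exact this

theorem Comm.symm (h : Comm U V) : Comm V U := by
  refine ⟨h.1.symm, ?_⟩
  have hκ : Function.Injective ![(1 : Fin 2), 0] := by decide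
  have := congrArg (on (lift n ![(1 : Fin 2), 0])) h.2.eq
  simp only [map_mul, lift_at hκ] at this
  exact this.symm

theorem Comm.at (h : Comm U V) (a b : Fin j) : Commute (at' a U) (at' b V) := by
  by_cases hab : a = b
  · rw [hab]
    exact h.1.map _
  have hκ := injective_vec2.2 hab
  have := congrArg (on (lift n ![a, b])) h.2.eq
  simp only [map_mul, lift_at hκ] at this
  exact this

/-- The part of the gate `at' a U * tx n a b c * at' a U` that does not depend on the value of the
wire `a` does not depend on the choice of the wire `a` either. -/
theorem tof_conj_indep (h : Pre U) (hc : Comm U U) :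
    at' (3 : Fin 4) U * tx n 3 1 2 * at' 3 U * tx n 3 1 2 =
      at' 0 U * tx n 0 1 2 * at' 0 U * tx n 0 1 2 := by
  have h0 := at_sq h (0 : Fin 4)
  have h3 := at_sq h (3 : Fin 4)
  have h03 : cx n 0 3 * at' (0 : Fin 4) U * cx n 0 3 = at' 0 U * at' 3 U := at_copy h (by decide)
  have hcx : cx n (0 : Fin 4) 3 * cx n 0 3 = 1 := C_mul_self (natAdd_ne (by decide))
  have hcomm : Commute (at' (0 : Fin 4) U) (at' 3 U) := hc.at 0 3
  have hTT : cx n (0 : Fin 4) 3 * tx n 3 1 2 * cx n 0 3 = tx n 0 1 2 * tx n 3 1 2 := by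
    apply C_T_C
    rw [injective_vec4]
    refine ⟨?_, ?_, ?_, ?_, ?_, ?_⟩ <;> exact natAdd_ne (by decide)
  have hT0 : tx n (0 : Fin 4) 1 2 * tx n 0 1 2 = 1 :=
    T_mul_self (natAdd_ne (by decide)) (natAdd_ne (by decide)) (natAdd_ne (by decide))
  have hcT : Commute (tx n (0 : Fin 4) 1 2) (tx n 3 1 2) := by
    apply commute_T_T_target_control
    rw [injective_vec4]
    refine ⟨?_, ?_, ?_, ?_, ?_, ?_⟩ <;> exact natAdd_ne (by decide)
  have hT3 : tx n (3 : Fin 4) 1 2 * tx n 3 1 2 = 1 :=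
    T_mul_self (natAdd_ne (by decide)) (natAdd_ne (by decide)) (natAdd_ne (by decide))
  have hU3 : Commute (at' (3 : Fin 4) U) (tx n 0 1 2) :=
    commute_at_tx U (by decide) (by decide) (by decide) (by decide) (by decide) (by decide)
  have hU0 : Commute (at' (0 : Fin 4) U) (tx n 3 1 2) :=
    commute_at_tx U (by decide) (by decide) (by decide) (by decide) (by decide) (by decide)
  generalize at' (3 : Fin 4) U = u3 at *
  generalize at' (0 : Fin 4) U = u0 at *
  generalize tx n (3 : Fin 4) 1 2 = t3 at *
  generalize tx n (0 : Fin 4) 1 2 = t0 at *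
  generalize cx n (0 : Fin 4) 3 = c at *
  -- Both sides add the product of `U` and the wire 1 to the wire 2. To compare them, u0 u3 is
  -- written as u0 conjugated by the cnot from wire 0 to wire 3; the same cnot conjugates t3 to t0
  -- t3, and all occurrences of `U` cancel. This gives `key`, and `Y` is an involution.
  set Y := u0 * t0 * u0 with hY
  have hYY : Y * Y = 1 := by
    rw [hY]
    calc u0 * t0 * u0 * (u0 * t0 * u0) = u0 * t0 * (u0 * u0) * t0 * u0 := by simp only [mul_assoc]
      _ = u0 * (t0 * t0) * u0 := by rw [h0]; simp only [mul_assoc, one_mul]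
      _ = 1 := by rw [hT0, mul_one, h0]
  have key : Y * (u3 * t3 * u3) = t0 * t3 := by
    calc Y * (u3 * t3 * u3) = u0 * t0 * (u0 * u3) * t3 * u3 := by rw [hY]; simp only [mul_assoc]
      _ = u0 * (t0 * u3) * (u0 * t3) * u3 := by rw [hcomm.eq]; simp only [mul_assoc]
      _ = u0 * u3 * (t0 * t3) * (u0 * u3) := by rw [hU0.eq, ← hU3.eq]; simp only [mul_assoc]
      _ = c * u0 * (c * c) * t3 * (c * c) * u0 * c := by
          rw [← h03, ← hTT]; simp only [mul_assoc]
      _ = c * (u0 * t3) * u0 * c := by rw [hcx]; simp only [mul_assoc, mul_one]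
      _ = c * t3 * (u0 * u0) * c := by rw [hU0.eq]; simp only [mul_assoc]
      _ = t0 * t3 := by rw [h0, mul_one, hTT]
  calc u3 * t3 * u3 * t3 = Y * Y * (u3 * t3 * u3) * t3 := by rw [hYY, one_mul]
    _ = Y * (t0 * (t3 * t3)) := by rw [mul_assoc Y, key]; simp only [mul_assoc]
    _ = Y * t0 := by rw [hT3, mul_one]

/-- Everything that commutes with the gate for another choice of the wire `a` commutes with it. -/
theorem commute_of_indep (h : Pre U) (hc : Comm U U) {Q : Gate (n + 4)}
    (hQ : Commute Q (at' (3 : Fin 4) U)) (hT : Commute Q (tx n 3 1 2)) :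
    Commute Q (at' 0 U * tx n 0 1 2 * at' 0 U * tx n 0 1 2) := by
  rw [← tof_conj_indep h hc]
  exact ((hQ.mul_right hT).mul_right hQ).mul_right hT

theorem castSucc_conj : on (lift n (Fin.castSucc : Fin 3 → Fin 4))
    (at' (0 : Fin 3) U * tx n 0 1 2 * at' 0 U * tx n 0 1 2) =
      at' 0 U * tx n 0 1 2 * at' 0 U * tx n 0 1 2 := by
  have hκ := Fin.castSucc_injective 3
  have h012 := lift_tx (n := n) hκ (show (0 : Fin 3) ≠ 1 by decide) (show (0 : Fin 3) ≠ 2 by decide)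
    (show (1 : Fin 3) ≠ 2 by decide)
  simp only [map_mul, lift_at hκ, h012]
  rfl

/-- By `tof_conj_indep` the commutator can be computed on a fourth wire instead of `a`, where it is
visibly independent of the target of `W`. -/
theorem commute_at_conj (h : Pre U) (hc : Comm U U) (W : Gate (n + 1)) (hab : a ≠ b) (hac : a ≠ c)
    (hbc : b ≠ c) (hW : Comm U W) :
    Commute (at' a W) (at' a U * tx n a b c * at' a U * tx n a b c) := by
  have base : Commute (at' (0 : Fin 3) W) (at' 0 U * tx n 0 1 2 * at' 0 U * tx n 0 1 2) := by
    apply on_injective (lift_injective (n := n) (Fin.castSucc_injective 3))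
    rw [map_mul _ (at' 0 W), map_mul _ _ (at' 0 W), castSucc_conj, lift_at (Fin.castSucc_injective 3)]
    exact commute_of_indep h hc (Q := at' 0 W) (hW.symm.at 0 3)
      (commute_at_tx W (by decide) (by decide) (by decide) (by decide) (by decide) (by decide))
  have hκ := injective_vec3.2 ⟨hab, hac, hbc⟩
  have := congrArg (on (lift n ![a, b, c])) base.eq
  simp only [map_mul, lift_at hκ] at this
  rw [lift_tx hκ (by decide) (by decide) (by decide)] at this
  exact this

/-- Uncomputation restores the auxiliary wire `a`. Up to a Toffoli gate controlled by `a`, which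
commutes with the test of `a`, the gate is the commutator, and this can be computed without the wire
`a`. -/
theorem clean (h : Pre U) (hc : Comm U U) (hab : a ≠ b) (hac : a ≠ c) (hbc : b ≠ c) :
    Commute (zx n a) (at' a U * tx n a b c * at' a U) := by
  have base : Commute (zx n (0 : Fin 3)) (at' 0 U * tx n 0 1 2 * at' 0 U * tx n 0 1 2) := by
    apply on_injective (lift_injective (n := n) (Fin.castSucc_injective 3))
    rw [map_mul _ (zx n 0), map_mul _ _ (zx n 0), castSucc_conj, lift_zx (Fin.castSucc_injective 3)]
    exact commute_of_indep h hc (Q := zx n 0) (commute_at_zx U (by decide)).symm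
      (commute_z_T (natAdd_ne (by decide)) (natAdd_ne (by decide)) (natAdd_ne (by decide))
        (natAdd_ne (by decide)) (natAdd_ne (by decide)) (natAdd_ne (by decide)))
  have hκ := injective_vec3.2 ⟨hab, hac, hbc⟩
  have h1 := congrArg (on (lift n ![a, b, c])) base.eq
  simp only [map_mul, lift_at hκ, lift_zx hκ] at h1
  rw [lift_tx hκ (by decide) (by decide) (by decide)] at h1
  have h2 : Commute (zx n a) (at' a U * tx n a b c * at' a U * tx n a b c) := h1
  have h3 : Commute (zx n a) (tx n a b c) :=
    commute_z_T' (natAdd_ne hab) (natAdd_ne hac) (natAdd_ne hbc)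
  have h4 : at' a U * tx n a b c * at' a U =
      at' a U * tx n a b c * at' a U * tx n a b c * tx n a b c := by
    rw [mul_assoc _ (tx n a b c) (tx n a b c),
      T_mul_self (natAdd_ne hab) (natAdd_ne hac) (natAdd_ne hbc), mul_one]
  rw [h4]
  exact h2.mul_right h3

end

end TOF

/-! ### The product of two oracles. -/

namespace TOF

open Circuit

variable {n : ℕ}

/-- The sum of two oracles is their composite; this is their product, computed with two
auxiliary wires. -/
noncomputable def prodAt {j : ℕ} (U V : Gate (n + 1)) (a b c : Fin j) : Gate (n + j) :=
  at' b U * at' c V * tx n b c a * at' c V * at' b U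

/-- The two auxiliary wires are prepared as 0 and postselected to be 0. Under the hypotheses of
`Comp` the postselection has no effect, since `clean_prodAt` shows that the wires are restored. -/
noncomputable def mulO (U V : Gate (n + 1)) : Gate (n + 1) :=
  K (n + 1) ≫ K (n + 2) ≫ (prodAt U V 0 1 2 : Gate (n + 3)) ≫ B (n + 2) ≫ B (n + 1)

/-- The oracle with the constant value `1`. -/
noncomputable def oneO (n : ℕ) : Gate (n + 1) := xx n (0 : Fin 1)

/-- The oracle of a variable. -/
noncomputable def varO (i : Fin n) : Gate (n + 1) := C (Fin.castAdd 1 i) (Fin.natAdd n 0)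

theorem at_oneO {j : ℕ} (a : Fin j) : at' a (oneO n) = xx n a :=
  lift_xx (injective_vec1 a) 0

theorem at_varO {j : ℕ} (a : Fin j) (i : Fin n) :
    at' a (varO i) = C (Fin.castAdd j i) (Fin.natAdd n a) := by
  rw [at', varO, on_C (lift_injective (injective_vec1 a)) (castAdd_ne_natAdd i 0)]
  simp

section

variable {j : ℕ} {a b c d : Fin j} {U V W : Gate (n + 1)}

theorem cx_sq (hab : a ≠ b) : cx n a b * cx n a b = 1 := C_mul_self (natAdd_ne hab)

theorem tx_sq (hab : a ≠ b) (hac : a ≠ c) (hbc : b ≠ c) : tx n a b c * tx n a b c = 1 :=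
  T_mul_self (natAdd_ne hab) (natAdd_ne hac) (natAdd_ne hbc)

theorem commute_zx_tx (hbc : b ≠ c) (hbd : b ≠ d) (hcd : c ≠ d) (hab : a ≠ b) (hac : a ≠ c)
    (had : a ≠ d) : Commute (zx n a) (tx n b c d) :=
  commute_z_T (natAdd_ne hbc) (natAdd_ne hbd) (natAdd_ne hcd) (natAdd_ne hab) (natAdd_ne hac)
    (natAdd_ne had)

theorem commute_zx_cx (hbc : b ≠ c) (hab : a ≠ b) (hac : a ≠ c) : Commute (zx n a) (cx n b c) :=
  commute_z_C (natAdd_ne hbc) (natAdd_ne hab) (natAdd_ne hac)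

theorem prodAt_comm (hUV : Comm U V) (hbc : b ≠ c) (hba : b ≠ a) (hca : c ≠ a) :
    prodAt U V a b c = prodAt V U a c b := by
  unfold prodAt
  rw [show tx n b c a = tx n c b a from
    T_comm_controls (natAdd_ne hbc) (natAdd_ne hba) (natAdd_ne hca), (hUV.at b c).eq, mul_assoc,
    ← (hUV.at b c).eq, ← mul_assoc]

/-- As `U` and `V` commute, `V` can be moved to the outside, which leaves the situation of `clean`
in the middle. -/
theorem clean_left (h : Pre U) (hU : Comm U U) (hUV : Comm U V) (hbc : b ≠ c) (hba : b ≠ a)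
    (hca : c ≠ a) : Commute (zx n b) (prodAt U V a b c) := by
  have h1 : prodAt U V a b c = at' c V * (at' b U * tx n b c a * at' b U) * at' c V := by
    unfold prodAt
    have hc := hUV.at b c
    generalize at' b U = u at *
    generalize at' c V = v at *
    calc u * v * tx n b c a * v * u = u * v * tx n b c a * (v * u) := by simp only [mul_assoc]
      _ = v * u * tx n b c a * (u * v) := by rw [hc.eq]
      _ = v * (u * tx n b c a * u) * v := by simp only [mul_assoc]
  rw [h1]
  have h2 := (commute_at_zx (n := n) V hbc.symm).symm
  exact (h2.mul_right (clean h hU hbc hba hca)).mul_right h2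

/-- The oracles `U` and `V` can be multiplied. -/
structure Comp (U V : Gate (n + 1)) : Prop where
  preL : Pre U
  preR : Pre V
  commL : Comm U U
  commR : Comm V V
  comm : Comm U V

theorem clean_prodAt (h : Comp U V) (hbc : b ≠ c) (hba : b ≠ a) (hca : c ≠ a) :
    Commute (prodAt U V a b c) (zx n b * zx n c) := by
  refine ((clean_left h.preL h.commL h.comm hbc hba hca).mul_left ?_).symm
  rw [prodAt_comm h.comm hbc hba hca]
  exact clean_left h.preR h.commR h.comm.symm hbc.symm hca hba

theorem lift_prodAt {i : ℕ} {κ : Fin j → Fin i} (hκ : Function.Injective κ) (hbc : b ≠ c)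
    (hba : b ≠ a) (hca : c ≠ a) :
    on (lift n κ) (prodAt U V a b c) = prodAt U V (κ a) (κ b) (κ c) := by
  simp only [prodAt, map_mul, lift_at hκ, lift_tx hκ hbc hba hca]

theorem castSucc_at (a : Fin j) (U : Gate (n + 1)) :
    on Fin.castSucc (at' a U) = at' a.castSucc U := by
  rw [castSucc_eq_lift, lift_at (Fin.castSucc_injective _)]

theorem castSucc_zx (a : Fin j) : on Fin.castSucc (zx n a) = zx n a.castSucc := by
  rw [castSucc_eq_lift, lift_zx (Fin.castSucc_injective _)]

theorem castSucc_mulO_base (h : Comp U V) :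
    at' (0 : Fin 3) (mulO U V) * (zx n 1 * zx n 2) = prodAt U V 0 1 2 * (zx n 1 * zx n 2) := by
  have hZ : ∀ W : Gate (n + 1), B (n + 2) ≫ (B (n + 1) ≫ W ≫ K (n + 1)) ≫ K (n + 2) =
      at' (0 : Fin 3) W * (zx n 1 * zx n 2) := by
    intro W
    have h1 : on Fin.castSucc W = at' (0 : Fin 2) W := by
      conv_lhs => rw [← at_zero W]
      exact castSucc_at 0 W
    rw [B_comp_K W, h1, B_comp_K, map_mul]
    rw [show on Fin.castSucc (at' (0 : Fin 2) W) = at' (0 : Fin 3) W from castSucc_at 0 W,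
      show on Fin.castSucc (z (Fin.last (n + 1))) = zx n (1 : Fin 3) from castSucc_zx (1 : Fin 2),
      mul_assoc]
    rfl
  have hz := hZ 1
  rw [map_one, one_mul, one_eq, Category.id_comp] at hz
  have h2 : at' (0 : Fin 3) (mulO U V) * (zx n 1 * zx n 2) =
      (zx n 1 * zx n 2) * prodAt U V 0 1 2 * (zx n 1 * zx n 2) := by
    rw [← hZ, ← hz, mulO]
    simp only [mul_eq, Category.assoc]
  have h3 : (zx n (1 : Fin 3) * zx n 2) * (zx n 1 * zx n 2) = zx n 1 * zx n 2 := by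
    have hc : Commute (zx n (1 : Fin 3)) (zx n 2) := commute_z_z (natAdd_ne (by decide))
    rw [mul_assoc, ← mul_assoc (zx n 2), hc.symm.eq, mul_assoc (zx n 1), z_mul_z, ← mul_assoc,
      z_mul_z]
  rw [h2, (clean_prodAt h (by decide) (by decide) (by decide)).symm.eq, mul_assoc, h3]

/-- The working description of the product: next to two zero wires it may be replaced by the
explicit circuit `prodAt`, with no postselection left. -/
theorem mulO_spec (h : Comp U V) (hbc : b ≠ c) (hba : b ≠ a) (hca : c ≠ a) :
    at' a (mulO U V) * (zx n b * zx n c) = prodAt U V a b c * (zx n b * zx n c) := by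
  have hκ := injective_vec3.2 ⟨hba.symm, hca.symm, hbc⟩
  have := congrArg (on (lift n ![a, b, c])) (castSucc_mulO_base h)
  simp only [map_mul, lift_at hκ, lift_zx hκ] at this
  rw [lift_prodAt hκ (by decide) (by decide) (by decide)] at this
  exact this

/-- Adding two auxiliary wires. -/
noncomputable def up2 : Gate (n + j) →* Gate (n + (j + 2)) := on (lift n (Fin.castAdd 2))

/-- Wires with value 0 can be split off again, so an identity may be checked after adding two zero
ancillas. The laws of `mulO` are proved in this way together with `mulO_spec`. -/
theorem up2_cancel {f g : Gate (n + j)}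
    (h : up2 f * (zx n (Fin.natAdd j 0) * zx n (Fin.natAdd j 1)) =
      up2 g * (zx n (Fin.natAdd j 0) * zx n (Fin.natAdd j 1))) : f = g := by
  have e : ∀ f : Gate (n + j), up2 f = on Fin.castSucc (on Fin.castSucc f) := by
    intro f
    rw [on_on (Fin.castSucc_injective _) (Fin.castSucc_injective _), up2]
    congr 2
    ext x
    induction x using Fin.addCases <;> simp
  have e0 : (zx n (Fin.natAdd j (0 : Fin 2)) : Gate (n + j + 2)) =
      on Fin.castSucc (z (Fin.last (n + j))) := by
    rw [on_z (Fin.castSucc_injective _)]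
    rfl
  have e1 : (zx n (Fin.natAdd j (1 : Fin 2)) : Gate (n + j + 2)) =  z (Fin.last (n + j + 1)) := rfl
  rw [← mul_assoc, ← mul_assoc] at h
  erw [e, e, e0, e1, ← map_mul, ← map_mul] at h
  exact on_castSucc_mul_z_cancel (on_castSucc_mul_z_cancel h)

theorem up2_at (a : Fin j) (U : Gate (n + 1)) : up2 (at' a U) = at' (Fin.castAdd 2 a) U :=
  lift_at (Fin.castAdd_injective _ _) a U

theorem up2_tx (hab : a ≠ b) (hac : a ≠ c) (hbc : b ≠ c) : up2 (tx n a b c) =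
    tx n (Fin.castAdd 2 a) (Fin.castAdd 2 b) (Fin.castAdd 2 c) :=
  lift_tx (Fin.castAdd_injective _ _) hab hac hbc

theorem up2_cx (hab : a ≠ b) : up2 (cx n a b) = cx n (Fin.castAdd 2 a) (Fin.castAdd 2 b) :=
  lift_cx (Fin.castAdd_injective _ _) hab

theorem mulO_at_commute (h : Comp U V) (hbc : b ≠ c) (hba : b ≠ a) (hca : c ≠ a)
    {Q : Gate (n + j)} (hQb : Commute Q (zx n b)) (hQc : Commute Q (zx n c))
    (hQ : Commute Q (prodAt U V a b c)) :
    at' a (mulO U V) * Q * (zx n b * zx n c) = Q * at' a (mulO U V) * (zx n b * zx n c) := by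
  rw [mul_assoc, (hQb.mul_right hQc).eq, ← mul_assoc, mulO_spec h hbc hba hca, mul_assoc,
    ← (hQb.mul_right hQc).eq, ← mul_assoc, ← hQ.eq, mul_assoc, ← mulO_spec h hbc hba hca, mul_assoc]

theorem commute_prodAt {Q : Gate (n + j)} (hU : Commute Q (at' b U)) (hV : Commute Q (at' c V))
    (hT : Commute Q (tx n b c a)) : Commute Q (prodAt U V a b c) :=
  (((hU.mul_right hV).mul_right hT).mul_right hV).mul_right hU

/-- `W` commutes with the constituents of `prodAt`. For a common target the Toffoli gate is the
critical one, and `Pre.tof` covers it; for different targets it touches no target of `W`. -/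
theorem comm_mulO (h : Comp U V) (hU : Comm U W) (hV : Comm V W) (hW : Pre W) :
    Comm (mulO U V) W := by
  constructor
  · rw [commute_iff_eq]
    apply up2_cancel (j := 1)
    have e : ∀ U : Gate (n + 1), (up2 U : Gate (n + 3)) = at' (0 : Fin 3) U := by
      intro U
      conv_lhs => rw [← at_zero U]
      exact up2_at 0 U
    simp only [map_mul]
    erw [e, e]
    exact mulO_at_commute h (b := 1) (c := 2) (by decide) (by decide) (by decide)
      (commute_at_zx W (by decide)) (commute_at_zx W (by decide))
      (commute_prodAt (hU.at 1 0).symm (hV.at 2 0).symm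
        (at_tof hW (by decide) (by decide) (by decide)))
  · rw [commute_iff_eq]
    apply up2_cancel (j := 2)
    simp only [map_mul, up2_at]
    exact mulO_at_commute (j := 4) h (a := 0) (b := 2) (c := 3) (Q := at' 1 W) (by decide)
      (by decide) (by decide)
      (commute_at_zx W (by decide)) (commute_at_zx W (by decide))
      (commute_prodAt (hU.at 2 1).symm (hV.at 3 1).symm
        (commute_at_tx W (by decide) (by decide) (by decide) (by decide) (by decide) (by decide)))

theorem prodAt_mul_self (h : Comp U V) (hbc : b ≠ c) (hba : b ≠ a) (hca : c ≠ a) :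
    prodAt U V a b c * prodAt U V a b c = 1 := by
  have hU := at_sq h.preL b
  have hV := at_sq h.preR c
  have hT := tx_sq (n := n) hbc hba hca
  unfold prodAt
  generalize at' b U = u at *
  generalize at' c V = v at *
  generalize tx n b c a = t at *
  calc u * v * t * v * u * (u * v * t * v * u) = u * v * t * v * (u * u) * v * t * v * u := by
        simp only [mul_assoc]
    _ = u * v * t * (v * v) * t * v * u := by rw [hU]; simp only [mul_assoc, one_mul]
    _ = u * v * (t * t) * v * u := by rw [hV]; simp only [mul_assoc, one_mul]
    _ = u * (v * v) * u := by rw [hT]; simp only [mul_assoc, one_mul]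
    _ = 1 := by rw [hV, mul_one, hU]

theorem pre_mulO (h : Comp U V) : Pre (mulO U V) := by
  constructor
  · apply up2_cancel (j := 1)
    have e : ∀ U : Gate (n + 1), (up2 U : Gate (n + 3)) = at' (0 : Fin 3) U := by
      intro U
      conv_lhs => rw [← at_zero U]
      exact up2_at 0 U
    rw [map_mul, map_one, one_mul]
    erw [e]
    have h1 := mulO_spec (j := 3) h (a := 0) (b := 1) (c := 2) (by decide) (by decide) (by decide)
    have hc := clean_prodAt (j := 3) h (a := 0) (b := 1) (c := 2) (by decide) (by decide)
      (by decide)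
    have hP := prodAt_mul_self (j := 3) h (a := 0) (b := 1) (c := 2) (by decide) (by decide)
      (by decide)
    show at' (0 : Fin 3) (mulO U V) * at' (0 : Fin 3) (mulO U V) * (zx n 1 * zx n 2) =
      zx n 1 * zx n 2
    rw [mul_assoc, h1, hc.eq, ← mul_assoc, h1, mul_assoc, ← hc.eq, ← mul_assoc, hP, one_mul]
  · apply up2_cancel (j := 2)
    simp only [map_mul, up2_at, up2_cx (show (0 : Fin 2) ≠ 1 by decide)]
    show cx n (0 : Fin 4) 1 * at' 0 (mulO U V) * cx n 0 1 * (zx n 2 * zx n 3) =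
      at' 0 (mulO U V) * at' 1 (mulO U V) * (zx n 2 * zx n 3)
    have h0 := mulO_spec (j := 4) h (a := 0) (b := 2) (c := 3) (by decide) (by decide) (by decide)
    have h1 := mulO_spec (j := 4) h (a := 1) (b := 2) (c := 3) (by decide) (by decide) (by decide)
    have hc1 := clean_prodAt (j := 4) h (a := 1) (b := 2) (c := 3) (by decide) (by decide)
      (by decide)
    have hcz : Commute (cx n (0 : Fin 4) 1) (zx n 2 * zx n 3) :=
      (commute_zx_cx (by decide) (by decide) (by decide)).symm.mul_right
        (commute_zx_cx (by decide) (by decide) (by decide)).symm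
    have hcU : Commute (cx n (0 : Fin 4) 1) (at' 2 U) :=
      (commute_at_cx U (by decide) (by decide) (by decide)).symm
    have hcV : Commute (cx n (0 : Fin 4) 1) (at' 3 V) :=
      (commute_at_cx V (by decide) (by decide) (by decide)).symm
    -- The cnot commutes with the oracles on the ancillas 2 and 3, so only the Toffoli gate in the
    -- middle is duplicated. Inserting an uncomputation and a recomputation between the two copies
    -- gives the two products.
    have hcT : cx n (0 : Fin 4) 1 * tx n 2 3 0 * cx n 0 1 = tx n 2 3 0 * tx n 2 3 1 := by
      apply C_T_C_target
      rw [injective_vec4]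
      refine ⟨?_, ?_, ?_, ?_, ?_, ?_⟩ <;> exact natAdd_ne (by decide)
    have hU := at_sq h.preL (2 : Fin 4)
    have hV := at_sq h.preR (3 : Fin 4)
    rw [mul_assoc, hcz.eq, ← mul_assoc, mul_assoc (cx n (0 : Fin 4) 1), h0, mul_assoc (at' 0 _), h1,
      hc1.eq, ← mul_assoc (at' 0 _), h0, mul_assoc _ (zx n 2 * zx n 3), ← hc1.eq, ← mul_assoc,
      mul_assoc _ _ (cx n 0 1), ← hcz.eq, ← mul_assoc, ← mul_assoc _ (prodAt U V 1 2 3)]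
    congr 1
    unfold prodAt
    generalize at' (2 : Fin 4) U = u at *
    generalize at' (3 : Fin 4) V = v at *
    generalize tx n (2 : Fin 4) 3 0 = t0 at *
    generalize tx n (2 : Fin 4) 3 1 = t1 at *
    generalize cx n (0 : Fin 4) 1 = c at *
    calc c * (u * v * t0 * v * u) * c = (c * u) * v * t0 * v * (u * c) := by
          simp only [mul_assoc]
      _ = u * c * v * t0 * v * (c * u) := by rw [hcU.eq]
      _ = u * (c * v) * t0 * (v * c) * u := by simp only [mul_assoc]
      _ = u * (v * c) * t0 * (c * v) * u := by rw [hcV.eq]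
      _ = u * v * (c * t0 * c) * v * u := by simp only [mul_assoc]
      _ = u * v * t0 * (v * (u * u) * v) * t1 * v * u := by
        rw [hcT, hU, mul_one, hV, mul_one]; simp only [mul_assoc]
      _ = u * v * t0 * v * u * (u * v * t1 * v * u) := by simp only [mul_assoc]
  · rw [commute_iff_eq]
    apply up2_cancel (j := 3)
    simp only [map_mul, up2_at]
    rw [up2_tx (by decide) (by decide) (by decide)]
    refine mulO_at_commute (j := 5) h (a := 0) (b := 3) (c := 4) (Q := tx n 1 2 0) (by decide)
      (by decide) (by decide)
      (commute_zx_tx (by decide) (by decide) (by decide) (by decide) (by decide) (by decide)).symm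
      (commute_zx_tx (by decide) (by decide) (by decide) (by decide) (by decide) (by decide)).symm
      (commute_prodAt
        (commute_at_tx U (by decide) (by decide) (by decide) (by decide) (by decide)
          (by decide)).symm
        (commute_at_tx V (by decide) (by decide) (by decide) (by decide) (by decide)
          (by decide)).symm
        (commute_T_T_target ?_))
    rw [injective_vec5]
    refine ⟨?_, ?_, ?_, ?_, ?_, ?_, ?_, ?_, ?_, ?_⟩ <;> exact natAdd_ne (by decide)

end

end TOF

/-! ### Closure of the oracles under sums and products. -/

namespace TOF

open Circuit

variable {n : ℕ}

theorem comm_one (U : Gate (n + 1)) : Comm 1 U :=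
  ⟨Commute.one_left _, by rw [map_one]; exact Commute.one_left _⟩

theorem comm_oneO_oneO : Comm (oneO n) (oneO n) :=
  ⟨Commute.refl _, by rw [at_oneO, at_oneO]; exact commute_X_X (natAdd_ne (by decide))⟩

theorem comm_oneO_varO (i : Fin n) : Comm (oneO n) (varO i) :=
  ⟨commute_X_C_target (castAdd_ne_natAdd _ _), by
    rw [at_oneO, at_varO]
    exact commute_X_C (castAdd_ne_natAdd _ _) (castAdd_ne_natAdd _ _).symm (natAdd_ne (by decide))⟩

theorem comm_varO_varO (i j : Fin n) : Comm (varO i) (varO j) :=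
  ⟨commute_C_C_target (castAdd_ne_natAdd _ _) (castAdd_ne_natAdd _ _), by
    rw [at_varO, at_varO]
    by_cases h : i = j
    · rw [h]
      exact commute_C_C_control (castAdd_ne_natAdd _ _) (castAdd_ne_natAdd _ _)
    · exact commute_C_C_of_ne (castAdd_ne_natAdd _ _) (castAdd_ne_natAdd _ _)
        (by simpa using h) (castAdd_ne_natAdd _ _) (castAdd_ne_natAdd _ _).symm
        (natAdd_ne (by decide))⟩

theorem pre_one : Pre (1 : Gate (n + 1)) where
  sq := one_mul 1
  copy := by simp only [map_one, mul_one]; exact cx_sq (by decide)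
  tof := by rw [map_one]; exact Commute.one_left _

theorem pre_oneO : Pre (oneO n) where
  sq := X_mul_self _
  copy := by
    rw [at_oneO, at_oneO]
    exact C_X_C_target (natAdd_ne (by decide))
  tof := by
    rw [at_oneO]
    exact commute_X_T (injective_vec3.2 ⟨natAdd_ne (by decide), natAdd_ne (by decide),
      natAdd_ne (by decide)⟩)

theorem pre_varO (i : Fin n) : Pre (varO i) where
  sq := C_mul_self (castAdd_ne_natAdd _ _)
  copy := by
    rw [at_varO, at_varO]
    exact C_C_C_target (castAdd_ne_natAdd _ _) (castAdd_ne_natAdd _ _) (natAdd_ne (by decide))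
  tof := by
    rw [at_varO]
    exact commute_C_T (injective_vec4.2 ⟨castAdd_ne_natAdd _ _, castAdd_ne_natAdd _ _,
      castAdd_ne_natAdd _ _, natAdd_ne (by decide), natAdd_ne (by decide), natAdd_ne (by decide)⟩)

theorem Comm.mul_left {U V W : Gate (n + 1)} (hU : Comm U W) (hV : Comm V W) : Comm (U * V) W :=
  ⟨hU.1.mul_left hV.1, by rw [map_mul]; exact hU.2.mul_left hV.2⟩

theorem Pre.mul {U V : Gate (n + 1)} (hU : Pre U) (hV : Pre V) (h : Comm U V) : Pre (U * V) where
  sq := by rw [mul_assoc, h.1.symm.left_comm, hV.sq, mul_one, hU.sq]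
  copy := by
    have hc : cx n (0 : Fin 2) 1 * cx n 0 1 = 1 := cx_sq (by decide)
    rw [map_mul, map_mul]
    calc cx n 0 1 * (at' 0 U * at' 0 V) * cx n 0 1
        = cx n 0 1 * at' 0 U * (cx n 0 1 * cx n 0 1) * at' 0 V * cx n 0 1 := by
          rw [hc]; simp only [mul_assoc, one_mul]
      _ = (cx n 0 1 * at' 0 U * cx n 0 1) * (cx n 0 1 * at' 0 V * cx n 0 1) := by
          simp only [mul_assoc]
      _ = at' 0 U * (at' 1 U * at' 0 V) * at' 1 V := by
          rw [hU.copy, hV.copy]; simp only [mul_assoc]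
      _ = at' 0 U * at' 0 V * (at' 1 U * at' 1 V) := by
          rw [(h.at 1 0).eq]; simp only [mul_assoc]
  tof := by rw [map_mul]; exact hU.tof.mul_left hV.tof

/-- The gates built from the constants and the variables by `k` rounds of sums and products. -/
def level (n : ℕ) : ℕ → Set (Gate (n + 1))
  | 0 => {U | U = 1 ∨ U = oneO n ∨ ∃ i, U = varO i}
  | k + 1 => {W | ∃ U ∈ level n k, ∃ V ∈ level n k, W = U * V ∨ W = mulO U V}

/-- Commutation of a product with another gate requires commutation of both factors with it as well
as `Pre` of that gate. The two statements are therefore proved together, for all pairs of a level at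
once. -/
theorem level_good (k : ℕ) :
    (∀ U ∈ level n k, Pre U) ∧ (∀ U ∈ level n k, ∀ V ∈ level n k, Comm U V) := by
  induction k with
  | zero =>
    constructor
    · rintro U (rfl | rfl | ⟨i, rfl⟩)
      exacts [pre_one, pre_oneO, pre_varO i]
    · rintro U (rfl | rfl | ⟨i, rfl⟩) V (rfl | rfl | ⟨j, rfl⟩)
      exacts [comm_one _, comm_one _, comm_one _, (comm_one _).symm, comm_oneO_oneO,
        comm_oneO_varO _, (comm_one _).symm, (comm_oneO_varO _).symm, comm_varO_varO _ _]
  | succ k ih =>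
    obtain ⟨hP, hC⟩ := ih
    have hcomp : ∀ U ∈ level n k, ∀ V ∈ level n k, Comp U V := fun U hU V hV =>
      ⟨hP U hU, hP V hV, hC U hU U hU, hC V hV V hV, hC U hU V hV⟩
    have hP' : ∀ W ∈ level n (k + 1), Pre W := by
      rintro W ⟨U, hU, V, hV, rfl | rfl⟩
      · exact (hP U hU).mul (hP V hV) (hC U hU V hV)
      · exact pre_mulO (hcomp U hU V hV)
    -- Pairs of mixed levels come first; decomposing one member of a pair in level `k + 1` leads
    -- back to them.
    have hmix : ∀ W ∈ level n (k + 1), ∀ U' ∈ level n k, Comm W U' := by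
      rintro W ⟨U, hU, V, hV, rfl | rfl⟩ U' hU'
      · exact (hC U hU U' hU').mul_left (hC V hV U' hU')
      · exact comm_mulO (hcomp U hU V hV) (hC U hU U' hU') (hC V hV U' hU') (hP U' hU')
    refine ⟨hP', ?_⟩
    rintro W ⟨U, hU, V, hV, rfl | rfl⟩ W' hW'
    · exact (hmix W' hW' U hU).symm.mul_left (hmix W' hW' V hV).symm
    · exact comm_mulO (hcomp U hU V hV) (hmix W' hW' U hU).symm (hmix W' hW' V hV).symm (hP' W' hW')

theorem one_mem_level (k : ℕ) : (1 : Gate (n + 1)) ∈ level n k := by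
  induction k with
  | zero => exact Or.inl rfl
  | succ k ih => exact ⟨1, ih, 1, ih, Or.inl (mul_one 1).symm⟩

theorem level_mono : Monotone (level n) :=
  monotone_nat_of_le_succ fun k U hU => ⟨U, hU, 1, one_mem_level k, Or.inl (mul_one U).symm⟩

/-- Oracles: the gates which are polynomials in the first `n` wires, added to the last wire. -/
def IsOracle (U : Gate (n + 1)) : Prop := ∃ k, U ∈ level n k

theorem IsOracle.exists_level {U V : Gate (n + 1)} (hU : IsOracle U) (hV : IsOracle V) :
    ∃ k, U ∈ level n k ∧ V ∈ level n k := by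
  obtain ⟨k, hk⟩ := hU
  obtain ⟨l, hl⟩ := hV
  exact ⟨max k l, level_mono (le_max_left _ _) hk, level_mono (le_max_right _ _) hl⟩

theorem IsOracle.pre {U : Gate (n + 1)} (hU : IsOracle U) : Pre U := by
  obtain ⟨k, hk⟩ := hU
  exact (level_good k).1 U hk

theorem IsOracle.comm {U V : Gate (n + 1)} (hU : IsOracle U) (hV : IsOracle V) : Comm U V := by
  obtain ⟨k, hk, hl⟩ := hU.exists_level hV
  exact (level_good k).2 U hk V hl

theorem IsOracle.comp {U V : Gate (n + 1)} (hU : IsOracle U) (hV : IsOracle V) : Comp U V :=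
  ⟨hU.pre, hV.pre, hU.comm hU, hV.comm hV, hU.comm hV⟩

theorem isOracle_one : IsOracle (1 : Gate (n + 1)) := ⟨0, one_mem_level 0⟩

theorem isOracle_oneO : IsOracle (oneO n) := ⟨0, Or.inr (Or.inl rfl)⟩

theorem isOracle_varO (i : Fin n) : IsOracle (varO i) := ⟨0, Or.inr (Or.inr ⟨i, rfl⟩)⟩

theorem IsOracle.mul {U V : Gate (n + 1)} (hU : IsOracle U) (hV : IsOracle V) :
    IsOracle (U * V) := by
  obtain ⟨k, hk, hl⟩ := hU.exists_level hV
  exact ⟨k + 1, U, hk, V, hl, Or.inl rfl⟩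

theorem IsOracle.mulO {U V : Gate (n + 1)} (hU : IsOracle U) (hV : IsOracle V) :
    IsOracle (mulO U V) := by
  obtain ⟨k, hk, hl⟩ := hU.exists_level hV
  exact ⟨k + 1, U, hk, V, hl, Or.inr rfl⟩

theorem IsOracle.induction {p : Gate (n + 1) → Prop} (h1 : p 1) (hone : p (oneO n))
    (hvar : ∀ i, p (varO i))
    (hadd : ∀ U V, IsOracle U → IsOracle V → p U → p V → p (U * V))
    (hmul : ∀ U V, IsOracle U → IsOracle V → p U → p V → p (TOF.mulO U V)) {U : Gate (n + 1)}
    (hU : IsOracle U) : p U := by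
  obtain ⟨k, hk⟩ := hU
  induction k generalizing U with
  | zero =>
    obtain rfl | rfl | ⟨i, rfl⟩ := hk
    exacts [h1, hone, hvar i]
  | succ k ih =>
    obtain ⟨U, hU, V, hV, rfl | rfl⟩ := hk
    · exact hadd U V ⟨k, hU⟩ ⟨k, hV⟩ (ih hU) (ih hV)
    · exact hmul U V ⟨k, hU⟩ ⟨k, hV⟩ (ih hU) (ih hV)

/-! The ring laws for oracles. -/

theorem up2_eq_at (U : Gate (n + 1)) : (up2 (j := 1) U : Gate (n + 3)) = at' (0 : Fin 3) U := by
  conv_lhs => rw [← at_zero U]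
  exact up2_at 0 U

theorem eq_of_at_three {U V : Gate (n + 1)}
    (h : at' (0 : Fin 3) U * (zx n 1 * zx n 2) = at' (0 : Fin 3) V * (zx n 1 * zx n 2)) : U = V := by
  apply up2_cancel (j := 1)
  erw [up2_eq_at, up2_eq_at]
  exact h

theorem eq_of_at_five {U V : Gate (n + 1)}
    (h : at' (0 : Fin 5) U * ((zx n 1 * zx n 2) * (zx n 3 * zx n 4)) =
      at' (0 : Fin 5) V * ((zx n 1 * zx n 2) * (zx n 3 * zx n 4))) : U = V := by
  apply eq_of_at_three
  apply up2_cancel (j := 3)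
  have e : ∀ a : Fin 3, up2 (zx n a) = zx n (Fin.castAdd 2 a) :=
    fun a => lift_zx (Fin.castAdd_injective _ _) a
  simp only [map_mul, up2_at, e, mul_assoc]
  simp only [mul_assoc] at h
  exact h

section

variable {U V W : Gate (n + 1)}

theorem mulO_comm (hU : IsOracle U) (hV : IsOracle V) : mulO U V = mulO V U := by
  apply eq_of_at_three
  have hz : Commute (zx n (1 : Fin 3)) (zx n 2) := commute_z_z (natAdd_ne (by decide))
  rw [mulO_spec (hU.comp hV) (by decide) (by decide) (by decide), hz.eq,
    mulO_spec (hV.comp hU) (by decide) (by decide) (by decide),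
    prodAt_comm (hU.comm hV) (by decide) (by decide) (by decide)]

/-- Computing `U` on `a`, copying to `b` and uncomputing amounts to adding `U` directly to `b`,
apart from the copy of the old value of `a`. -/
theorem at_cx_at (h : Pre U) {j : ℕ} {a b : Fin j} (hab : a ≠ b) :
    at' a U * cx n a b * at' a U = at' b U * cx n a b := by
  have h1 := at_copy h hab
  have h2 : cx n a b * cx n a b = 1 := cx_sq hab
  have h3 : cx n a b * at' a U = at' a U * at' b U * cx n a b := by
    rw [← h1, mul_assoc _ (cx n a b), h2, mul_one]
  rw [mul_assoc, h3, ← mul_assoc, ← mul_assoc, at_sq h, one_mul]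

/-- Setting the ancilla 2 to 1 turns the Toffoli gate into a cnot times a Toffoli gate that the zero
wire 2 makes trivial. The rest is compute, copy, uncompute, as in `at_cx_at`. -/
theorem mulO_one (hU : IsOracle U) : mulO U (oneO n) = U := by
  apply eq_of_at_three
  rw [mulO_spec (hU.comp isOracle_oneO) (by decide) (by decide) (by decide), prodAt]
  simp only [at_oneO]
  have h1 : xx n (2 : Fin 3) * tx n 1 2 0 * xx n 2 = cx n 1 0 * tx n 1 2 0 := by
    have := X_T_X (natAdd_ne (n := n) (show (2 : Fin 3) ≠ 1 by decide))
      (natAdd_ne (show (2 : Fin 3) ≠ 0 by decide)) (natAdd_ne (show (1 : Fin 3) ≠ 0 by decide))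
    rwa [T_comm_controls (natAdd_ne (by decide)) (natAdd_ne (by decide)) (natAdd_ne (by decide))]
      at this
  have h2 : tx n (1 : Fin 3) 2 0 * zx n 2 = zx n 2 := by
    rw [show tx n (1 : Fin 3) 2 0 = tx n 2 1 0 from
      T_comm_controls (natAdd_ne (by decide)) (natAdd_ne (by decide)) (natAdd_ne (by decide))]
    exact T_mul_z (natAdd_ne (by decide)) (natAdd_ne (by decide)) (natAdd_ne (by decide))
  have h3 : cx n (1 : Fin 3) 0 * zx n 1 = zx n 1 := C_mul_z (natAdd_ne (by decide))
  have h4 := at_cx_at hU.pre (show (1 : Fin 3) ≠ 0 by decide)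
  have hz : Commute (zx n (1 : Fin 3)) (zx n 2) := commute_z_z (natAdd_ne (by decide))
  have h5 : Commute (at' (1 : Fin 3) U) (zx n 2) := commute_at_zx U (by decide)
  calc at' (1 : Fin 3) U * xx n 2 * tx n 1 2 0 * xx n 2 * at' 1 U * (zx n 1 * zx n 2)
      = at' 1 U * (xx n 2 * tx n 1 2 0 * xx n 2) * (at' 1 U * zx n 2) * zx n 1 := by
        rw [hz.eq]; simp only [mul_assoc]
    _ = at' 1 U * cx n 1 0 * (tx n 1 2 0 * zx n 2) * at' 1 U * zx n 1 := by
        rw [h1, h5.eq]; simp only [mul_assoc]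
    _ = at' 1 U * cx n 1 0 * (zx n 2 * at' 1 U) * zx n 1 := by
        rw [h2]; simp only [mul_assoc]
    _ = at' 1 U * cx n 1 0 * at' 1 U * (zx n 2 * zx n 1) := by
        rw [← h5.eq]; simp only [mul_assoc]
    _ = at' 0 U * (cx n 1 0 * zx n 1) * zx n 2 := by
        rw [h4, ← hz.eq]; simp only [mul_assoc]
    _ = at' 0 U * (zx n 1 * zx n 2) := by rw [h3, mul_assoc]

/-- Both ancillas carry the same value, so the second is a copy of the first by cnot. The
conjugation rule `C_T_C'`, which reflects b * b = b, then replaces the Toffoli gate by a cnot up to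
a trivial factor. -/
theorem mulO_self (hU : IsOracle U) : mulO U U = U := by
  apply eq_of_at_three
  rw [mulO_spec (hU.comp hU) (by decide) (by decide) (by decide), prodAt]
  have h2 : tx n (1 : Fin 3) 2 0 * zx n 2 = zx n 2 := by
    rw [show tx n (1 : Fin 3) 2 0 = tx n 2 1 0 from
      T_comm_controls (natAdd_ne (by decide)) (natAdd_ne (by decide)) (natAdd_ne (by decide))]
    exact T_mul_z (natAdd_ne (by decide)) (natAdd_ne (by decide)) (natAdd_ne (by decide))
  have h3 : cx n (1 : Fin 3) 0 * zx n 1 = zx n 1 := C_mul_z (natAdd_ne (by decide))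
  have h3' : cx n (1 : Fin 3) 2 * zx n 1 = zx n 1 := C_mul_z (natAdd_ne (by decide))
  have h4 := at_cx_at hU.pre (show (1 : Fin 3) ≠ 0 by decide)
  have h6 := at_copy hU.pre (show (1 : Fin 3) ≠ 2 by decide)
  have hz : Commute (zx n (1 : Fin 3)) (zx n 2) := commute_z_z (natAdd_ne (by decide))
  have h5 : Commute (at' (1 : Fin 3) U) (zx n 2) := commute_at_zx U (by decide)
  have h7 : cx n (1 : Fin 3) 2 * tx n 1 2 0 * cx n 1 2 = cx n 1 0 * tx n 1 2 0 :=
    C_T_C' (natAdd_ne (by decide)) (natAdd_ne (by decide)) (natAdd_ne (by decide))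
  have h8 : Commute (at' (0 : Fin 3) U) (cx n 1 2) :=
    commute_at_cx U (by decide) (by decide) (by decide)
  have h9 : Commute (at' (1 : Fin 3) U) (at' 2 U) := (hU.comm hU).at 1 2
  calc at' (1 : Fin 3) U * at' 2 U * tx n 1 2 0 * at' 2 U * at' 1 U * (zx n 1 * zx n 2)
      = (at' (1 : Fin 3) U * at' 2 U) * tx n 1 2 0 * (at' 1 U * at' 2 U) * (zx n 1 * zx n 2) := by
        rw [h9.eq]; simp only [mul_assoc]
    _ = cx n 1 2 * at' 1 U * (cx n 1 2 * tx n 1 2 0 * cx n 1 2) * at' 1 U *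
          (cx n 1 2 * zx n 1) * zx n 2 := by
        rw [← h6]; simp only [mul_assoc]
    _ = cx n 1 2 * at' 1 U * cx n 1 0 * tx n 1 2 0 * (at' 1 U * zx n 2) * zx n 1 := by
        rw [h7, h3', mul_assoc _ (zx n 1), hz.eq]; simp only [mul_assoc]
    _ = cx n 1 2 * at' 1 U * cx n 1 0 * (tx n 1 2 0 * zx n 2) * at' 1 U * zx n 1 := by
        rw [h5.eq]; simp only [mul_assoc]
    _ = cx n 1 2 * at' 1 U * cx n 1 0 * (zx n 2 * at' 1 U) * zx n 1 := by
        rw [h2]; simp only [mul_assoc]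
    _ = cx n 1 2 * (at' 1 U * cx n 1 0 * at' 1 U) * (zx n 2 * zx n 1) := by
        rw [← h5.eq]; simp only [mul_assoc]
    _ = cx n 1 2 * at' 0 U * (cx n 1 0 * zx n 1) * zx n 2 := by
        rw [h4, ← hz.eq]; simp only [mul_assoc]
    _ = at' 0 U * (cx n 1 2 * zx n 1) * zx n 2 := by
        rw [h3, ← h8.eq]; simp only [mul_assoc]
    _ = at' 0 U * (zx n 1 * zx n 2) := by rw [h3', mul_assoc]

/-- The circuit for `V * W` contains the commutator of `W` with the Toffoli gate, and by
`commute_at_conj` the oracle `V` on the same ancilla passes it. The contributions of `W` and `V`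
separate, the superfluous Toffoli gate dies on the zero wire 2, and the two halves are completed by
`U` twice. -/
theorem mulO_add (hU : IsOracle U) (hV : IsOracle V) (hW : IsOracle W) :
    mulO U (V * W) = mulO U V * mulO U W := by
  rw [((hU.mulO hV).comm (hU.mulO hW)).1.eq]
  apply eq_of_at_three
  have hVs := mulO_spec (hU.comp hV) (show (1 : Fin 3) ≠ 2 by decide) (show (1 : Fin 3) ≠ 0 by decide)
    (show (2 : Fin 3) ≠ 0 by decide)
  have hWs := mulO_spec (hU.comp hW) (show (1 : Fin 3) ≠ 2 by decide) (show (1 : Fin 3) ≠ 0 by decide)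
    (show (2 : Fin 3) ≠ 0 by decide)
  have hc := clean_prodAt (hU.comp hV) (show (1 : Fin 3) ≠ 2 by decide)
    (show (1 : Fin 3) ≠ 0 by decide) (show (2 : Fin 3) ≠ 0 by decide)
  rw [mulO_spec (hU.comp (hV.mul hW)) (by decide) (by decide) (by decide), map_mul,
    mul_assoc (at' 0 _), hVs, hc.eq, ← mul_assoc (at' 0 _), hWs, mul_assoc (prodAt U W 0 1 2),
    ← hc.eq, ← mul_assoc (prodAt U W 0 1 2)]
  have ht : tx n (1 : Fin 3) 2 0 = tx n 2 1 0 :=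
    T_comm_controls (natAdd_ne (by decide)) (natAdd_ne (by decide)) (natAdd_ne (by decide))
  have htz : tx n (1 : Fin 3) 2 0 * zx n 2 = zx n 2 := by
    rw [ht]
    exact T_mul_z (natAdd_ne (by decide)) (natAdd_ne (by decide)) (natAdd_ne (by decide))
  have htt : tx n (1 : Fin 3) 2 0 * tx n 1 2 0 = 1 := tx_sq (by decide) (by decide) (by decide)
  have hD := commute_at_conj hW.pre (hW.comm hW) V (show (2 : Fin 3) ≠ 1 by decide)
    (show (2 : Fin 3) ≠ 0 by decide) (show (1 : Fin 3) ≠ 0 by decide) (hW.comm hV)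
  have hVz := clean hV.pre (hV.comm hV) (show (2 : Fin 3) ≠ 1 by decide)
    (show (2 : Fin 3) ≠ 0 by decide) (show (1 : Fin 3) ≠ 0 by decide)
  rw [← ht] at hD hVz
  have hVW := (hV.comm hW).at (2 : Fin 3) 2
  have hU1 := at_sq hU.pre (1 : Fin 3)
  have hUz : Commute (at' (1 : Fin 3) U) (zx n 2) := commute_at_zx U (by decide)
  have hz : Commute (zx n (1 : Fin 3)) (zx n 2) := commute_z_z (natAdd_ne (by decide))
  simp only [prodAt, map_mul]
  generalize at' (1 : Fin 3) U = u at *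
  generalize at' (2 : Fin 3) V = v at *
  generalize at' (2 : Fin 3) W = w at *
  generalize tx n (1 : Fin 3) 2 0 = t at *
  generalize zx n (1 : Fin 3) = z1 at *
  generalize zx n (2 : Fin 3) = z2 at *
  calc u * (v * w) * t * (v * w) * u * (z1 * z2)
      = u * v * (w * t) * (v * w) * u * (z1 * z2) := by simp only [mul_assoc]
    _ = u * v * (w * t * w * (t * t)) * v * u * (z1 * z2) := by
        rw [htt, hVW.eq, mul_one]; simp only [mul_assoc]
    _ = u * (v * (w * t * w * t)) * t * v * (u * z2) * z1 := by
        rw [hz.eq]; simp only [mul_assoc]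
    _ = u * (w * t * w * t) * ((v * t * v) * z2) * u * z1 := by
        rw [hD.eq, hUz.eq]; simp only [mul_assoc]
    _ = u * (w * t * w) * (t * z2) * (v * t * v) * u * z1 := by
        rw [← hVz.eq]; simp only [mul_assoc]
    _ = u * (w * t * w) * (z2 * (v * t * v)) * u * z1 := by
        rw [htz]; simp only [mul_assoc]
    _ = u * (w * t * w) * (v * t * v) * (z2 * u) * z1 := by
        rw [hVz.eq]; simp only [mul_assoc]
    _ = u * w * t * w * (u * u) * v * t * v * u * (z1 * z2) := by
        rw [hU1, ← hUz.eq, hz.eq, mul_one]; simp only [mul_assoc]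
    _ = u * w * t * w * u * (u * v * t * v * u) * (z1 * z2) := by
        simp only [mul_assoc]

end

end TOF

/-! ### Associativity, and the Boolean ring of oracles. -/

namespace TOF

open Circuit

variable {n : ℕ}

section

variable {U V W : Gate (n + 1)}

theorem commute_zx_zx {j : ℕ} {a b : Fin j} (hab : a ≠ b) : Commute (zx n a) (zx n b) :=
  commute_z_z (natAdd_ne hab)

/-- The product of three oracles, computed with one auxiliary wire `p` for the product of `U` and
`V` and further auxiliary wires `u`, `v`, `w` for `U`, `V`, `W`. -/
theorem mulO_mulO_spec (hU : IsOracle U) (hV : IsOracle V) (hW : IsOracle W)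
    {j : ℕ} {t p w u v : Fin j} (h : [t, p, w, u, v].Nodup) :
    at' t (mulO (mulO U V) W) * ((zx n p * zx n w) * (zx n u * zx n v)) =
      at' u U * at' v V * at' w W * (zx n p * (tx n u v p * tx n p w t * tx n u v p) * zx n p) *
        (at' u U * at' v V * at' w W) * ((zx n p * zx n w) * (zx n u * zx n v)) := by
  simp only [List.nodup_cons, List.mem_cons, not_or, List.not_mem_nil, not_false_eq_true,
    and_true, List.nodup_nil] at h
  obtain ⟨⟨htp, htw, htu, htv⟩, ⟨hpw, hpu, hpv⟩, ⟨hwu, hwv⟩, huv⟩ := h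
  have hA := hU.mulO hV
  have s1 := mulO_spec (hA.comp hW) hpw (Ne.symm htp) (Ne.symm htw)
  have s2 := mulO_spec (hU.comp hV) huv (Ne.symm hpu) (Ne.symm hpv)
  have c2 := clean_prodAt (hU.comp hV) huv (Ne.symm hpu) (Ne.symm hpv)
  have hz : Commute (zx n p * zx n w) (zx n u * zx n v) :=
    ((commute_zx_zx hpu).mul_right (commute_zx_zx hpv)).mul_left
      ((commute_zx_zx hwu).mul_right (commute_zx_zx hwv))
  have hWz : Commute (at' w W) (zx n u * zx n v) :=
    (commute_at_zx _ hwu).mul_right (commute_at_zx _ hwv)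
  have hTz : Commute (tx n p w t) (zx n u * zx n v) :=
    (commute_zx_tx hpw (Ne.symm htp) (Ne.symm htw) (Ne.symm hpu) (Ne.symm hwu)
      (Ne.symm htu)).symm.mul_right (commute_zx_tx hpw (Ne.symm htp) (Ne.symm htw) (Ne.symm hpv)
      (Ne.symm hwv) (Ne.symm htv)).symm
  have hUV := (hU.comm hV).at u v
  have hUW := (hU.comm hW).at u w
  have hVW := (hV.comm hW).at v w
  have hUU := at_sq hU.pre u
  have hVV := at_sq hV.pre v
  have hUT : Commute (at' u U) (tx n p w t) :=
    commute_at_tx U hpw (Ne.symm htp) (Ne.symm htw) (Ne.symm hpu) (Ne.symm hwu) (Ne.symm htu)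
  have hVT : Commute (at' v V) (tx n p w t) :=
    commute_at_tx V hpw (Ne.symm htp) (Ne.symm htw) (Ne.symm hpv) (Ne.symm hwv) (Ne.symm htv)
  have hWT : Commute (at' w W) (tx n u v p) :=
    commute_at_tx W huv (Ne.symm hpu) (Ne.symm hpv) hwu hwv (Ne.symm hpw)
  have hUp : Commute (at' u U) (zx n p) := commute_at_zx _ (Ne.symm hpu)
  have hVp : Commute (at' v V) (zx n p) := commute_at_zx _ (Ne.symm hpv)
  have hWp : Commute (at' w W) (zx n p) := commute_at_zx _ (Ne.symm hpw)
  have hMp : Commute (at' t (mulO (mulO U V) W)) (zx n p) := commute_at_zx _ htp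
  have hpp : zx n p * zx n p = zx n p := z_mul_z _
  have hZ1 : zx n p * ((zx n p * zx n w) * (zx n u * zx n v)) =
      (zx n p * zx n w) * (zx n u * zx n v) := by
    simp only [← mul_assoc]; rw [hpp]
  have hGz : Commute (at' u U * at' v V * at' w W) (zx n p) :=
    (hUp.mul_left hVp).mul_left hWp
  simp only [prodAt] at s1 s2 c2
  generalize at' t (mulO (mulO U V) W) = M at *
  generalize at' p (mulO U V) = A at *
  generalize at' u U = x at *
  generalize at' v V = y at *
  generalize at' w W = r at *
  generalize tx n p w t = τ at *
  generalize tx n u v p = σ at *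
  generalize zx n u * zx n v = z' at *
  generalize zx n p * zx n w = z'' at *
  generalize zx n p = zp at *
  set G := x * y with hG
  have hyx : y * x = G := hUV.eq.symm
  have hGG : G * G = 1 := by
    rw [hG]
    calc x * y * (x * y) = x * (y * x) * y := by simp only [mul_assoc]
      _ = (x * x) * (y * y) := by rw [← hUV.eq]; simp only [mul_assoc]
      _ = 1 := by rw [hUU, hVV, mul_one]
  have hGr : Commute G r := hUW.mul_left hVW
  have hGT : Commute G τ := hUT.mul_left hVT
  have hP : G * σ * y * x = G * σ * G := by rw [mul_assoc _ y x, hyx]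
  rw [hP] at s2 c2
  -- Both occurrences of the inner product are expanded next to the zero wires `u`, `v`. The
  -- uncomputation of the first and the computation of the second slide past `r` and `τ` and cancel.
  have e1 : M * (z'' * z') = G * σ * r * τ * r * σ * G * (z'' * z') := by
    calc M * (z'' * z') = A * r * τ * r * (A * z') * z'' := by
          rw [← mul_assoc, s1, mul_assoc _ z'' z', hz.eq]; simp only [mul_assoc]
      _ = A * (r * (τ * (r * z'))) * (G * σ * G) * z'' := by
          rw [s2, c2.eq]; simp only [mul_assoc]
      _ = (A * z') * (r * τ * r) * (G * σ * G) * z'' := by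
          rw [hWz.eq, ← mul_assoc τ, hTz.eq, mul_assoc z', ← mul_assoc r z', hWz.eq]
          simp only [mul_assoc]
      _ = (G * σ * G) * (z' * r) * τ * r * (G * σ * G) * z'' := by
          rw [s2]; simp only [mul_assoc]
      _ = (G * σ * G) * r * (z' * τ) * r * (G * σ * G) * z'' := by
          rw [← hWz.eq]; simp only [mul_assoc]
      _ = (G * σ * G) * r * τ * (z' * r) * (G * σ * G) * z'' := by
          rw [← hTz.eq]; simp only [mul_assoc]
      _ = (G * σ * G) * r * τ * r * (z' * (G * σ * G)) * z'' := by
          rw [← hWz.eq]; simp only [mul_assoc]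
      _ = G * σ * (G * r) * τ * (r * G) * σ * G * (z' * z'') := by
          rw [← c2.eq]; simp only [mul_assoc]
      _ = G * σ * (r * G) * τ * (G * r) * σ * G * (z' * z'') := by rw [hGr.eq]
      _ = G * σ * r * (G * τ) * G * r * σ * G * (z' * z'') := by simp only [mul_assoc]
      _ = G * σ * r * τ * (G * G) * r * σ * G * (z' * z'') := by
          rw [hGT.eq]; simp only [mul_assoc]
      _ = G * σ * r * τ * r * σ * G * (z'' * z') := by
          rw [hGG, hz.eq, mul_one]
  -- All oracles move to the outside; only three Toffoli gates remain in the middle.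
  have e2 : G * σ * r * τ * r * σ * G = G * r * (σ * τ * σ) * (G * r) := by
    rw [hGr.eq]
    calc G * σ * r * τ * r * σ * G = G * (σ * r) * τ * (r * σ) * G := by simp only [mul_assoc]
      _ = G * (r * σ) * τ * (σ * r) * G := by rw [hWT.eq]
      _ = (G * r) * σ * τ * σ * (r * G) := by simp only [mul_assoc]
      _ = r * G * (σ * τ * σ) * (r * G) := by rw [hGr.eq]; simp only [mul_assoc]
  rw [e2] at e1
  -- The test of the wire `p` is duplicated, moved past `M` and past the oracles, and placed on both
  -- sides of the Toffoli gates, as `z_T_T_T_z` requires.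
  calc M * (z'' * z') = (M * zp) * (z'' * z') := by rw [mul_assoc, hZ1]
    _ = zp * (M * (z'' * z')) := by rw [hMp.eq, mul_assoc]
    _ = zp * (G * r) * (σ * τ * σ) * (G * r) * (z'' * z') := by rw [e1]; simp only [mul_assoc]
    _ = zp * (G * r) * (σ * τ * σ) * (G * r) * (zp * (z'' * z')) := by rw [hZ1]
    _ = zp * (G * r) * (σ * τ * σ) * ((G * r) * zp) * (z'' * z') := by simp only [mul_assoc]
    _ = ((G * r) * zp) * (σ * τ * σ) * ((G * r) * zp) * (z'' * z') := by rw [hGz.eq]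
    _ = ((G * r) * zp) * (σ * τ * σ) * (zp * (G * r)) * (z'' * z') := by rw [hGz.eq]
    _ = G * r * (zp * (σ * τ * σ) * zp) * (G * r) * (z'' * z') := by simp only [mul_assoc]

/-- With the ancillas 2 and 4 exchanged in one of the two expansions, the oracles sit on the same
wires, and `z_T_T_T_z` identifies the Toffoli gates. Together with commutativity this gives
associativity. -/
theorem mulO_right_comm (hU : IsOracle U) (hV : IsOracle V) (hW : IsOracle W) :
    mulO (mulO U V) W = mulO (mulO U W) V := by
  apply eq_of_at_five
  have h1 := mulO_mulO_spec hU hV hW (j := 5) (t := 0) (p := 1) (w := 2) (u := 3) (v := 4)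
    (by decide)
  have h2 := mulO_mulO_spec hU hW hV (j := 5) (t := 0) (p := 1) (w := 4) (u := 3) (v := 2)
    (by decide)
  have hz : (zx n (1 : Fin 5) * zx n 4) * (zx n 3 * zx n 2) =
      (zx n 1 * zx n 2) * (zx n 3 * zx n 4) := by
    rw [mul_assoc, mul_assoc, (commute_zx_zx (show (3 : Fin 5) ≠ 2 by decide)).eq,
      (commute_zx_zx (show (4 : Fin 5) ≠ 2 by decide)).left_comm,
      (commute_zx_zx (show (4 : Fin 5) ≠ 3 by decide)).eq]
  have hVW := (hV.comm hW).at (4 : Fin 5) 2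
  have hT : zx n (1 : Fin 5) * (tx n 3 4 1 * tx n 1 2 0 * tx n 3 4 1) * zx n 1 =
      zx n 1 * (tx n 3 2 1 * tx n 1 4 0 * tx n 3 2 1) * zx n 1 := by
    apply z_T_T_T_z
    rw [injective_vec5]
    refine ⟨?_, ?_, ?_, ?_, ?_, ?_, ?_, ?_, ?_, ?_⟩ <;> exact natAdd_ne (by decide)
  rw [hz] at h2
  rw [h1, h2, hT, mul_assoc (at' 3 U), mul_assoc (at' 3 U), hVW.eq]
  simp only [mul_assoc]

theorem mulO_assoc (hU : IsOracle U) (hV : IsOracle V) (hW : IsOracle W) :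
    mulO (mulO U V) W = mulO U (mulO V W) := by
  rw [mulO_comm hU hV, mulO_right_comm hV hU hW, mulO_comm (hV.mulO hW) hU]

end

/-- The oracles with `n` input wires. -/
def Oracle (n : ℕ) := {U : Gate (n + 1) // IsOracle U}

namespace Oracle

instance : Zero (Oracle n) := ⟨⟨1, isOracle_one⟩⟩

noncomputable instance : One (Oracle n) := ⟨⟨oneO n, isOracle_oneO⟩⟩

instance : Add (Oracle n) := ⟨fun U V => ⟨U.1 * V.1, U.2.mul V.2⟩⟩

instance : Neg (Oracle n) := ⟨fun U => U⟩

noncomputable instance : Mul (Oracle n) := ⟨fun U V => ⟨mulO U.1 V.1, U.2.mulO V.2⟩⟩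

noncomputable instance : CommRing (Oracle n) where
  add_assoc U V W := Subtype.ext (mul_assoc U.1 V.1 W.1)
  zero_add U := Subtype.ext (one_mul U.1)
  add_zero U := Subtype.ext (mul_one U.1)
  add_comm U V := Subtype.ext (U.2.comm V.2).1.eq
  neg_add_cancel U := Subtype.ext U.2.pre.sq
  nsmul := nsmulRec
  zsmul := zsmulRec
  mul_assoc U V W := Subtype.ext (mulO_assoc U.2 V.2 W.2)
  mul_comm U V := Subtype.ext (mulO_comm U.2 V.2)
  one_mul U := Subtype.ext ((mulO_comm isOracle_oneO U.2).trans (mulO_one U.2))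
  mul_one U := Subtype.ext (mulO_one U.2)
  left_distrib U V W := Subtype.ext (mulO_add U.2 V.2 W.2)
  right_distrib U V W := Subtype.ext (by
    show mulO (U.1 * V.1) W.1 = mulO U.1 W.1 * mulO V.1 W.1
    rw [mulO_comm (U.2.mul V.2) W.2, mulO_add W.2 U.2 V.2, mulO_comm W.2 U.2, mulO_comm W.2 V.2])
  zero_mul U := Subtype.ext (by
    show mulO 1 U.1 = 1
    -- Distributivity makes the product with 0 equal to its own double, which vanishes because
    -- oracles are involutions.
    have h := mulO_add U.2 isOracle_one isOracle_one
    rw [mul_one] at h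
    rw [mulO_comm isOracle_one U.2]
    have h2 := (U.2.mulO isOracle_one).pre.sq
    rw [h, h2])
  mul_zero U := Subtype.ext (by
    show mulO U.1 1 = 1
    have h := mulO_add U.2 isOracle_one isOracle_one
    rw [mul_one] at h
    have h2 := (U.2.mulO isOracle_one).pre.sq
    rw [h, h2])

theorem val_add (U V : Oracle n) : (U + V).1 = U.1 * V.1 := rfl

theorem val_mul (U V : Oracle n) : (U * V).1 = mulO U.1 V.1 := rfl

theorem val_zero : (0 : Oracle n).1 = 1 := rfl

theorem val_one : (1 : Oracle n).1 = oneO n := rfl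

theorem add_self (U : Oracle n) : U + U = 0 := Subtype.ext U.2.pre.sq

theorem mul_self (U : Oracle n) : U * U = U := Subtype.ext (mulO_self U.2)

/-- The variables. -/
noncomputable def var (i : Fin n) : Oracle n := ⟨varO i, isOracle_varO i⟩

@[elab_as_elim]
theorem induction {p : Oracle n → Prop} (h0 : p 0) (h1 : p 1) (hvar : ∀ i, p (var i))
    (hadd : ∀ U V, p U → p V → p (U + V)) (hmul : ∀ U V, p U → p V → p (U * V)) (U : Oracle n) :
    p U := by
  obtain ⟨U, hU⟩ := U
  refine IsOracle.induction (p := fun U => ∀ hU : IsOracle U, p ⟨U, hU⟩) (fun _ => h0) (fun _ => h1)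
    (fun i _ => hvar i) ?_ ?_ hU hU
  · intro U V hU hV pU pV _
    exact hadd ⟨U, hU⟩ ⟨V, hV⟩ (pU hU) (pV hV)
  · intro U V hU hV pU pV _
    exact hmul ⟨U, hU⟩ ⟨V, hV⟩ (pU hU) (pV hV)

end Oracle

end TOF

/-! ### Moving oracles through maps. -/

namespace TOF

open Circuit

section slide

variable {n m : ℕ}

/-- The bijection that sends the last wires through `τ`. -/
def liftEquiv (n : ℕ) {i s j : ℕ} (τ : Fin (i + s) ≃ Fin j) : Fin (n + i + s) ≃ Fin (n + j) :=
  (finCongr (Nat.add_assoc n i s)).trans (permSum (Equiv.refl (Fin n)) τ)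

theorem liftEquiv_castAdd {i s j : ℕ} (τ : Fin (i + s) ≃ Fin j) (x : Fin (n + i)) :
    liftEquiv n τ (Fin.castAdd s x) = lift n (τ ∘ Fin.castAdd s) x := by
  induction x using Fin.addCases with
  | left x =>
    have : (finCongr (Nat.add_assoc n i s)) (Fin.castAdd s (Fin.castAdd i x)) =
        Fin.castAdd (i + s) x := by ext; simp
    simp only [liftEquiv, Equiv.trans_apply, this, permSum_castAdd, lift_castAdd, Equiv.refl_apply]
  | right x =>
    have : (finCongr (Nat.add_assoc n i s)) (Fin.castAdd s (Fin.natAdd n x)) =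
        Fin.natAdd n (Fin.castAdd s x) := by ext; simp
    simp only [liftEquiv, Equiv.trans_apply, this, permSum_natAdd, lift_natAdd, Function.comp_apply]

theorem pm_liftEquiv {i s j : ℕ} (τ : Fin (i + s) ≃ Fin j) :
    pm (liftEquiv n τ) = pm (finCongr (Nat.add_assoc n i s)) ≫ (𝟙 (mk n) ⊗' pm τ) := by
  rw [liftEquiv, ← pm_comp, ← pm_refl n, pm_tens]

theorem tens_pm_liftEquiv (h : mk n ⟶ mk m) {i s j : ℕ} (τ : Fin (i + s) ≃ Fin j) :
    ((h ⊗' 𝟙 (mk i)) ⊗' 𝟙 (mk s)) ≫ pm (liftEquiv m τ) =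
      pm (liftEquiv n τ) ≫ (h ⊗' 𝟙 (mk j)) := by
  rw [pm_liftEquiv, pm_liftEquiv, ← Category.assoc, tens_assoc, id_tens_id]
  simp only [Category.assoc]
  rw [← tens_comp, ← tens_comp, Category.comp_id, Category.id_comp, Category.id_comp,
    Category.comp_id]

theorem tens_pm_liftEquiv_symm (h : mk n ⟶ mk m) {i s j : ℕ} (τ : Fin (i + s) ≃ Fin j) :
    (h ⊗' 𝟙 (mk j)) ≫ pm (liftEquiv m τ).symm =
      pm (liftEquiv n τ).symm ≫ ((h ⊗' 𝟙 (mk i)) ⊗' 𝟙 (mk s)) := by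
  have h1 := congrArg (fun x => pm (liftEquiv n τ).symm ≫ x ≫ pm (liftEquiv m τ).symm)
    (tens_pm_liftEquiv h τ)
  simp only [Category.assoc, pm_comp_symm, Category.comp_id, pm_symm_comp_assoc] at h1
  exact h1.symm

/-- The placement permutes only the auxiliary wires, which `h` does not touch. -/
theorem slide_lift (h : mk n ⟶ mk m) {i j : ℕ} {κ : Fin i → Fin j} (hκ : Function.Injective κ)
    {U : Gate (m + i)} {U' : Gate (n + i)}
    (hU : (h ⊗' 𝟙 (mk i)) ≫ U = U' ≫ (h ⊗' 𝟙 (mk i))) :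
    (h ⊗' 𝟙 (mk j)) ≫ on (lift m κ) U = on (lift n κ) U' ≫ (h ⊗' 𝟙 (mk j)) := by
  obtain ⟨s, τ, hτ⟩ := exists_extend hκ
  have e : τ ∘ Fin.castAdd s = κ := by ext i; simp [hτ]
  rw [on_eq_place (liftEquiv m τ) (fun x => by rw [liftEquiv_castAdd, e]),
    on_eq_place (liftEquiv n τ) (fun x => by rw [liftEquiv_castAdd, e]), place, place,
    ← Category.assoc, tens_pm_liftEquiv_symm]
  simp only [Category.assoc]
  rw [← tens_pm_liftEquiv, ← Category.assoc (tens _ _) (tens U _), ← tens_id_comp, hU, tens_id_comp]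
  simp only [Category.assoc]

theorem slide_natAdd (h : mk n ⟶ mk m) {j : ℕ} (g : Gate j) :
    (h ⊗' 𝟙 (mk j)) ≫ on (Fin.natAdd m) g = on (Fin.natAdd n) g ≫ (h ⊗' 𝟙 (mk j)) := by
  rw [on_natAdd, on_natAdd, ← tens_eq_comp, ← tens_eq_comp']

theorem tens_one_succ (h : mk n ⟶ mk m) (j : ℕ) :
    (h ⊗' 𝟙 (mk j)) ⊗' 𝟙 (mk 1) = tens (n := n) (m := m) h (𝟙 (mk (j + 1))) := by
  have h1 := tens_assoc h (𝟙 (mk j)) (𝟙 (mk 1))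
  rw [id_tens_id] at h1
  exact ((Category.comp_id _).symm.trans h1).trans (Category.id_comp _)

theorem slide_K (h : mk n ⟶ mk m) (j : ℕ) :
    (h ⊗' 𝟙 (mk j)) ≫ K (m + j) =
      K (n + j) ≫ tens (n := n) (m := m) h (𝟙 (mk (j + 1))) := by
  rw [← tens_one_succ, K, K]
  conv_lhs => rw [← tens_unit (h ⊗' 𝟙 (mk j))]
  exact (tens_eq_comp _ _).symm.trans (tens_eq_comp' _ _)

theorem slide_B (h : mk n ⟶ mk m) (j : ℕ) :
    tens (n := n) (m := m) h (𝟙 (mk (j + 1))) ≫ B (m + j) = B (n + j) ≫ (h ⊗' 𝟙 (mk j)) := by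
  rw [← tens_one_succ, B, B]
  conv_rhs => rw [← tens_unit (h ⊗' 𝟙 (mk j))]
  exact (tens_eq_comp _ _).symm.trans (tens_eq_comp' _ _)

theorem slide_at (h : mk n ⟶ mk m) {j : ℕ} (a : Fin j) {U : Gate (m + 1)} {U' : Gate (n + 1)}
    (hU : (h ⊗' 𝟙 (mk 1)) ≫ U = U' ≫ (h ⊗' 𝟙 (mk 1))) :
    (h ⊗' 𝟙 (mk j)) ≫ at' a U = at' a U' ≫ (h ⊗' 𝟙 (mk j)) :=
  slide_lift h (injective_vec1 a) hU

theorem slide_tx (h : mk n ⟶ mk m) {j : ℕ} {a b c : Fin j} (hab : a ≠ b) (hac : a ≠ c)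
    (hbc : b ≠ c) : (h ⊗' 𝟙 (mk j)) ≫ tx m a b c = tx n a b c ≫ (h ⊗' 𝟙 (mk j)) := by
  rw [tx, tx, ← on_T (Fin.natAdd_injective _ _) hab hac hbc,
    ← on_T (Fin.natAdd_injective _ _) hab hac hbc, slide_natAdd]

/-- The oracle `U`, applied after `h`, is the oracle `U'`, applied before `h`. -/
def Tracks (h : mk n ⟶ mk m) (U : Oracle m) (U' : Oracle n) : Prop :=
  (h ⊗' 𝟙 (mk 1)) ≫ U.1 = U'.1 ≫ (h ⊗' 𝟙 (mk 1))

theorem Tracks.zero (h : mk n ⟶ mk m) : Tracks h 0 0 := by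
  rw [Tracks, Oracle.val_zero, Oracle.val_zero]
  exact (Category.comp_id _).trans (Category.id_comp _).symm

theorem Tracks.one (h : mk n ⟶ mk m) : Tracks h 1 1 := by
  rw [Tracks, Oracle.val_one, Oracle.val_one, oneO, oneO, xx, xx,
    ← on_X (Fin.natAdd_injective _ _), ← on_X (Fin.natAdd_injective _ _), slide_natAdd]

variable {h : mk n ⟶ mk m} {U V : Oracle m} {U' V' : Oracle n}

theorem Tracks.add (hU : Tracks h U U') (hV : Tracks h V V') : Tracks h (U + V) (U' + V') := by
  rw [Tracks, Oracle.val_add, Oracle.val_add, mul_eq, mul_eq, ← Category.assoc, hU, Category.assoc,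
    hV, Category.assoc]

/-- Every piece of the circuit of `mulO` can be slid through: the two oracles by hypothesis, the
ancillas and the Toffoli gate because they avoid the wires of `h`. -/
theorem Tracks.mul (hU : Tracks h U U') (hV : Tracks h V V') : Tracks h (U * V) (U' * V') := by
  have hP : (h ⊗' 𝟙 (mk 3)) ≫ prodAt U.1 V.1 0 1 2 =
      prodAt U'.1 V'.1 0 1 2 ≫ (h ⊗' 𝟙 (mk 3)) := by
    simp only [prodAt, mul_eq, Category.assoc]
    rw [← Category.assoc, slide_at h 1 hU, Category.assoc, ← Category.assoc (tens h _),
      slide_at h 2 hV, Category.assoc, ← Category.assoc (tens h _),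
      slide_tx h (by decide) (by decide) (by decide), Category.assoc, ← Category.assoc (tens h _),
      slide_at h 2 hV, Category.assoc, slide_at h 1 hU]
  rw [Tracks, Oracle.val_mul, Oracle.val_mul, mulO, mulO, ← Category.assoc, slide_K h 1,
    Category.assoc, ← Category.assoc (tens h _), slide_K h 2, Category.assoc,
    ← Category.assoc (tens h _), hP, Category.assoc, ← Category.assoc (tens h _), slide_B h 2,
    Category.assoc, slide_B h 1]
  simp only [Category.assoc]

theorem Tracks.comp {k : ℕ} {g : mk m ⟶ mk k} {W : Oracle k} (hU : Tracks g W U)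
    (hh : Tracks h U U') : Tracks (h ≫ g) W U' := by
  rw [Tracks, tens_id_comp, Category.assoc, hU, ← Category.assoc, hh, Category.assoc]

/-- Tracking respects 0, 1, sums and products, and the variables generate. -/
theorem exists_tracks (hvar : ∀ i, ∃ U', Tracks h (Oracle.var i) U') (U : Oracle m) :
    ∃ U', Tracks h U U' := by
  induction U using Oracle.induction with
  | h0 => exact ⟨0, Tracks.zero h⟩
  | h1 => exact ⟨1, Tracks.one h⟩
  | hvar i => exact hvar i
  | hadd U V hU hV =>
    obtain ⟨U', hU⟩ := hU
    obtain ⟨V', hV⟩ := hV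
    exact ⟨_, hU.add hV⟩
  | hmul U V hU hV =>
    obtain ⟨U', hU⟩ := hU
    obtain ⟨V', hV⟩ := hV
    exact ⟨_, hU.mul hV⟩

theorem Tracks.prod {ι : Type*} (s : Finset ι) {f : ι → Oracle m} {f' : ι → Oracle n}
    (hf : ∀ i ∈ s, Tracks h (f i) (f' i)) : Tracks h (∏ i ∈ s, f i) (∏ i ∈ s, f' i) := by
  classical
  induction s using Finset.induction_on with
  | empty => simpa using Tracks.one h
  | insert a s ha ih =>
    rw [Finset.prod_insert ha, Finset.prod_insert ha]
    exact (hf a (Finset.mem_insert_self a s)).mul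
      (ih fun i hi => hf i (Finset.mem_insert_of_mem hi))

end slide

/-! ### Renaming the input wires of oracles. -/

section emb

variable {k n : ℕ}

/-- Extending a map of wires by further wires behind. -/
def liftL (ι : Fin k → Fin n) (j : ℕ) : Fin (k + j) → Fin (n + j) :=
  Fin.addCases (Fin.castAdd j ∘ ι) (Fin.natAdd n)

@[simp] theorem liftL_castAdd (ι : Fin k → Fin n) {j : ℕ} (x : Fin k) :
    liftL ι j (Fin.castAdd j x) = Fin.castAdd j (ι x) := by simp [liftL]

@[simp] theorem liftL_natAdd (ι : Fin k → Fin n) {j : ℕ} (x : Fin j) :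
    liftL ι j (Fin.natAdd k x) = Fin.natAdd n x := by simp [liftL]

variable {ι : Fin k → Fin n}

theorem liftL_injective (h : Function.Injective ι) (j : ℕ) : Function.Injective (liftL ι j) := by
  intro x y hxy
  induction x using Fin.addCases <;> induction y using Fin.addCases <;>
    simp [Fin.ext_iff] at hxy
  · rw [h (Fin.ext hxy)]
  · omega
  · omega
  · rw [Fin.ext hxy]

theorem liftL_at (h : Function.Injective ι) {j : ℕ} (a : Fin j) (U : Gate (k + 1)) :
    on (liftL ι j) (at' a U) = at' a (on (liftL ι 1) U) := by
  rw [at', at', on_on (lift_injective (injective_vec1 a)) (liftL_injective h j),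
    on_on (liftL_injective h 1) (lift_injective (injective_vec1 a))]
  congr 2
  ext x
  induction x using Fin.addCases <;> simp

theorem liftL_mulO (h : Function.Injective ι) {U V : Gate (k + 1)} (hU : IsOracle U)
    (hV : IsOracle V) (hU' : IsOracle (on (liftL ι 1) U)) (hV' : IsOracle (on (liftL ι 1) V)) :
    on (liftL ι 1) (mulO U V) = mulO (on (liftL ι 1) U) (on (liftL ι 1) V) := by
  apply eq_of_at_three
  have hι := liftL_injective h 3
  rw [mulO_spec (hU'.comp hV') (by decide) (by decide) (by decide)]
  have h1 := congrArg (on (liftL ι 3)) (mulO_spec (hU.comp hV) (show (1 : Fin 3) ≠ 2 by decide)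
    (show (1 : Fin 3) ≠ 0 by decide) (show (2 : Fin 3) ≠ 0 by decide))
  simp only [map_mul, prodAt, liftL_at h, on_z hι, liftL_natAdd] at h1
  rw [on_T hι (natAdd_ne (by decide)) (natAdd_ne (by decide)) (natAdd_ne (by decide))] at h1
  simp only [liftL_natAdd] at h1
  exact h1

theorem liftL_varO (h : Function.Injective ι) (i : Fin k) :
    on (liftL ι 1) (varO i) = varO (ι i) := by
  rw [varO, on_C (liftL_injective h 1) (castAdd_ne_natAdd _ _)]
  simp [varO]

theorem liftL_oneO (h : Function.Injective ι) : on (liftL ι 1) (oneO k) = oneO n := by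
  rw [oneO, on_X (liftL_injective h 1)]
  simp [oneO]

theorem isOracle_liftL (h : Function.Injective ι) {U : Gate (k + 1)} (hU : IsOracle U) :
    IsOracle (on (liftL ι 1) U) := by
  refine IsOracle.induction (p := fun U => IsOracle (on (liftL ι 1) U)) ?_ ?_ ?_ ?_ ?_ hU
  · rw [map_one]; exact isOracle_one
  · rw [liftL_oneO h]; exact isOracle_oneO
  · intro i; rw [liftL_varO h]; exact isOracle_varO _
  · intro U V hU hV pU pV; rw [map_mul]; exact pU.mul pV
  · intro U V hU hV pU pV; rw [liftL_mulO h hU hV pU pV]; exact pU.mulO pV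

/-- Renaming the input wires of oracles. -/
noncomputable def Oracle.emb (h : Function.Injective ι) : Oracle k →+* Oracle n where
  toFun U := ⟨on (liftL ι 1) U.1, isOracle_liftL h U.2⟩
  map_one' := Subtype.ext (liftL_oneO h)
  map_mul' U V := Subtype.ext
    (liftL_mulO h U.2 V.2 (isOracle_liftL h U.2) (isOracle_liftL h V.2))
  map_zero' := Subtype.ext (map_one _)
  map_add' U V := Subtype.ext (map_mul _ U.1 V.1)

theorem Oracle.emb_var (h : Function.Injective ι) (i : Fin k) :
    Oracle.emb h (Oracle.var i) = Oracle.var (ι i) := Subtype.ext (liftL_varO h i)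

theorem Oracle.emb_val (h : Function.Injective ι) (U : Oracle k) :
    (Oracle.emb h U).1 = on (liftL ι 1) U.1 := rfl

end emb

end TOF

/-! ### The variables before and after a generator. -/

namespace TOF

open Circuit

section tracks

variable {n m : ℕ}

theorem Oracle.val_var (i : Fin n) :
    (Oracle.var i).1 = C (Fin.castAdd 1 i) (Fin.natAdd n 0) := rfl

/-- Conjugation by the cnots that load the ancillas expands the Toffoli gate bilinearly into four.
Three of them have a zero ancilla as a control and are trivial; the fourth is controlled by the two
variables. -/
theorem val_var_mul_var {i j : Fin n} (hij : i ≠ j) : (Oracle.var i * Oracle.var j).1 =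
    T (Fin.castAdd 1 i) (Fin.castAdd 1 j) (Fin.natAdd n 0) := by
  apply eq_of_at_three
  have hk := lift_injective (n := n) (injective_vec1 (0 : Fin 3))
  have hi := (isOracle_varO i)
  have hj := (isOracle_varO j)
  have hT : at' (0 : Fin 3) (T (Fin.castAdd 1 i) (Fin.castAdd 1 j) (Fin.natAdd n 0)) =
      T (Fin.castAdd 3 i) (Fin.castAdd 3 j) (Fin.natAdd n 0) :=
    (on_T hk (by simpa using hij) (castAdd_ne_natAdd _ _) (castAdd_ne_natAdd _ _)).trans (by simp)
  have hP := mulO_spec (hi.comp hj) (show (1 : Fin 3) ≠ 2 by decide) (show (1 : Fin 3) ≠ 0 by decide)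
    (show (2 : Fin 3) ≠ 0 by decide)
  rw [prodAt, at_varO, at_varO] at hP
  rw [hT]
  refine hP.trans ?_
  set a : Fin (n + 3) := Fin.castAdd 3 i with ha
  set b : Fin (n + 3) := Fin.castAdd 3 j with hb
  set w : Fin 3 → Fin (n + 3) := Fin.natAdd n with hw
  have hab : a ≠ b := by simpa [ha, hb] using hij
  have haw : ∀ x, a ≠ w x := fun x => castAdd_ne_natAdd _ _
  have hbw : ∀ x, b ≠ w x := fun x => castAdd_ne_natAdd _ _
  have h01 : w 0 ≠ w 1 := natAdd_ne (by decide)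
  have h02 : w 0 ≠ w 2 := natAdd_ne (by decide)
  have h12 : w 1 ≠ w 2 := natAdd_ne (by decide)
  have h1 : C b (w 2) * T (w 2) (w 1) (w 0) * C b (w 2) = T b (w 1) (w 0) * T (w 2) (w 1) (w 0) :=
    C_T_C (injective_vec4.2 ⟨hbw _, hbw _, hbw _, h12.symm, h02.symm, h01.symm⟩)
  have h2 : C a (w 1) * T (w 1) b (w 0) * C a (w 1) = T a b (w 0) * T (w 1) b (w 0) :=
    C_T_C (injective_vec4.2 ⟨haw _, hab, haw _, (hbw _).symm, h01.symm, hbw _⟩)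
  have h3 : C a (w 1) * T (w 1) (w 2) (w 0) * C a (w 1) = T a (w 2) (w 0) * T (w 1) (w 2) (w 0) :=
    C_T_C (injective_vec4.2 ⟨haw _, haw _, haw _, h12, h01.symm, h02.symm⟩)
  have hcc : C a (w 1) * C a (w 1) = 1 := C_mul_self (haw _)
  have hz : Commute (z (w 1)) (z (w 2)) := commute_z_z h12
  have k1 : T (w 1) (w 2) (w 0) * z (w 1) = z (w 1) := T_mul_z h12 h01.symm h02.symm
  have k2 : T a (w 2) (w 0) * z (w 2) = z (w 2) := by
    rw [T_comm_controls (haw _) (haw _) h02.symm]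
    exact T_mul_z (haw _).symm h02.symm (haw _)
  have k3 : T (w 1) b (w 0) * z (w 1) = z (w 1) := T_mul_z (hbw _).symm h01.symm (hbw _)
  show C a (w 1) * C b (w 2) * T (w 1) (w 2) (w 0) * C b (w 2) * C a (w 1) * (z (w 1) * z (w 2)) =
    T a b (w 0) * (z (w 1) * z (w 2))
  calc C a (w 1) * C b (w 2) * T (w 1) (w 2) (w 0) * C b (w 2) * C a (w 1) * (z (w 1) * z (w 2))
      = C a (w 1) * (C b (w 2) * T (w 2) (w 1) (w 0) * C b (w 2)) * C a (w 1) *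
          (z (w 1) * z (w 2)) := by
        rw [T_comm_controls h12 h01.symm h02.symm]; simp only [mul_assoc]
    _ = C a (w 1) * T (w 1) b (w 0) * (C a (w 1) * C a (w 1)) * T (w 1) (w 2) (w 0) * C a (w 1) *
          (z (w 1) * z (w 2)) := by
        rw [h1, hcc, T_comm_controls (hbw 1) (hbw 0) h01.symm, T_comm_controls h12.symm h02.symm
          h01.symm]; simp only [mul_assoc, one_mul]
    _ = (C a (w 1) * T (w 1) b (w 0) * C a (w 1)) * (C a (w 1) * T (w 1) (w 2) (w 0) * C a (w 1)) *
          (z (w 1) * z (w 2)) := by simp only [mul_assoc]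
    _ = T a b (w 0) * T (w 1) b (w 0) * T a (w 2) (w 0) * (T (w 1) (w 2) (w 0) * z (w 1)) *
          z (w 2) := by rw [h2, h3]; simp only [mul_assoc]
    _ = T a b (w 0) * T (w 1) b (w 0) * (T a (w 2) (w 0) * z (w 2)) * z (w 1) := by
        rw [k1, mul_assoc _ (z (w 1)), hz.eq]; simp only [mul_assoc]
    _ = T a b (w 0) * (T (w 1) b (w 0) * z (w 1)) * z (w 2) := by
        rw [k2, mul_assoc _ (z (w 2)), ← hz.eq]; simp only [mul_assoc]
    _ = T a b (w 0) * (z (w 1) * z (w 2)) := by rw [k3]; simp only [mul_assoc]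

theorem tens_one_eq_on (h : Gate n) : h ⊗' 𝟙 (mk 1) = on (Fin.castAdd 1) h := (on_castAdd 1 h).symm

theorem tracks_gate_iff {h : Gate n} {U U' : Oracle n} :
    Tracks h U U' ↔ on (Fin.castAdd 1) h * U.1 = U'.1 * on (Fin.castAdd 1) h := by
  rw [Tracks, tens_one_eq_on, mul_eq, mul_eq]

theorem castAdd_ne {x y : Fin n} (h : x ≠ y) : Fin.castAdd m x ≠ Fin.castAdd m y := by
  simpa using h

/-- After the gate, the target carries the old value plus the product of the controls; as an
identity of gates this is `T_C_T`. -/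
theorem tracks_T {a b c : Fin n} (hab : a ≠ b) (hac : a ≠ c) (hbc : b ≠ c) :
    Tracks (T a b c) (Oracle.var c) (Oracle.var a * Oracle.var b + Oracle.var c) := by
  have hT := T_C_T (N := n + 1) (a := Fin.castAdd 1 a) (b := Fin.castAdd 1 b)
    (c := Fin.castAdd 1 c) (d := Fin.natAdd n 0) (injective_vec4.2 ⟨castAdd_ne hab,
      castAdd_ne hac, castAdd_ne_natAdd _ _, castAdd_ne hbc, castAdd_ne_natAdd _ _,
      castAdd_ne_natAdd _ _⟩)
  rw [tracks_gate_iff, Oracle.val_add, val_var_mul_var hab, on_T (Fin.castAdd_injective _ _) hab hac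
    hbc, Oracle.val_var, ← hT, mul_assoc _ (T _ _ _) (T _ _ _),
    T_mul_self (castAdd_ne hab) (castAdd_ne hac) (castAdd_ne hbc), mul_one]

theorem tracks_T_of_ne {a b c x : Fin n} (hab : a ≠ b) (hac : a ≠ c) (hbc : b ≠ c) (hx : x ≠ c) :
    Tracks (T a b c) (Oracle.var x) (Oracle.var x) := by
  rw [tracks_gate_iff, on_T (Fin.castAdd_injective _ _) hab hac hbc, Oracle.val_var]
  have hab' := castAdd_ne (m := 1) hab
  have hac' := castAdd_ne (m := 1) hac
  have hbc' := castAdd_ne (m := 1) hbc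
  have hna := castAdd_ne_natAdd a (0 : Fin 1)
  have hnb := castAdd_ne_natAdd b (0 : Fin 1)
  have hnc := castAdd_ne_natAdd c (0 : Fin 1)
  have hnx := castAdd_ne_natAdd x (0 : Fin 1)
  by_cases hxa : x = a
  · rw [hxa]
    exact commute_T_C_control (injective_vec4.2 ⟨hab', hac', hna, hbc', hnb, hnc⟩)
  by_cases hxb : x = b
  · rw [hxb, T_comm_controls hab' hac' hbc']
    exact commute_T_C_control (injective_vec4.2 ⟨hab'.symm, hbc', hnb, hac', hna, hnc⟩)
  · refine (commute_C_on (injective_vec3.2 ⟨hab', hac', hbc'⟩) hnx ?_ ?_ _).symm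
    · intro i
      fin_cases i
      exacts [castAdd_ne hxa, castAdd_ne hxb, castAdd_ne hx]
    · intro i
      fin_cases i
      exacts [hna.symm, hnb.symm, hnc.symm]

theorem tracks_X (a : Fin n) : Tracks (X a) (Oracle.var a) (1 + Oracle.var a) := by
  have hT := X_C_X (castAdd_ne_natAdd a (0 : Fin 1))
  rw [tracks_gate_iff, Oracle.val_add, Oracle.val_one, oneO, on_X (Fin.castAdd_injective _ _),
    Oracle.val_var, ← hT, mul_assoc _ (X _) (X _), X_mul_self, mul_one]

theorem tracks_X_of_ne {a x : Fin n} (hx : a ≠ x) :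
    Tracks (X a) (Oracle.var x) (Oracle.var x) := by
  rw [tracks_gate_iff, on_X (Fin.castAdd_injective _ _), Oracle.val_var]
  exact commute_X_C (castAdd_ne_natAdd _ _) (castAdd_ne hx) (castAdd_ne_natAdd _ _)

theorem pm_comp_on {k : ℕ} (σ : Fin n ≃ Fin m) {κ : Fin k → Fin n} (hκ : Function.Injective κ)
    (f : Gate k) : pm σ ≫ on (σ ∘ κ) f = on κ f ≫ pm σ := by
  rw [← on_on hκ σ.injective, on_equiv, pm_comp_symm_assoc]

theorem tracks_pm (σ : Fin n ≃ Fin m) (x : Fin n) :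
    Tracks (pm σ) (Oracle.var (σ x)) (Oracle.var x) := by
  rw [Tracks, ← pm_refl, pm_tens, Oracle.val_var, Oracle.val_var]
  have h := pm_comp_on (permSum σ (Equiv.refl (Fin 1))) (κ := ![Fin.castAdd 1 x, Fin.natAdd n 0])
    (injective_vec2.2 (castAdd_ne_natAdd x 0)) cnotG
  rw [comp_vec2] at h
  simpa [C] using h

theorem K_comp_z (n : ℕ) : K n ≫ z (Fin.last n) = K n := by
  rw [← B_K, ← Category.assoc, K_B, Category.id_comp]

theorem insertEquiv_last_one (n : ℕ) :
    insertEquiv n 1 (Fin.last (n + 1)) = Fin.castAdd 1 (Fin.last n) := by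
  ext
  rw [insertEquiv_last]
  simp

theorem insertEquiv_castAdd_one (x : Fin n) :
    insertEquiv n 1 (Fin.castAdd 1 x).castSucc = Fin.castAdd 1 x.castSucc := by
  ext
  rw [insertEquiv_castSucc]
  simp

theorem insertEquiv_natAdd_one (n : ℕ) :
    insertEquiv n 1 (Fin.natAdd n (0 : Fin 1)).castSucc = Fin.natAdd (n + 1) 0 := by
  ext
  rw [insertEquiv_castSucc]
  simp

theorem K_tens (n : ℕ) : K n ⊗' 𝟙 (mk 1) = K (n + 1) ≫ pm (insertEquiv n 1) := insert_k0 n 1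

theorem B_tens (n : ℕ) : B n ⊗' 𝟙 (mk 1) = pm (insertEquiv n 1).symm ≫ B (n + 1) := insert_b0 n 1

/-- A cnot controlled by the fresh wire with value 0 does nothing. -/
theorem tracks_K_last (n : ℕ) : Tracks (K n) (Oracle.var (Fin.last n)) 0 := by
  have h := pm_comp_on (insertEquiv n 1)
    (κ := ![Fin.last (n + 1), (Fin.natAdd n (0 : Fin 1)).castSucc])
    (injective_vec2.2 (last_ne_castSucc _)) cnotG
  rw [comp_vec2, insertEquiv_last_one, insertEquiv_natAdd_one] at h
  rw [Tracks, Oracle.val_zero, one_eq, Category.id_comp, K_tens, Oracle.val_var, Category.assoc]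
  refine (congrArg (K (n + 1) ≫ ·) h).trans ?_
  show K (n + 1) ≫ C _ _ ≫ _ = _
  rw [← Category.assoc, ← K_comp_z, Category.assoc (K _), ← mul_eq, z_mul_C (last_ne_castSucc _)]

theorem tracks_K (x : Fin n) : Tracks (K n) (Oracle.var x.castSucc) (Oracle.var x) := by
  have h := pm_comp_on (insertEquiv n 1)
    (κ := ![(Fin.castAdd 1 x).castSucc, (Fin.natAdd n (0 : Fin 1)).castSucc])
    (injective_vec2.2 fun h => castAdd_ne_natAdd x 0 (Fin.castSucc_injective _ h)) cnotG
  rw [comp_vec2, insertEquiv_castAdd_one, insertEquiv_natAdd_one] at h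
  rw [Tracks, K_tens, Oracle.val_var, Oracle.val_var, Category.assoc]
  refine (congrArg (K (n + 1) ≫ ·) h).trans ?_
  show K (n + 1) ≫ C _ _ ≫ _ = _
  rw [← on_C (Fin.castSucc_injective _) (castAdd_ne_natAdd _ _), ← Category.assoc, K_naturality,
    Category.assoc]

theorem tracks_B (x : Fin n) : Tracks (B n) (Oracle.var x) (Oracle.var x.castSucc) := by
  have h := pm_comp_on (insertEquiv n 1)
    (κ := ![(Fin.castAdd 1 x).castSucc, (Fin.natAdd n (0 : Fin 1)).castSucc])
    (injective_vec2.2 fun h => castAdd_ne_natAdd x 0 (Fin.castSucc_injective _ h)) cnotG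
  rw [comp_vec2, insertEquiv_castAdd_one, insertEquiv_natAdd_one] at h
  have h' : pm (insertEquiv n 1).symm ≫ C (Fin.castAdd 1 x).castSucc
      (Fin.natAdd n (0 : Fin 1)).castSucc =
      C (Fin.castAdd 1 x.castSucc) (Fin.natAdd (n + 1) 0) ≫ pm (insertEquiv n 1).symm := by
    have := congrArg (fun y => pm (insertEquiv n 1).symm ≫ y ≫ pm (insertEquiv n 1).symm) h
    simp only [Category.assoc, pm_comp_symm, Category.comp_id, pm_symm_comp_assoc] at this
    exact this.symm
  rw [Tracks, B_tens, Oracle.val_var, Oracle.val_var, Category.assoc, ← B_naturality,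
    on_C (Fin.castSucc_injective _) (castAdd_ne_natAdd _ _), ← Category.assoc, h', Category.assoc]

end tracks

end TOF

/-! ### Multiply controlled not gates are monomials. -/

namespace TOF

open Circuit

section cnot_gate

theorem pm_finCongr_K {p q : ℕ} (h : p = q) :
    pm (finCongr h) ≫ K q = K p ≫ pm (finCongr (congrArg (· + 1) h)) := by
  subst h
  exact (Category.id_comp _).trans (Category.comp_id _).symm

theorem B_pm_finCongr {p q : ℕ} (h : p = q) :
    B p ≫ pm (finCongr h) = pm (finCongr (congrArg (· + 1) h)) ≫ B q := by
  subst h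
  exact (Category.comp_id _).trans (Category.id_comp _).symm

/-- The wiring that moves the last wire behind the first two. -/
def ancillaEquiv (k : ℕ) : Fin (k + 5) ≃ Fin (3 + (k + 2)) :=
  (finCongr (by omega)).trans (insertEquiv 2 (k + 2))

theorem ancillaEquiv_last (k : ℕ) : (ancillaEquiv k (Fin.last (k + 4)) : ℕ) = 2 := by
  have : (finCongr (by omega : k + 5 = 2 + (k + 2) + 1)) (Fin.last (k + 4)) =
      Fin.last (2 + (k + 2)) := by ext; simp
  simp only [ancillaEquiv, Equiv.trans_apply, this, insertEquiv_last]

theorem ancillaEquiv_castSucc (k : ℕ) (x : Fin (k + 4)) :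
    (ancillaEquiv k x.castSucc : ℕ) = if (x : ℕ) < 2 then (x : ℕ) else x + 1 := by
  have : (finCongr (by omega : k + 5 = 2 + (k + 2) + 1)) x.castSucc =
      (Fin.cast (by omega : k + 4 = 2 + (k + 2)) x).castSucc := by ext; simp
  simp only [ancillaEquiv, Equiv.trans_apply, this, insertEquiv_castSucc]
  simp

/-- The wires of the inner gate of the recursion. -/
def innerWires (k : ℕ) : Fin (k + 3) → Fin (k + 5) :=
  Fin.cons (Fin.last (k + 4)) fun i : Fin (k + 2) => i.succ.succ.castSucc

/-- The controls of the inner gate of the recursion. -/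
def innerControls (k : ℕ) : Fin (k + 2) → Fin (k + 4) :=
  Fin.cons (Fin.last (k + 3)) fun i : Fin (k + 1) => i.succ.succ.castSucc

theorem innerWires_injective (k : ℕ) : Function.Injective (innerWires k) := by
  rw [innerWires, Fin.cons_injective_iff]
  refine ⟨?_, ?_⟩
  · rintro ⟨i, hi⟩
    exact Fin.castSucc_ne_last _ hi
  · intro i j hij
    simpa using hij

theorem innerControls_injective (k : ℕ) : Function.Injective (innerControls k) := by
  rw [innerControls, Fin.cons_injective_iff]
  refine ⟨?_, ?_⟩
  · rintro ⟨i, hi⟩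
    exact Fin.castSucc_ne_last _ hi
  · intro i j hij
    simpa using hij

theorem insertEquiv_comp_innerWires (k : ℕ) :
    insertEquiv (k + 3) 1 ∘ innerWires k = liftL (innerControls k) 1 := by
  funext i
  refine Fin.cases ?_ (fun i => ?_) i
  · have : (0 : Fin (k + 3)) = Fin.castAdd 1 0 := by ext; simp
    rw [this, liftL_castAdd]
    exact insertEquiv_last_one (k + 3)
  · refine Fin.lastCases ?_ (fun i => ?_) i
    · have : (Fin.last (k + 1)).succ = Fin.natAdd (k + 2) (0 : Fin 1) := by ext; simp
      rw [this, liftL_natAdd, ← this]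
      exact insertEquiv_natAdd_one (k + 3)
    · have : i.castSucc.succ = Fin.castAdd 1 i.succ := by ext; simp
      rw [this, liftL_castAdd]
      exact insertEquiv_castAdd_one i.succ.succ

theorem ancillaEquiv_comp_innerWires (k : ℕ) (h : 2 + (k + 3) = 3 + (k + 2)) :
    ancillaEquiv k ∘ innerWires k = finCongr h ∘ Fin.natAdd 2 := by
  funext i
  ext
  refine Fin.cases ?_ (fun i => ?_) i
  · exact (ancillaEquiv_last k).trans (by simp)
  · refine (ancillaEquiv_castSucc k i.succ.succ).trans ?_
    simp
    omega

theorem ancillaEquiv_comp_vec (k : ℕ) :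
    ancillaEquiv k ∘ ![Fin.castAdd 1 0, Fin.castAdd 1 1, Fin.last (k + 4)] =
      Fin.castAdd (k + 2) := by
  funext i
  ext
  fin_cases i
  · exact (ancillaEquiv_castSucc k 0).trans (by simp)
  · exact (ancillaEquiv_castSucc k 1).trans (by simp)
  · exact (ancillaEquiv_last k).trans (by simp)

theorem ofCircuit_cnotGate_add_three (k : ℕ) : ofCircuit (cnotGate (k + 3)) =
    K (k + 4) ≫ (T (Fin.castAdd 1 0) (Fin.castAdd 1 1) (Fin.last (k + 4)) *
      on (innerWires k) (ofCircuit (cnotGate (k + 2))) *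
      T (Fin.castAdd 1 0) (Fin.castAdd 1 1) (Fin.last (k + 4))) ≫ B (k + 4) := by
  set G := ofCircuit (cnotGate (k + 2))
  have e1 : pm (finCongr (by omega : k + 4 = 2 + (k + 2))) ≫ ((𝟙 (mk 2) ⊗' k0) ⊗' 𝟙 (mk (k + 2))) =
      K (k + 4) ≫ pm (ancillaEquiv k) := by
    rw [insert_k0]
    refine (Category.assoc _ _ _).symm.trans ?_
    rw [pm_finCongr_K, Category.assoc]
    exact congrArg (K (k + 4) ≫ ·) (pm_comp _ _)
  have e2 : ((𝟙 (mk 2) ⊗' b0) ⊗' 𝟙 (mk (k + 2))) ≫ pm (finCongr (by omega : 2 + (k + 2) = k + 4)) =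
      pm (ancillaEquiv k).symm ≫ B (k + 4) := by
    rw [insert_b0]
    refine (Category.assoc _ _ _).trans ?_
    rw [B_pm_finCongr, ← Category.assoc]
    exact congrArg (· ≫ B (k + 4)) (pm_comp _ _)
  have h : 2 + (k + 3) = 3 + (k + 2) := by omega
  have e3 : pm (finCongr h).symm ≫ (𝟙 (mk 2) ⊗' G) ≫ pm (finCongr h) =
      on (finCongr h ∘ Fin.natAdd 2) G := by
    rw [← on_on (Fin.natAdd_injective _ _) (finCongr h).injective, on_natAdd, on_equiv]
  have hd : ofCircuit (cnotGate (k + 3)) =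
      (pm (finCongr (by omega : k + 4 = 2 + (k + 2))) ≫
        ((𝟙 (mk 2) ⊗' k0) ⊗' 𝟙 (mk (k + 2)))) ≫ (tofG ⊗' 𝟙 (mk (k + 2))) ≫
      (pm (finCongr h).symm ≫ (𝟙 (mk 2) ⊗' G) ≫ pm (finCongr h)) ≫ (tofG ⊗' 𝟙 (mk (k + 2))) ≫
      ((𝟙 (mk 2) ⊗' b0) ⊗' 𝟙 (mk (k + 2))) ≫ pm (finCongr (by omega : 2 + (k + 2) = k + 4)) := by
    rw [cnotGate]
    rfl
  have hv : Function.Injective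
      ![Fin.castAdd 1 (0 : Fin (k + 4)), Fin.castAdd 1 1, Fin.last (k + 4)] :=
    injective_vec3.2 ⟨castAdd_ne (by simp), Fin.castSucc_ne_last _, Fin.castSucc_ne_last _⟩
  rw [hd, e1, e2, e3, ← on_castAdd, ← ancillaEquiv_comp_vec, ← ancillaEquiv_comp_innerWires,
    mul_eq, mul_eq, T]
  simp only [Category.assoc]
  have c1 := pm_comp_on (ancillaEquiv k) hv tofG
  have c2 := pm_comp_on (ancillaEquiv k) (innerWires_injective k) G
  rw [← Category.assoc (pm _), c1, Category.assoc, ← Category.assoc (pm _), c2, Category.assoc,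
    ← Category.assoc (pm _), c1, Category.assoc, pm_comp_symm_assoc]

/-- The product of the first two variables, computed on an ancillary wire. -/
noncomputable def ancillaProd (k : ℕ) : mk (k + 3) ⟶ mk (k + 4) :=
  K (k + 3) ≫ T 0 1 (Fin.last (k + 3))

theorem tracks_ancillaProd_last (k : ℕ) : Tracks (ancillaProd k) (Oracle.var (Fin.last (k + 3)))
    (Oracle.var 0 * Oracle.var 1) := by
  have h1 : (0 : Fin (k + 4)) ≠ 1 := by simp
  have h := tracks_T h1 (Fin.castSucc_ne_last (0 : Fin (k + 3)))
    (Fin.castSucc_ne_last (1 : Fin (k + 3)))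
  have h' := ((tracks_K (0 : Fin (k + 3))).mul (tracks_K (1 : Fin (k + 3)))).add
    (tracks_K_last (k + 3))
  rw [add_zero] at h'
  exact h.comp h'

theorem tracks_ancillaProd_castSucc (k : ℕ) (x : Fin (k + 3)) :
    Tracks (ancillaProd k) (Oracle.var x.castSucc) (Oracle.var x) := by
  have h1 : (0 : Fin (k + 4)) ≠ 1 := by simp
  exact (tracks_T_of_ne h1 (Fin.castSucc_ne_last (0 : Fin (k + 3)))
    (Fin.castSucc_ne_last (1 : Fin (k + 3))) (Fin.castSucc_ne_last x)).comp (tracks_K x)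

/-- If `g` undoes `h`, tracking computes the conjugate of an oracle; preparing and uncomputing an
ancilla is such a pair. -/
theorem Tracks.sandwich {n m : ℕ} {h : mk n ⟶ mk m} {g : mk m ⟶ mk n} (hg : h ≫ g = 𝟙 _)
    {U : Oracle m} {U' : Oracle n} (hU : Tracks h U U') :
    (h ⊗' 𝟙 (mk 1)) ≫ U.1 ≫ (g ⊗' 𝟙 (mk 1)) = U'.1 := by
  rw [← Category.assoc, hU, Category.assoc, ← tens_id_comp, hg, id_tens_id]
  exact Category.comp_id _

theorem sandwich_eq_tens {n : ℕ} (f : Gate (n + 2)) : K (n + 1) ≫ f ≫ B (n + 1) =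
    (K n ⊗' 𝟙 (mk 1)) ≫ on (insertEquiv n 1) f ≫ (B n ⊗' 𝟙 (mk 1)) := by
  rw [on_equiv, K_tens, B_tens]
  simp only [Category.assoc, pm_comp_symm_assoc]

theorem on_insertEquiv_T (k : ℕ) :
    on (insertEquiv (k + 3) 1) (T (Fin.castAdd 1 0) (Fin.castAdd 1 1) (Fin.last (k + 4))) =
      T 0 1 (Fin.last (k + 3)) ⊗' 𝟙 (mk 1) := by
  have h01 : (Fin.castAdd 1 0 : Fin (k + 5)) ≠ Fin.castAdd 1 1 := castAdd_ne (by simp)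
  have h0 : (0 : Fin (k + 4)) ≠ Fin.last (k + 3) := Fin.castSucc_ne_last (0 : Fin (k + 3))
  have h1 : (1 : Fin (k + 4)) ≠ Fin.last (k + 3) := Fin.castSucc_ne_last (1 : Fin (k + 3))
  rw [on_T (insertEquiv (k + 3) 1).injective h01 (Fin.castSucc_ne_last _)
    (Fin.castSucc_ne_last _), tens_one_eq_on, on_T (Fin.castAdd_injective _ _) (by simp) h0 h1]
  congr 1
  exact insertEquiv_last_one (k + 3)

/-- The first Toffoli gate makes the ancilla carry the product of the first two variables. By
induction the inner gate is the product of the ancilla and the remaining variables, so it pulls back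
to the product of all variables, and the second Toffoli gate clears the ancilla. -/
theorem ofCircuit_cnotGate_step {k : ℕ}
    (ih : ofCircuit (cnotGate (k + 2)) = (∏ i : Fin (k + 2), Oracle.var i).1) :
    ofCircuit (cnotGate (k + 3)) = (∏ i : Fin (k + 3), Oracle.var i).1 := by
  have hT : T 0 1 (Fin.last (k + 3)) ≫ T 0 1 (Fin.last (k + 3)) = 𝟙 _ :=
    T_mul_self (by simp) (Fin.castSucc_ne_last (0 : Fin (k + 3)))
      (Fin.castSucc_ne_last (1 : Fin (k + 3)))
  have hg : ancillaProd k ≫ (T 0 1 (Fin.last (k + 3)) ≫ B (k + 3)) = 𝟙 _ := by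
    rw [ancillaProd, Category.assoc, ← Category.assoc (T _ _ _), hT, Category.id_comp, K_B]
  have hW : Tracks (ancillaProd k)
      (Oracle.emb (innerControls_injective k) (∏ i : Fin (k + 2), Oracle.var i))
      (∏ i : Fin (k + 3), Oracle.var i) := by
    have h1 : ∏ i : Fin (k + 3), Oracle.var i =
        Oracle.var 0 * Oracle.var 1 * ∏ i : Fin (k + 1), Oracle.var i.succ.succ := by
      rw [Fin.prod_univ_succ, Fin.prod_univ_succ, ← mul_assoc, Fin.succ_zero_eq_one]
    have h2 : Oracle.emb (innerControls_injective k) (∏ i : Fin (k + 2), Oracle.var i) =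
        Oracle.var (Fin.last (k + 3)) *
          ∏ i : Fin (k + 1), Oracle.var (i.succ.succ.castSucc : Fin (k + 4)) := by
      simp only [Fin.prod_univ_succ (n := k + 1), map_mul, map_prod, Oracle.emb_var,
        innerControls, Fin.cons_zero, Fin.cons_succ]
    rw [h1, h2]
    refine (tracks_ancillaProd_last k).mul (Tracks.prod _ fun i _ => ?_)
    exact tracks_ancillaProd_castSucc k i.succ.succ
  rw [ofCircuit_cnotGate_add_three, ih, ← hW.sandwich hg, Oracle.emb_val,
    ← insertEquiv_comp_innerWires, ← on_on (innerWires_injective k) (insertEquiv (k + 3) 1).injective,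
    sandwich_eq_tens, map_mul, map_mul, on_insertEquiv_T, ancillaProd, tens_id_comp, tens_id_comp,
    mul_eq, mul_eq]
  simp only [Category.assoc]

theorem ofCircuit_cnotGate :
    ∀ k : ℕ, ofCircuit (cnotGate k) = (∏ i : Fin k, Oracle.var i).1
  | 0 => by
    rw [Finset.univ_eq_empty, Finset.prod_empty, Oracle.val_one, oneO]
    exact X_0.symm
  | 1 => by
    rw [Fin.prod_univ_one, Oracle.val_var]
    exact C_01.symm
  | 2 => by
    rw [Fin.prod_univ_two, val_var_mul_var (by decide)]
    exact T_012.symm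
  | k + 3 => ofCircuit_cnotGate_step (ofCircuit_cnotGate (k + 2))

end cnot_gate

/-! ### Polynomial forms are exactly the oracles. -/

section poly

variable {n : ℕ}

theorem targetLast_eq_liftL (S : Finset (Fin n)) :
    targetLast S = liftL (S.orderEmbOfFin rfl) 1 := by
  funext i
  refine Fin.lastCases ?_ (fun i => ?_) i
  · rw [targetLast, Fin.snoc_last]
    exact (liftL_natAdd _ (0 : Fin 1)).symm
  · rw [targetLast, Fin.snoc_castSucc]
    exact (liftL_castAdd _ i).symm

theorem ofCircuit_on_targetLast (S : Finset (Fin n)) :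
    ofCircuit ((cnotGate S.card).on (targetLast S) (targetLast_injective S)) =
      (∏ i ∈ S, Oracle.var i).1 := by
  have h := (S.orderEmbOfFin rfl).injective
  have h1 : ∏ i ∈ S, Oracle.var i = ∏ i, Oracle.var (S.orderEmbOfFin rfl i) := by
    conv_lhs => rw [← Finset.image_orderEmbOfFin_univ S rfl]
    rw [Finset.prod_image fun _ _ _ _ h' => h h']
  rw [ofCircuit_on, ofCircuit_cnotGate, targetLast_eq_liftL, ← Oracle.emb_val h, map_prod, h1]
  simp only [Oracle.emb_var]

theorem ofCircuit_polyCircuit (l : List (Finset (Fin n))) :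
    ofCircuit (polyCircuit l) = (l.map fun S => ∏ i ∈ S, Oracle.var i).sum.1 := by
  induction l with
  | nil => rfl
  | cons S l ih =>
    rw [List.map_cons, List.sum_cons, Oracle.val_add, ← ih, ← ofCircuit_on_targetLast]
    rfl

theorem exists_list (U : Oracle n) :
    ∃ l : List (Finset (Fin n)), U = (l.map fun S => ∏ i ∈ S, Oracle.var i).sum := by
  induction U using Oracle.induction with
  | h0 => exact ⟨[], rfl⟩
  | h1 => exact ⟨[∅], by simp⟩
  | hvar i => exact ⟨[{i}], by simp⟩
  | hadd U V hU hV =>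
    obtain ⟨l, rfl⟩ := hU
    obtain ⟨l', rfl⟩ := hV
    exact ⟨l ++ l', by simp⟩
  | hmul U V hU hV =>
    obtain ⟨l, rfl⟩ := hU
    obtain ⟨l', rfl⟩ := hV
    -- Common variables are absorbed because squares collapse, so monomials multiply by union of
    -- their sets.
    have hS (S S' : Finset (Fin n)) : (∏ i ∈ S, Oracle.var i) * ∏ i ∈ S', Oracle.var i =
        ∏ i ∈ S ∪ S', Oracle.var i := by
      induction S using Finset.induction_on with
      | empty => simp
      | insert a S ha ih =>
        rw [Finset.prod_insert ha, mul_assoc, ih, Finset.insert_union]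
        by_cases h : a ∈ S ∪ S'
        · rw [Finset.insert_eq_of_mem h, ← Finset.mul_prod_erase _ _ h, ← mul_assoc,
            Oracle.mul_self]
        · rw [Finset.prod_insert h]
    refine ⟨l.flatMap fun S => l'.map fun S' => S ∪ S', ?_⟩
    induction l with
    | nil => simp
    | cons S l ih =>
      rw [List.map_cons, List.sum_cons, add_mul, ih, List.flatMap_cons, List.map_append,
        List.sum_append, ← List.sum_map_mul_left, List.map_map]
      simp only [hS, Function.comp_def]

end poly

end TOF

/-! ### Restricting to the inputs where an oracle has a given value. -/

namespace TOF

open Circuit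

variable {n : ℕ}

/-- The restriction to the inputs where the oracle `U` has the value `1`. -/
noncomputable def test (U : Oracle n) : Gate n := K n ≫ (xx n (0 : Fin 1) * U.1) ≫ B n

/-- The restriction to the inputs where the oracle `U` has the value `0`. -/
noncomputable def zeroTest (U : Oracle n) : Gate n := K n ≫ U.1 ≫ B n

theorem zeroTest_eq (U : Oracle n) : zeroTest U = test (1 + U) := by
  have h : xx n (0 : Fin 1) * (oneO n * U.1) = U.1 := by
    rw [← mul_assoc, oneO, X_mul_self, one_mul]
  rw [zeroTest, test, Oracle.val_add, Oracle.val_one, h]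

theorem test_eq (U : Oracle n) : test U = zeroTest (1 + U) := by
  rw [zeroTest_eq, ← add_assoc, Oracle.add_self, zero_add]

theorem lift_castSucc (f : Gate n) {j : ℕ} (a : Fin j) :
    on (lift n ![a]) (on Fin.castSucc f) = on (Fin.castAdd j) f := by
  rw [on_on (Fin.castSucc_injective n) (lift_injective (injective_vec1 a))]
  congr 1
  congr 1
  funext x
  exact lift_castAdd _ x

theorem castAdd_sandwich (f : Gate (n + 1)) {j : ℕ} (a : Fin j) :
    on (Fin.castAdd j) (K n ≫ f ≫ B n) * zx n a = zx n a * at' a f * zx n a := by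
  have h1 : on Fin.castSucc (K n ≫ f ≫ B n) * z (Fin.last n) =
      z (Fin.last n) * f * z (Fin.last n) := by
    rw [← B_comp_K, ← B_K, mul_eq, mul_eq]
    simp only [Category.assoc]
  have hz : at' a (z (Fin.last n)) = zx n a := lift_zx (injective_vec1 a) (0 : Fin 1)
  have h2 := congrArg (at' a) h1
  rw [map_mul, map_mul, map_mul, hz] at h2
  rw [← h2, at', lift_castSucc]

theorem castAdd_test (U : Oracle n) {j : ℕ} (a : Fin j) :
    on (Fin.castAdd j) (test U) * zx n a = zx n a * (xx n a * at' a U.1) * zx n a := by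
  have hx : at' a (xx n (0 : Fin 1)) = xx n a := lift_xx (injective_vec1 a) (0 : Fin 1)
  rw [test, castAdd_sandwich, map_mul, hx]

/-- The test in the form compute, restrict to 1, uncompute, which unlike `castAdd_test` postselects
no output. In the proof a second zero wire realizes the restriction to 1 as a postselected cnot;
compute, copy, uncompute then adds `U` directly to that wire. -/
theorem castAdd_test' (U : Oracle n) {j : ℕ} (a : Fin j) :
    on (Fin.castAdd j) (test U) * zx n a = at' a U.1 * ox n a * at' a U.1 * zx n a := by
  have base : on (Fin.castAdd 1) (test U) * zx n (0 : Fin 1) =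
      at' (0 : Fin 1) U.1 * ox n 0 * at' (0 : Fin 1) U.1 * zx n 0 := by
    apply on_castSucc_mul_z_cancel
    have e1 : on Fin.castSucc (on (Fin.castAdd 1) (test U)) = on (Fin.castAdd 2) (test U) := by
      rw [on_on (Fin.castAdd_injective _ _) (Fin.castSucc_injective _)]
      rfl
    have e2 : on Fin.castSucc (ox n (0 : Fin 1)) = ox n (0 : Fin 2) :=
      on_o (Fin.castSucc_injective _) _
    have e3 : on Fin.castSucc (zx n (0 : Fin 1)) = zx n (0 : Fin 2) := castSucc_zx (0 : Fin 1)
    have e4 : on Fin.castSucc (at' (0 : Fin 1) U.1) = at' (0 : Fin 2) U.1 := castSucc_at 0 U.1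
    have e5 : z (Fin.last (n + 1)) = zx n (1 : Fin 2) := rfl
    rw [map_mul, map_mul, map_mul, map_mul, e1, e2, e3, e4, e5]
    have h01 : (0 : Fin 2) ≠ 1 := by decide
    have hz := commute_zx_zx (n := n) h01
    have h1 := castAdd_test U (1 : Fin 2)
    have h2 := z_X_C_z (natAdd_ne (n := n) h01)
    have h3 := at_copy U.2.pre h01
    have h4 := at_sq U.2.pre (0 : Fin 2)
    have h5 : Commute (at' (0 : Fin 2) U.1) (zx n 1) := commute_at_zx _ h01
    have h6 : Commute (at' (0 : Fin 2) U.1) (xx n 1) := commute_at_xx _ h01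
    have h7 : cx n (0 : Fin 2) 1 * zx n 0 = zx n 0 := C_mul_z (natAdd_ne h01)
    have h8 : cx n (0 : Fin 2) 1 * cx n 0 1 = 1 := cx_sq h01
    have h9 : Commute (at' (1 : Fin 2) U.1) (zx n 0) := commute_at_zx _ h01.symm
    have h10 := (U.2.comm U.2).at (0 : Fin 2) 1
    have h11 : Commute (zx n (0 : Fin 2)) (xx n 1) := commute_z_X (natAdd_ne h01)
    rw [mul_assoc, hz.eq, ← mul_assoc, h1, mul_assoc _ (zx n (0 : Fin 2)), hz.eq]
    change zx n 1 * xx n 1 * cx n 0 1 * zx n 1 = ox n 0 * zx n 1 at h2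
    generalize at' (0 : Fin 2) U.1 = u at *
    generalize at' (1 : Fin 2) U.1 = v at *
    generalize zx n (0 : Fin 2) = z0 at *
    generalize zx n (1 : Fin 2) = z1 at *
    generalize xx n (1 : Fin 2) = x1 at *
    generalize cx n (0 : Fin 2) 1 = c at *
    generalize ox n (0 : Fin 2) = o0 at *
    have k1 : u * c * u = v * c := by
      calc u * c * u = u * (c * u * c) * c := by
            simp only [mul_assoc]; rw [h8, mul_one]
        _ = u * u * v * c := by rw [h3]; simp only [mul_assoc]
        _ = v * c := by rw [h4, one_mul]
    symm
    calc u * o0 * u * (z1 * z0) = u * (o0 * z1) * u * z0 := by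
          rw [← mul_assoc, mul_assoc (u * o0), h5.eq]; simp only [mul_assoc]
      _ = z1 * x1 * (u * c * u) * z1 * z0 := by
          rw [← h2]
          simp only [← mul_assoc]
          rw [h5.eq, mul_assoc z1 u, h6.eq]
          simp only [mul_assoc]
          rw [← mul_assoc z1 u, ← h5.eq]
          simp only [mul_assoc]
      _ = z1 * x1 * v * (c * z0) * z1 := by
          rw [k1, mul_assoc _ z1 z0, ← hz.eq]; simp only [mul_assoc]
      _ = z1 * (x1 * v) * z1 * z0 := by
          rw [h7, mul_assoc _ z0 z1, hz.eq]; simp only [mul_assoc]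
  have hz : at' a (zx n (0 : Fin 1)) = zx n a := lift_zx (injective_vec1 a) (0 : Fin 1)
  have ho : at' a (ox n (0 : Fin 1)) = ox n a := by
    rw [at', on_o (lift_injective (injective_vec1 a)), lift_natAdd]
    rfl
  have h2 := congrArg (at' a) base
  rw [map_mul, map_mul, map_mul, map_mul, hz, ho, at_zero] at h2
  rw [← h2, at']
  exact congrArg (· * _) (lift_castSucc _ a).symm

theorem castAdd_three_cancel {f g : Gate n}
    (h : on (Fin.castAdd 3) f * zx n (0 : Fin 3) * (zx n 1 * zx n 2) =
      on (Fin.castAdd 3) g * zx n 0 * (zx n 1 * zx n 2)) : f = g := by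
  have e (f : Gate n) : up2 (on (Fin.castAdd 1) f * zx n (0 : Fin 1)) =
      on (Fin.castAdd 3) f * zx n (0 : Fin 3) := by
    have hz : up2 (zx n (0 : Fin 1)) = zx n (0 : Fin 3) := lift_zx (Fin.castAdd_injective _ _) _
    rw [map_mul, hz, up2, on_on (Fin.castAdd_injective _ _)
      (lift_injective (Fin.castAdd_injective _ _))]
    congr 3
    funext x
    exact lift_castAdd _ x
  refine on_mul_z_cancel (Fin.castAdd_injective n 1) (a := Fin.natAdd n 0)
    (fun i => castAdd_ne_natAdd i 0) (up2_cancel (j := 1) ?_)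
  rw [e, e]
  exact h

/-- The postselected Toffoli gate inside the test of the product is, by `z_X_T_z`, the restriction
of both ancillas to 1. What remains is compute both, restrict both, uncompute both, and this splits
into two tests of the form `castAdd_test'`. -/
theorem test_mul (U V : Oracle n) : test (U * V) = test U * test V := by
  have hP := mulO_spec (U.2.comp V.2) (show (1 : Fin 3) ≠ 2 by decide)
    (show (1 : Fin 3) ≠ 0 by decide) (show (2 : Fin 3) ≠ 0 by decide)
  have hUV := castAdd_test (U * V) (0 : Fin 3)
  have hU := castAdd_test' U (1 : Fin 3)
  have hV := castAdd_test' V (2 : Fin 3)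
  have hT : zx n (0 : Fin 3) * xx n 0 * tx n 1 2 0 * zx n 0 = ox n 1 * ox n 2 * zx n 0 :=
    z_X_T_z (natAdd_ne (by decide)) (natAdd_ne (by decide)) (natAdd_ne (by decide))
  have hz12 := commute_zx_zx (n := n) (show (1 : Fin 3) ≠ 2 by decide)
  have hz01 := commute_zx_zx (n := n) (show (0 : Fin 3) ≠ 1 by decide)
  have hz02 := commute_zx_zx (n := n) (show (0 : Fin 3) ≠ 2 by decide)
  have huz : Commute (at' (1 : Fin 3) U.1) (zx n 0) := commute_at_zx _ (by decide)
  have hvz : Commute (at' (2 : Fin 3) V.1) (zx n 0) := commute_at_zx _ (by decide)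
  have hux : Commute (at' (1 : Fin 3) U.1) (xx n 0) := commute_at_xx _ (by decide)
  have hvx : Commute (at' (2 : Fin 3) V.1) (xx n 0) := commute_at_xx _ (by decide)
  have huz2 : Commute (at' (1 : Fin 3) U.1) (zx n 2) := commute_at_zx _ (by decide)
  have hvz1 : Commute (at' (2 : Fin 3) V.1) (zx n 1) := commute_at_zx _ (by decide)
  have huv := (U.2.comm V.2).at (1 : Fin 3) 2
  have huo : Commute (at' (1 : Fin 3) U.1) (ox n 2) := commute_at_ox _ (by decide)
  have hvo : Commute (at' (2 : Fin 3) V.1) (ox n 1) := commute_at_ox _ (by decide)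
  have hzo : Commute (zx n (1 : Fin 3)) (ox n 2) :=
    (commute_o_z (natAdd_ne (by decide))).symm
  have hVz : Commute (on (Fin.castAdd 3) (test V)) (zx n 1) :=
    (commute_z_on (Fin.castAdd_injective _ _) (fun i => (castAdd_ne_natAdd i _).symm) _).symm
  have key : on (Fin.castAdd 3) (test (U * V)) * zx n 0 * (zx n 1 * zx n 2) =
      on (Fin.castAdd 3) (test U * test V) * zx n 0 * (zx n 1 * zx n 2) := by
    rw [Oracle.val_mul] at hUV
    rw [hUV, map_mul]
    rw [prodAt] at hP
    generalize at' (1 : Fin 3) U.1 = u at *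
    generalize at' (2 : Fin 3) V.1 = v at *
    generalize at' (0 : Fin 3) (mulO U.1 V.1) = w at *
    generalize zx n (0 : Fin 3) = z0 at *
    generalize zx n (1 : Fin 3) = z1 at *
    generalize zx n (2 : Fin 3) = z2 at *
    generalize xx n (0 : Fin 3) = x0 at *
    generalize tx n (1 : Fin 3) 2 0 = t at *
    generalize ox n (1 : Fin 3) = o1 at *
    generalize ox n (2 : Fin 3) = o2 at *
    generalize on (Fin.castAdd 3) (test U) = τ at *
    generalize on (Fin.castAdd 3) (test V) = σ at *
    have hz0 : Commute z0 (z1 * z2) := hz01.mul_right hz02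
    symm
    calc τ * σ * z0 * (z1 * z2) = τ * (σ * z1) * z2 * z0 := by
          rw [mul_assoc _ z0, hz0.eq]; simp only [mul_assoc]
      _ = (τ * z1) * (σ * z2) * z0 := by rw [hVz.eq]; simp only [mul_assoc]
      _ = u * o1 * u * (z1 * v) * o2 * v * z2 * z0 := by rw [hU, hV]; simp only [mul_assoc]
      _ = u * o1 * u * v * (z1 * o2) * v * z2 * z0 := by rw [← hvz1.eq]; simp only [mul_assoc]
      _ = u * o1 * (u * v) * o2 * (z1 * v) * z2 * z0 := by rw [hzo.eq]; simp only [mul_assoc]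
      _ = u * (o1 * v) * (u * o2) * v * z1 * z2 * z0 := by
          rw [← hvz1.eq, huv.eq]; simp only [mul_assoc]
      _ = u * v * o1 * o2 * (u * v) * z1 * z2 * z0 := by
          rw [← hvo.eq, huo.eq]; simp only [mul_assoc]
      _ = u * v * (o1 * o2 * z0) * v * u * (z1 * z2) := by
          rw [huv.eq, mul_assoc _ z1 z2, mul_assoc _ (z1 * z2) z0, ← hz0.eq]
          simp only [mul_assoc]
          rw [← mul_assoc u z0, huz.eq, mul_assoc z0, ← mul_assoc v z0, hvz.eq]
          simp only [mul_assoc]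
      _ = z0 * x0 * (u * v * t * v * u * (z1 * z2)) * z0 := by
          have hA : Commute (u * v) z0 := huz.mul_left hvz
          have hB : Commute (u * v) x0 := hux.mul_left hvx
          have hC : Commute (v * u) z0 := hvz.mul_left huz
          rw [← hT]
          calc u * v * (z0 * x0 * t * z0) * v * u * (z1 * z2)
              = (u * v) * z0 * x0 * t * (z0 * (v * u)) * (z1 * z2) := by simp only [mul_assoc]
            _ = z0 * ((u * v) * x0) * t * (v * u) * (z0 * (z1 * z2)) := by
              rw [hA.eq, ← hC.eq]; simp only [mul_assoc]
            _ = z0 * x0 * (u * v * t * v * u * (z1 * z2)) * z0 := by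
              rw [hB.eq, hz0.eq]; simp only [mul_assoc]
      _ = z0 * (x0 * w) * z0 * (z1 * z2) := by
          rw [← hP, mul_assoc _ z0, hz0.eq]; simp only [mul_assoc]
  exact castAdd_three_cancel key

end TOF

/-! ### Mirror images are partial inverses. -/

namespace TOF

open Circuit

section

variable {n m k : ℕ}

/-- The oracle on the right is the disjunction: it vanishes exactly where both do. -/
theorem zeroTest_mul (U V : Oracle n) :
    zeroTest U * zeroTest V = zeroTest (1 + (1 + U) * (1 + V)) := by
  rw [zeroTest_eq, zeroTest_eq, zeroTest_eq, ← test_mul, ← add_assoc, Oracle.add_self, zero_add]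

theorem zeroTest_zero : zeroTest (0 : Oracle n) = 1 := by
  rw [zeroTest, Oracle.val_zero, one_eq, Category.id_comp, K_B, one_eq]

theorem test_var (x : Fin n) : test (Oracle.var x) = o x := by
  refine on_mul_z_cancel (Fin.castAdd_injective n 1) (a := Fin.natAdd n 0)
    (fun i => castAdd_ne_natAdd i 0) ?_
  have h := castAdd_test (Oracle.var x) (0 : Fin 1)
  rw [at_zero, Oracle.val_var, ← mul_assoc] at h
  rw [on_o (Fin.castAdd_injective _ _), ← z_X_C_z (castAdd_ne_natAdd _ _)]
  exact h

theorem Tracks.comp_zeroTest {f : mk n ⟶ mk m} {U : Oracle m} {U' : Oracle n}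
    (h : Tracks f U U') : f ≫ zeroTest U = zeroTest U' ≫ f := by
  have h1 := slide_K f 0
  have h2 := slide_B f 0
  rw [tens_unit] at h1 h2
  have h3 : f ≫ K m = K n ≫ (f ⊗' 𝟙 (mk 1)) := h1
  have h4 : (f ⊗' 𝟙 (mk 1)) ≫ B m = B n ≫ f := h2
  rw [zeroTest, zeroTest, ← Category.assoc, h3, Category.assoc, ← Category.assoc (tens f _), h,
    Category.assoc, h4, Category.assoc, Category.assoc]

/-- The map `g` is a partial inverse of `f` whose domain is given by an oracle, and oracles after
`f` are oracles before `f`. -/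
structure PartialInverse (f : mk n ⟶ mk m) (g : mk m ⟶ mk n) : Prop where
  intro ::
  tracks : ∀ U, ∃ U', Tracks f U U'
  comp_eq : ∃ U, f ≫ g = zeroTest U
  regular : f ≫ g ≫ f = f

/-- The domain of the second map is a test between `f` and `g`. Pulled back along `f` it becomes a
test in front, and tests are closed under composition. -/
theorem PartialInverse.comp {f : mk n ⟶ mk m} {g : mk m ⟶ mk n} {f' : mk m ⟶ mk k}
    {g' : mk k ⟶ mk m} (h : PartialInverse f g) (h' : PartialInverse f' g') :
    PartialInverse (f ≫ f') (g' ≫ g) := by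
  obtain ⟨V, hV⟩ := h.comp_eq
  obtain ⟨U, hU⟩ := h'.comp_eq
  obtain ⟨U', ht⟩ := h.tracks U
  have e := ht.comp_zeroTest
  refine ⟨fun W => ?_, ⟨1 + (1 + U') * (1 + V), ?_⟩, ?_⟩
  · obtain ⟨W', hW'⟩ := h'.tracks W
    obtain ⟨W'', hW''⟩ := h.tracks W'
    exact ⟨W'', hW'.comp hW''⟩
  · rw [← zeroTest_mul, mul_eq, ← hV, ← Category.assoc (zeroTest U'), ← e, ← hU]
    simp only [Category.assoc]
  · calc (f ≫ f') ≫ (g' ≫ g) ≫ f ≫ f' = f ≫ (f' ≫ g') ≫ g ≫ f ≫ f' := by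
          simp only [Category.assoc]
      _ = zeroTest U' ≫ (f ≫ g ≫ f) ≫ f' := by
          rw [hU, ← Category.assoc f, e]; simp only [Category.assoc]
      _ = (f ≫ zeroTest U) ≫ f' := by rw [h.regular, e, Category.assoc]
      _ = f ≫ f' ≫ g' ≫ f' := by rw [← hU]; simp only [Category.assoc]
      _ = f ≫ f' := by rw [h'.regular]

theorem PartialInverse.of_iso {f : mk n ⟶ mk m} {g : mk m ⟶ mk n} (h : f ≫ g = 𝟙 _)
    (hf : ∀ i, ∃ U', Tracks f (Oracle.var i) U') : PartialInverse f g :=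
  ⟨exists_tracks hf, ⟨0, by rw [h, zeroTest_zero, one_eq]⟩,
    by rw [← Category.assoc, h, Category.id_comp]⟩

theorem partialInverse_pm (σ : Fin n ≃ Fin m) : PartialInverse (pm σ) (pm σ.symm) :=
  .of_iso (pm_comp_symm σ) fun i => ⟨_, by
    have := tracks_pm σ (σ.symm i)
    rwa [Equiv.apply_symm_apply] at this⟩

theorem PartialInverse.conj {n' m' : ℕ} {f : mk n ⟶ mk m} {g : mk m ⟶ mk n}
    (h : PartialInverse f g) (σ : Fin n' ≃ Fin n) (τ : Fin m ≃ Fin m') :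
    PartialInverse (pm σ ≫ f ≫ pm τ) (pm τ.symm ≫ g ≫ pm σ.symm) := by
  rw [← Category.assoc (pm τ.symm)]
  exact (partialInverse_pm σ).comp (h.comp (partialInverse_pm τ))

theorem B1_eq (n : ℕ) : B1 n = X (Fin.last n) ≫ B n := by
  have h : B n = X (Fin.last n) ≫ B1 n := by
    rw [B, b0_eq, id_tens_comp, X, last_eq_natAdd, on_natAdd]
    rfl
  rw [h, ← Category.assoc, ← mul_eq, X_mul_self, one_eq, Category.id_comp]

theorem partialInverse_K1 (n : ℕ) : PartialInverse (K1 n) (B1 n) := by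
  refine .of_iso (K1_B1 n) fun i => ?_
  rw [K1_eq]
  refine Fin.lastCases ?_ (fun i => ?_) i
  · exact ⟨_, (tracks_X _).comp ((Tracks.one _).add (tracks_K_last n))⟩
  · exact ⟨_, (tracks_X_of_ne (last_ne_castSucc i)).comp (tracks_K i)⟩

theorem partialInverse_B1 (n : ℕ) : PartialInverse (B1 n) (K1 n) := by
  refine ⟨exists_tracks fun i => ?_, ⟨1 + Oracle.var (Fin.last n), ?_⟩, ?_⟩
  · rw [B1_eq]
    exact ⟨_, (tracks_B i).comp (tracks_X_of_ne (last_ne_castSucc i))⟩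
  · rw [B1_K1, ← test_var, test_eq]
  · rw [K1_B1, Category.comp_id]

theorem partialInverse_T {a b c : Fin n} (hab : a ≠ b) (hac : a ≠ c) (hbc : b ≠ c) :
    PartialInverse (T a b c) (T a b c) := by
  refine .of_iso (T_mul_self hab hac hbc) fun i => ?_
  by_cases h : i = c
  · rw [h]
    exact ⟨_, tracks_T hab hac hbc⟩
  · exact ⟨_, tracks_T_of_ne hab hac hbc h⟩

/-- Partial inverses for circuits that are placed below further wires. -/
def StablePartialInverse (f : mk n ⟶ mk m) (g : mk m ⟶ mk n) : Prop :=
  ∀ r, PartialInverse (𝟙 (mk r) ⊗' f) (𝟙 (mk r) ⊗' g)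

theorem StablePartialInverse.tens_id {f : mk n ⟶ mk m} {g : mk m ⟶ mk n}
    (h : StablePartialInverse f g) (r : ℕ) :
    PartialInverse (f ⊗' 𝟙 (mk r)) (g ⊗' 𝟙 (mk r)) := by
  have e {n m : ℕ} (f : mk n ⟶ mk m) : f ⊗' 𝟙 (mk r) =
      pm (finAddFlip (m := n) (n := r)) ≫ (𝟙 (mk r) ⊗' f) ≫ pm finAddFlip.symm := by
    rw [← Category.assoc, ← swap_natural, Category.assoc, pm_comp_symm, Category.comp_id]
  rw [e f, e g]
  exact (h r).conj _ _

theorem StablePartialInverse.id_tens {f : mk n ⟶ mk m} {g : mk m ⟶ mk n}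
    (h : StablePartialInverse f g) (r : ℕ) :
    StablePartialInverse (𝟙 (mk r) ⊗' f) (𝟙 (mk r) ⊗' g) := by
  intro s
  have e {n m : ℕ} (f : mk n ⟶ mk m) : 𝟙 (mk s) ⊗' (𝟙 (mk r) ⊗' f) =
      pm (finCongr (Nat.add_assoc s r n)).symm ≫ (𝟙 (mk (s + r)) ⊗' f) ≫
        pm (finCongr (Nat.add_assoc s r m)) := by
    rw [← id_tens_id, tens_assoc, pm_symm_comp_assoc]
  rw [e f, e g]
  exact (h (s + r)).conj _ _

/-- A juxtaposition is a composite of maps that each act on one block of wires. This is why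
stability under further wires is carried through the induction. -/
theorem StablePartialInverse.tens {n' m' : ℕ} {f : mk n ⟶ mk m} {g : mk m ⟶ mk n}
    {f' : mk n' ⟶ mk m'} {g' : mk m' ⟶ mk n'} (h : StablePartialInverse f g)
    (h' : StablePartialInverse f' g') : StablePartialInverse (f ⊗' f') (g ⊗' g') := by
  intro r
  have e {n m n' m' : ℕ} (f : mk n ⟶ mk m) (f' : mk n' ⟶ mk m') : 𝟙 (mk r) ⊗' (f ⊗' f') =
      pm (finCongr (Nat.add_assoc r n n')).symm ≫ ((𝟙 (mk r) ⊗' f) ⊗' f') ≫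
        pm (finCongr (Nat.add_assoc r m m')) := by
    rw [tens_assoc, pm_symm_comp_assoc]
  rw [e f, e g]
  refine PartialInverse.conj ?_ _ _
  rw [tens_eq_comp, tens_eq_comp' _ g']
  exact ((h.id_tens r).tens_id n').comp (h' (r + m))

theorem stablePartialInverse_dagger (c : Circuit n m) :
    StablePartialInverse (ofCircuit c) (ofCircuit c.dagger) := by
  induction c with
  | perm σ =>
    intro r
    have := partialInverse_pm (permSum (Equiv.refl (Fin r)) σ)
    rw [← pm_tens, pm_refl] at this
    refine (congrArg (PartialInverse _) ?_).mp this
    exact (pm_tens (Equiv.refl (Fin r)) σ.symm).symm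
  | ket1 => exact partialInverse_K1
  | bra1 => exact partialInverse_B1
  | tof =>
    intro r
    have e : 𝟙 (mk r) ⊗' ofCircuit Circuit.tof =
        T (Fin.natAdd r (0 : Fin 3)) (Fin.natAdd r 1) (Fin.natAdd r 2) := by
      rw [← on_natAdd, ← on_T (Fin.natAdd_injective _ _) (by decide) (by decide) (by decide), T_012]
      rfl
    rw [dagger, e]
    exact partialInverse_T (natAdd_ne (by decide)) (natAdd_ne (by decide)) (natAdd_ne (by decide))
  | comp f g hf hg =>
    intro r
    rw [dagger, ofCircuit_comp, ofCircuit_comp, id_tens_comp, id_tens_comp]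
    exact (hf r).comp (hg r)
  | tensor f g hf hg => exact hf.tens hg

theorem partialInverse_dagger (c : Circuit n m) :
    PartialInverse (ofCircuit c) (ofCircuit c.dagger) := by
  have := (stablePartialInverse_dagger c).tens_id 0
  rwa [tens_unit, tens_unit] at this

end

end TOF

/-! ### Soundness of the interpretation by partial functions on bits. -/

namespace TOF

open Circuit

section eval

/-- The partial function on bits that a circuit computes. -/
def eval : {n m : ℕ} → Circuit n m → (Fin n → Bool) → Option (Fin m → Bool)
  | _, _, perm σ, x => some (x ∘ σ.symm)
  | _, _, ket1, _ => some fun _ => true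
  | _, _, bra1, x => if x 0 then some Fin.elim0 else none
  | _, _, Circuit.tof, x => some ![x 0, x 1, xor (x 2) (x 0 && x 1)]
  | _, _, Circuit.comp f g, x => (eval f x).bind (eval g)
  | _, _, @Circuit.tensor n _ n' _ f g, x => (eval f (x ∘ Fin.castAdd n')).bind fun y =>
      (eval g (x ∘ Fin.natAdd n)).map (Fin.append y)

theorem eval_comp {n m k : ℕ} (f : Circuit n m) (g : Circuit m k) (x : Fin n → Bool) :
    eval (f ⨾ g) x = (eval f x).bind (eval g) := rfl

theorem eval_comp_eq {n m k : ℕ} (f : Circuit n m) (g : Circuit m k) :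
    eval (f ⨾ g) = fun x => (eval f x).bind (eval g) := rfl

theorem eval_tensor {n m n' m' : ℕ} (f : Circuit n m) (g : Circuit n' m')
    (x : Fin (n + n') → Bool) : eval (f ⊠ g) x = (eval f (x ∘ Fin.castAdd n')).bind fun y =>
      (eval g (x ∘ Fin.natAdd n)).map (Fin.append y) := rfl

theorem eval_perm {n m : ℕ} (σ : Fin n ≃ Fin m) (x : Fin n → Bool) :
    eval (perm σ) x = some (x ∘ σ.symm) := rfl

/-- The output `y` is characterized on the chosen wires and on the idle ones, so the bijection
`wiring` need never be evaluated. -/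
theorem eval_on {k n : ℕ} {f : Circuit k k} {ι : Fin k → Fin n} (h : Function.Injective ι)
    {x y : Fin n → Bool} (hf : eval f (x ∘ ι) = some (y ∘ ι)) (hy : ∀ i, i ∉ Set.range ι → x i = y i) :
    eval (f.on ι h) x = some y := by
  have h1 : (x ∘ (wiring ι h).symm.symm) ∘ Fin.castAdd (n - k) = x ∘ ι := by
    funext i
    simp [wiring_castAdd]
  have h2 : Fin.append (y ∘ ι) ((x ∘ (wiring ι h).symm.symm) ∘ Fin.natAdd k) ∘ (wiring ι h).symm =
      y := by
    funext i
    obtain ⟨i, rfl⟩ := (wiring ι h).surjective i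
    induction i using Fin.addCases with
    | left i =>
      rw [Function.comp_apply, Equiv.symm_apply_apply, Fin.append_left, wiring_castAdd]
      rfl
    | right i =>
      simp only [Function.comp_apply, Equiv.symm_apply_apply, Fin.append_right, Equiv.symm_symm]
      apply hy
      rintro ⟨j, hj⟩
      rw [← wiring_castAdd ι h] at hj
      exact absurd ((wiring ι h).injective hj) (by simp [Fin.ext_iff]; omega)
  rw [Circuit.on, eval_comp, eval_perm, Option.bind_some, eval_comp, eval_tensor, h1, hf, idn,
    eval_perm, Option.bind_some, Option.map_some, Option.bind_some, eval_perm]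
  exact congrArg some h2

theorem eval_tof_on {n : ℕ} {ι : Fin 3 → Fin n} (h : Function.Injective ι) (x : Fin n → Bool) :
    eval (tof.on ι h) x =
      some (Function.update x (ι 2) (xor (x (ι 2)) (x (ι 0) && x (ι 1)))) := by
  refine eval_on h ?_ fun i hi => ?_
  · refine congrArg some ?_
    funext j
    fin_cases j <;> simp [Function.update, h.eq_iff]
  · rw [Function.update_of_ne]
    rintro rfl
    exact hi ⟨2, rfl⟩

theorem eval_tof_on_eq {n : ℕ} {ι : Fin 3 → Fin n} (h : Function.Injective ι) :
    eval (tof.on ι h) =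
      fun x => some (Function.update x (ι 2) (xor (x (ι 2)) (x (ι 0) && x (ι 1)))) :=
  funext (eval_tof_on h)

theorem eval_cnot (x : Fin 2 → Bool) : eval Circuit.cnot x = some ![x 0, xor (x 1) (x 0)] := by
  revert x
  decide

theorem eval_cnot_on {n : ℕ} {ι : Fin 2 → Fin n} (h : Function.Injective ι) (x : Fin n → Bool) :
    eval (cnot.on ι h) x = some (Function.update x (ι 1) (xor (x (ι 1)) (x (ι 0)))) := by
  refine eval_on h ?_ fun i hi => ?_
  · rw [eval_cnot]
    refine congrArg some ?_
    funext j
    fin_cases j <;> simp [Function.update, h.eq_iff]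
  · rw [Function.update_of_ne]
    rintro rfl
    exact hi ⟨1, rfl⟩

theorem eval_cnot_on_eq {n : ℕ} {ι : Fin 2 → Fin n} (h : Function.Injective ι) :
    eval (cnot.on ι h) =
      fun x => some (Function.update x (ι 1) (xor (x (ι 1)) (x (ι 0)))) :=
  funext (eval_cnot_on h)

theorem eval_cnot3 (x : Fin 4 → Bool) :
    eval cnot3 x = some ![x 0, x 1, x 2, xor (x 3) (x 0 && x 1 && x 2)] := by
  simp only [cnot3, eval_comp_eq, eval_tof_on_eq]
  revert x
  decide

theorem eval_of_rel {n m : ℕ} {c d : Circuit n m} (h : Rel c d) (x : Fin n → Bool) :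
    eval c x = eval d x := by
  induction h with
  | refl f => rfl
  | symm _ ih => exact (ih x).symm
  | trans _ _ ih₁ ih₂ => exact (ih₁ x).trans (ih₂ x)
  | comp _ _ ih₁ ih₂ => rw [eval_comp, eval_comp, ih₁, funext ih₂]
  | tensor _ _ ih₁ ih₂ => rw [eval_tensor, eval_tensor, ih₁, ih₂]
  | assoc f g h =>
    rw [eval_comp, eval_comp, eval_comp, Option.bind_assoc]
    rfl
  | id_comp f => rfl
  | comp_id f =>
    rw [eval_comp]
    cases eval f x <;> rfl
  | perm_comp σ τ => rfl
  | perm_tensor σ τ =>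
    refine congrArg some ?_
    funext i
    obtain ⟨i, rfl⟩ := (permSum σ τ).surjective i
    induction i using Fin.addCases <;> rw [Function.comp_apply, Equiv.symm_apply_apply] <;> simp
  | interchange f g f' g' =>
    simp only [eval_comp, eval_tensor]
    cases eval f (x ∘ Fin.castAdd _) with
    | none => rfl
    | some a =>
      cases eval f' (x ∘ Fin.natAdd _) with
      | none => simp
      | some b =>
        simp only [Option.bind_some, Option.map_some, eval_tensor]
        congr 1
        · congr 1
          funext i
          simp
        · funext y
          congr 2
          funext i
          simp
  | tensor_assoc f g h =>
    have e1 : ∀ {n₁ n₂ n₃ : ℕ} (x : Fin (n₁ + n₂ + n₃) → Bool),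
        (x ∘ (finCongr (Nat.add_assoc n₁ n₂ n₃)).symm) ∘ Fin.castAdd (n₂ + n₃) =
          (x ∘ Fin.castAdd n₃) ∘ Fin.castAdd n₂ := fun _ => rfl
    have e2 : ∀ {n₁ n₂ n₃ : ℕ} (x : Fin (n₁ + n₂ + n₃) → Bool),
        ((x ∘ (finCongr (Nat.add_assoc n₁ n₂ n₃)).symm) ∘ Fin.natAdd n₁) ∘ Fin.castAdd n₃ =
          (x ∘ Fin.castAdd n₃) ∘ Fin.natAdd n₁ := fun _ => rfl
    have e3 : ∀ {n₁ n₂ n₃ : ℕ} (x : Fin (n₁ + n₂ + n₃) → Bool),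
        ((x ∘ (finCongr (Nat.add_assoc n₁ n₂ n₃)).symm) ∘ Fin.natAdd n₁) ∘ Fin.natAdd n₂ =
          x ∘ Fin.natAdd (n₁ + n₂) := by
      intro n₁ n₂ n₃ x
      funext i
      refine congrArg x ?_
      ext
      simp [Nat.add_assoc]
    simp only [eval_comp, eval_tensor, wire, eval_perm, Option.bind_some]
    rw [e1, e2, e3]
    cases eval f _ with
    | none => rfl
    | some a =>
      cases eval g _ with
      | none => rfl
      | some b =>
        cases eval h _ with
        | none => rfl
        | some c =>
          simp only [Option.bind_some, Option.map_some, eval_perm]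
          refine congrArg some ?_
          rw [Fin.append_assoc]
          funext i
          simp
  | unit_tensor f =>
    have e : (x ∘ (finCongr (Nat.zero_add _)).symm) = x ∘ Fin.natAdd 0 := by
      funext i
      refine congrArg x ?_
      ext
      simp
    simp only [eval_comp, eval_tensor, wire, idn, eval_perm, Option.bind_some]
    rw [e]
    cases eval f _ with
    | none => rfl
    | some a =>
      refine congrArg some ?_
      funext i
      have : (finCongr (Nat.zero_add _)).symm i = Fin.natAdd 0 i := by ext; simp
      rw [Function.comp_apply, this, Fin.append_right]
  | tensor_unit f =>
    rw [eval_tensor]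
    show (eval f x).bind _ = _
    cases eval f x with
    | none => rfl
    | some a =>
      refine congrArg some ?_
      funext i
      exact Fin.append_left _ _ i
  | @swap_natural n m n' m' f g =>
    have f1 : ∀ {n n' : ℕ} (i : Fin n'),
        (finAddFlip (m := n) (n := n')).symm (Fin.castAdd n i) = Fin.natAdd n i := by
      intro n n' i
      rw [Equiv.symm_apply_eq, finAddFlip_apply_natAdd]
    have f2 : ∀ {n n' : ℕ} (i : Fin n),
        (finAddFlip (m := n) (n := n')).symm (Fin.natAdd n' i) = Fin.castAdd n' i := by
      intro n n' i
      rw [Equiv.symm_apply_eq, finAddFlip_apply_castAdd]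
    have e1 : (x ∘ (finAddFlip (m := n) (n := n')).symm) ∘ Fin.castAdd n = x ∘ Fin.natAdd n := by
      funext i
      exact congrArg x (f1 i)
    have e2 : (x ∘ (finAddFlip (m := n) (n := n')).symm) ∘ Fin.natAdd n' = x ∘ Fin.castAdd n' := by
      funext i
      exact congrArg x (f2 i)
    simp only [eval_comp, eval_tensor, Circuit.swap, eval_perm, Option.bind_some]
    rw [e1, e2]
    cases eval f _ with
    | none => cases eval g _ <;> rfl
    | some a =>
      cases eval g _ with
      | none => rfl
      | some b =>
        refine congrArg some ?_
        funext i
        induction i using Fin.addCases <;> simp [f1, f2]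
  | tof1 => revert x; decide
  | tof1' => revert x; decide
  | tof2 => revert x; decide
  | tof2' => revert x; decide
  | tof3 => simp only [eval_comp_eq, eval_tof_on_eq]; revert x; decide
  | tof4 => simp only [eval_comp_eq, eval_tof_on_eq]; revert x; decide
  | tof5 => simp only [eval_comp_eq, eval_tof_on_eq]; revert x; decide
  | tof5' => simp only [eval_comp_eq, eval_tof_on_eq]; revert x; decide
  | tof6 => simp only [eval_comp_eq, eval_cnot_on_eq]; revert x; decide
  | tof7 => revert x; decide
  | tof8 => revert x; decide
  | tof9 => revert x; decide
  | tof10 => simp only [eval_comp_eq, eval_tof_on_eq]; revert x; decide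
  | tof11 => simp only [eval_comp_eq, eval_tof_on_eq, eval_cnot_on_eq]; revert x; decide
  | tof12 => simp only [eval_comp_eq, eval_tof_on_eq]; revert x; decide
  | tof13 => simp only [eval_comp_eq, eval_tof_on_eq, eval_cnot_on_eq]; revert x; decide
  | tof14 => simp only [eval_comp_eq, eval_cnot_on_eq]; revert x; decide
  | tof15 => simp only [eval_tof_on_eq]; revert x; decide
  | tof16 =>
    -- The function computed by `cnot3` is symmetric in its controls, so its own output serves for
    -- the permuted gate.
    rw [eval_on (y := ![x 0, x 1, x 2, xor (x 3) (x 0 && x 1 && x 2)]), eval_cnot3]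
    · rw [eval_cnot3]; revert x; decide
    · intro i; revert x; revert i; decide

end eval

end TOF

/-! ### Idempotents, polyforms and their polynomials. -/

namespace TOF

open Circuit

section normal_form

variable {n m : ℕ}

theorem dagger_dagger (c : Circuit n m) : c.dagger.dagger = c := by
  induction c with
  | comp f g hf hg => rw [dagger, dagger, hf, hg]
  | tensor f g hf hg => rw [dagger, dagger, hf, hg]
  | _ => rfl

theorem zeroTest_mul_self (U : Oracle n) : zeroTest U * zeroTest U = zeroTest U := by
  rw [zeroTest_eq, ← test_mul, Oracle.mul_self]

theorem zeroTest_comm (U V : Oracle n) : zeroTest U * zeroTest V = zeroTest V * zeroTest U := by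
  rw [zeroTest_eq, zeroTest_eq, ← test_mul, ← test_mul, mul_comm]

theorem isPolyform_iff (e : Gate n) : IsPolyform e ↔ ∃ U, e = zeroTest U := by
  constructor
  · rintro ⟨q, ⟨l, rfl⟩, rfl⟩
    refine ⟨(l.map fun S => ∏ i ∈ S, Oracle.var i).sum, ?_⟩
    rw [ofCircuit_polyCircuit]
    rfl
  · rintro ⟨U, rfl⟩
    obtain ⟨l, rfl⟩ := exists_list U
    refine ⟨_, ⟨l, rfl⟩, ?_⟩
    rw [ofCircuit_polyCircuit]
    rfl

theorem exists_mul_dagger (c : Circuit n n) :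
    (∃ U, ofCircuit c * ofCircuit c.dagger = zeroTest U) ∧
    (∃ V, ofCircuit c.dagger * ofCircuit c = zeroTest V) ∧
    ofCircuit c * ofCircuit c.dagger * ofCircuit c = ofCircuit c ∧
    ofCircuit c.dagger * ofCircuit c * ofCircuit c.dagger = ofCircuit c.dagger := by
  have h := partialInverse_dagger c
  have h' := partialInverse_dagger c.dagger
  rw [dagger_dagger] at h'
  exact ⟨h.comp_eq, h'.comp_eq, (Category.assoc _ _ _).trans h.regular,
    (Category.assoc _ _ _).trans h'.regular⟩

/-- For an idempotent c one has c° = c° c c° = (c° c)(c c°), and both brackets are tests. -/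
theorem dagger_eq_zeroTest {c : Circuit n n} (h : ofCircuit c * ofCircuit c = ofCircuit c) :
    ∃ U, ofCircuit c.dagger = zeroTest U := by
  obtain ⟨⟨U, hU⟩, ⟨V, hV⟩, -, hd⟩ := exists_mul_dagger c
  refine ⟨1 + (1 + V) * (1 + U), ?_⟩
  rw [← zeroTest_mul, ← hU, ← hV]
  conv_lhs => rw [← hd, ← h]
  simp only [mul_assoc]

/-- The mirror image is a test, hence idempotent, so the same argument applies to it and returns to
`e`. -/
theorem isPolyform_of_mul_self {e : Gate n} (h : e * e = e) : IsPolyform e := by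
  obtain ⟨c, rfl⟩ := exists_ofCircuit e
  obtain ⟨W, hW⟩ := dagger_eq_zeroTest h
  have := dagger_eq_zeroTest (c := c.dagger) (by rw [hW, zeroTest_mul_self])
  rwa [dagger_dagger, ← isPolyform_iff] at this

/-- For every circuit c presenting the test e, the mirror image is a test v. Since tests commute, e
= e v e = e v, which is c c°. -/
theorem isRestrictionIdempotent_zeroTest (U : Oracle n) :
    IsRestrictionIdempotent (zeroTest U) := by
  intro c hc
  have h : ofCircuit c * ofCircuit c = ofCircuit c := by rw [hc, zeroTest_mul_self]
  obtain ⟨V, hV⟩ := dagger_eq_zeroTest h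
  obtain ⟨-, -, hr, -⟩ := exists_mul_dagger c
  rw [← hc, ofCircuit_comp, ← mul_eq]
  conv_rhs => rw [← hr, mul_assoc, hV, hc, zeroTest_comm, ← mul_assoc, zeroTest_mul_self]
  rw [hV, hc]

theorem Oracle.two_eq_zero : ((2 : ℕ) : Oracle n) = 0 := by
  rw [Nat.cast_ofNat, ← one_add_one_eq_two, Oracle.add_self]

/-- The oracle of a polynomial. -/
noncomputable def ofPoly (n : ℕ) : MvPolynomial (Fin n) (ZMod 2) →+* Oracle n :=
  MvPolynomial.eval₂Hom (ZMod.castHom (ringChar.dvd Oracle.two_eq_zero) (Oracle n)) Oracle.var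

theorem ofPoly_polynomial (l : List (Finset (Fin n))) :
    ofPoly n (polynomial l) = (l.map fun S => ∏ i ∈ S, Oracle.var i).sum := by
  rw [polynomial, map_list_sum, List.map_map]
  congr 2
  funext S
  simp [ofPoly]

theorem sandwichZero_polyCircuit (l : List (Finset (Fin n))) :
    sandwichZero (ofCircuit (polyCircuit l)) = zeroTest (ofPoly n (polynomial l)) := by
  rw [ofCircuit_polyCircuit, ofPoly_polynomial]
  rfl

/-- The wires are prepared with the coordinates of `x`; pulling back along this map evaluates
variables at `x`, and `g` removes the wires again. -/
theorem exists_point : ∀ {n : ℕ} (x : Fin n → ZMod 2), ∃ (f : mk 0 ⟶ mk n) (g : mk n ⟶ mk 0),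
    f ≫ g = 𝟙 _ ∧ ∀ i, Tracks f (Oracle.var i) (if x i = 0 then 0 else 1)
  | 0, _ => ⟨𝟙 _, 𝟙 _, Category.comp_id _, fun i => i.elim0⟩
  | n + 1, x => by
    obtain ⟨f, g, h, hf⟩ := exists_point fun i => x i.castSucc
    by_cases hx : x (Fin.last n) = 0
    · refine ⟨f ≫ K n, B n ≫ g, ?_, fun i => ?_⟩
      · rw [Category.assoc, K_B_assoc, h]
      · refine Fin.lastCases ?_ (fun i => ?_) i
        · rw [if_pos hx]
          exact (tracks_K_last n).comp (Tracks.zero f)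
        · exact (tracks_K i).comp (hf i)
    · refine ⟨f ≫ K1 n, B1 n ≫ g, ?_, fun i => ?_⟩
      · rw [Category.assoc, ← Category.assoc (K1 n), K1_B1, Category.id_comp, h]
      · rw [K1_eq]
        refine Fin.lastCases ?_ (fun i => ?_) i
        · rw [if_neg hx]
          refine ((tracks_X _).comp ((Tracks.one _).add (tracks_K_last n))).comp ?_
          rw [add_zero]
          exact Tracks.one f
        · exact ((tracks_X_of_ne (last_ne_castSucc i)).comp (tracks_K i)).comp (hf i)

theorem zmod_two_cases (a : ZMod 2) : a = 0 ∨ a = 1 := by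
  revert a
  decide

theorem tracks_ofPoly {x : Fin n → ZMod 2} {f : mk 0 ⟶ mk n}
    (hf : ∀ i, Tracks f (Oracle.var i) (if x i = 0 then 0 else 1))
    (p : MvPolynomial (Fin n) (ZMod 2)) :
    Tracks f (ofPoly n p) (if MvPolynomial.eval x p = 0 then 0 else 1) := by
  have e : ∀ a : ZMod 2, (if a = 0 then (0 : Oracle 0) else 1) =
      ZMod.castHom (ringChar.dvd Oracle.two_eq_zero) (Oracle 0) a := by
    intro a
    obtain rfl | rfl := zmod_two_cases a
    · rw [if_pos rfl, map_zero]
    · rw [if_neg (by decide), map_one]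
  simp only [e] at hf ⊢
  induction p using MvPolynomial.induction_on with
  | C a =>
    obtain rfl | rfl := zmod_two_cases a
    · simpa using Tracks.zero f
    · rw [map_one MvPolynomial.C, map_one, map_one, map_one]
      exact Tracks.one f
  | add p q hp hq =>
    rw [map_add, map_add, map_add]
    exact hp.add hq
  | mul_X p i hp =>
    rw [map_mul, map_mul, map_mul, MvPolynomial.eval_X]
    refine hp.mul ?_
    simpa [ofPoly] using hf i

/-- The scalar |1⟩ followed by ⟨0| is the nowhere defined partial function, while the identity is
defined; soundness of `eval` separates them. -/
theorem zeroTest_one_ne : zeroTest (1 : Oracle 0) ≠ 1 := by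
  intro h
  have h1 : ofCircuit ((idn 0 ⊠ ket1) ⨾ (idn 0 ⊠ bra0)) = ofCircuit (idn 0) := by
    rw [← show zeroTest (1 : Oracle 0) = ofCircuit (idn 0) from h]
    show K1 0 ≫ B 0 = _
    rw [K1_eq, Category.assoc]
    rfl
  have h2 := eval_of_rel (rel_of_ofCircuit_eq h1) Fin.elim0
  revert h2
  decide

/-- Between the point `x` and its inverse, a test becomes the scalar test of the value at `x`, and
the scalars of 0 and 1 differ. -/
theorem eval_eq_of_zeroTest_eq {p q : MvPolynomial (Fin n) (ZMod 2)}
    (h : zeroTest (ofPoly n p) = zeroTest (ofPoly n q)) (x : Fin n → ZMod 2) :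
    MvPolynomial.eval x p = MvPolynomial.eval x q := by
  obtain ⟨f, g, hfg, hf⟩ := exists_point x
  have e (p : MvPolynomial (Fin n) (ZMod 2)) : f ≫ zeroTest (ofPoly n p) ≫ g =
      zeroTest (if MvPolynomial.eval x p = 0 then 0 else 1) := by
    rw [← Category.assoc, (tracks_ofPoly hf p).comp_zeroTest, Category.assoc, hfg,
      Category.comp_id]
  have h1 := (e p).symm.trans ((congrArg (fun t => f ≫ t ≫ g) h).trans (e q))
  obtain hp | hp := zmod_two_cases (MvPolynomial.eval x p) <;>
    obtain hq | hq := zmod_two_cases (MvPolynomial.eval x q) <;> rw [hp, hq] at h1 ⊢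
  · rw [if_pos rfl, if_neg (by decide), zeroTest_zero] at h1
    exact absurd h1.symm zeroTest_one_ne
  · rw [if_pos rfl, if_neg (by decide), zeroTest_zero] at h1
    exact absurd h1 zeroTest_one_ne

theorem polynomial_mem_restrictDegree (l : List (Finset (Fin n))) :
    polynomial l ∈ MvPolynomial.restrictDegree (Fin n) (ZMod 2) 1 := by
  rw [polynomial]
  refine (MvPolynomial.restrictDegree (Fin n) (ZMod 2) 1).toAddSubmonoid.list_sum_mem ?_
  intro p hp
  obtain ⟨S, -, rfl⟩ := List.mem_map.1 hp
  refine (MvPolynomial.mem_restrictDegree _ _ _).2 fun s hs i => ?_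
  refine (MvPolynomial.degreeOf_le_iff.1 ((MvPolynomial.degreeOf_prod_le i S _).trans ?_)) s hs
  simp only [MvPolynomial.degreeOf_X]
  rw [Finset.sum_ite_eq]
  split_ifs <;> simp

/-- Over a field with two elements a polynomial of degree at most 1 in each variable that vanishes
at all points is zero; this is applied to the difference. -/
theorem polynomial_eq_iff (l l' : List (Finset (Fin n))) :
    sandwichZero (ofCircuit (polyCircuit l)) = sandwichZero (ofCircuit (polyCircuit l')) ↔
      polynomial l = polynomial l' := by
  rw [sandwichZero_polyCircuit, sandwichZero_polyCircuit]
  refine ⟨fun h => ?_, fun h => by rw [h]⟩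
  refine sub_eq_zero.1 (MvPolynomial.eq_zero_of_eval_eq_zero (Fin n) (ZMod 2) _ (fun x => ?_) ?_)
  · rw [map_sub, eval_eq_of_zeroTest_eq h, sub_self]
  · exact Submodule.sub_mem _ (polynomial_mem_restrictDegree l) (polynomial_mem_restrictDegree l')

end normal_form

end TOF

/-- Polyforms are a normal form for the idempotents of `TOF`: every polyform is an idempotent, and
in fact a restriction idempotent; every idempotent is a polyform; and two polyforms agree exactly
when their polynomials over `ℤ/2` agree. -/
theorem mainTheorem3 :
    (∀ (n : ℕ) (e : TOF.mk n ⟶ TOF.mk n), TOF.IsPolyform e →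
      e ≫ e = e ∧ TOF.IsRestrictionIdempotent e) ∧
    (∀ (n : ℕ) (e : TOF.mk n ⟶ TOF.mk n), e ≫ e = e → TOF.IsPolyform e) ∧
    (∀ (n : ℕ) (l l' : List (Finset (Fin n))),
      TOF.sandwichZero (TOF.ofCircuit (Circuit.polyCircuit l)) =
          TOF.sandwichZero (TOF.ofCircuit (Circuit.polyCircuit l')) ↔
        Circuit.polynomial l = Circuit.polynomial l') := by
  refine ⟨fun n e he => ?_, fun n e he => TOF.isPolyform_of_mul_self he,
    fun n l l' => TOF.polynomial_eq_iff l l'⟩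
  obtain ⟨U, rfl⟩ := (TOF.isPolyform_iff e).1 he
  exact ⟨TOF.zeroTest_mul_self U, TOF.isRestrictionIdempotent_zeroTest U⟩
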